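/- **Setting.** Let $\mathcal{S}$ be a supercategory: a well-powered, complete, $\mathbb{Q}$-linear abelian category with a biadditive symmetric monoidal product $\otimes$ with unit $I$, together with a chosen object $P$ such that $\Lambda^2(P)\cong I$ (a chosen isomorphism) and $S^2(P)\cong 0$. We also assume that countable direct sums exist in $\mathcal S$ and that $X\otimes(-)$ is right exact and commutes with countable direct sums for every $X$. (Example: superspaces over a field of characteristic $0$.) Algebras are associative and unital, and algebras, Lie algebras and modules are formed inside a symmetric monoidal category. For a Lie algebra $K$, $\mathrm{Mod}(K)$ denotes the symmetric monoidal category of $K$-modules, and $M\mapsto M^K$ is the right adjoint of the functor which equips an object with the zero action of $K$; it carries algebras to algebras. **Cohomology.** Let $Q$ be $P$ regarded as an abelian Lie algebra, and $\mathcal{Q}=\mathrm{Mod}(Q)$; its objects are pairs $(X,d)$, where $X\in\mathcal S$ and $d:P\otimes X\to X$ is an odd endomorphism with $d^2=0$. Put $H^{\mathcal Q}(X)=\ker d/\operatorname{im} d$; if $X$ is an algebra in $\mathcal Q$, this is an algebra in $\mathcal S$. Let $D=S(P)=I\oplus P$ be the commutative algebra in $\mathcal Q$ whose differential vanishes on $I$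 and is the odd map $P\to I$ given by $P\otimes P=\Lambda^2(P)\cong I$ on $P$. Let $L_0$ be a Lie algebra in $\mathcal S$, let $L=D\otimes L_0$ (a Lie algebra in $\mathcal Q$; here $L_0$ carries $d=0$), and let $\mathcal L=\mathrm{Mod}(L)$ be the category of $L$-modules in $\mathcal Q$. For $X$ in $\mathcal L$ put $H(X)=H^{\mathcal Q}(X^L)$; if $X$ is an algebra in $\mathcal L$, then $H(X)$ is an algebra in $\mathcal S$. **Quadratic case.** Suppose that $L_0$ is rigid (it has a dual $L_0^*$) and quadratic: there is given an isomorphism $L_0^*\cong L_0$ of $L_0$-modules for which the corresponding invariant bilinear form $B:L_0\otimes L_0\to I$ is symmetric. Let $M_L=I\oplus L$ be the unital Lie algebra in $\mathcal L$ which is the central extension $0\to I\to M_L\to L\to 0$ given by the cocycle that pairs the component $P\otimes L_0$ of $L$ with itself by $P\otimes P\cong I$ and $B$ and vanishes on the other components; $L$ acts on $M_L$ through the adjoint action. Let $E_L$ be the unital enveloping algebra of $M_L$: the algebra in $\mathcal L$ which is universal among algebras that receive a Lie algebra morphism from $M_L$ carrying $I\to M_L$ to the unit. Let $U(L_0)$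 be the universal enveloping algebra of $L_0$ in $\mathcal S$, on which $L_0$ acts by the adjoint action. **Proposition.** The algebras $U(L_0)$ in $\mathcal S$ and $E_L$ in $\mathcal L$ exist, and there is an isomorphism of algebras in $\mathcal S$ $$H(E_L)\;\cong\; U(L_0)^{L_0}.$$ -/

import Mathlib

open CategoryTheory MonoidalCategory Limits
universe v u
noncomputable section
set_option linter.unusedSectionVars false
namespace SuperCat
section General
variable {C : Type u} [Category.{v} C] [Preadditive C] [MonoidalCategory C] [MonoidalPreadditive C]
  [SymmetricCategory C]

/-- A Lie algebra in a symmetric monoidal preadditive category. The Jacobi identity reads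
`[x, [y, z]] = [[x, y], z] + [y, [x, z]]`. -/
structure LieObj (C : Type u) [Category.{v} C] [Preadditive C] [MonoidalCategory C]
    [SymmetricCategory C] where
  X : C
  bracket : X ⊗ X ⟶ X
  skew : (β_ X X).hom ≫ bracket = -bracket
  jacobi : X ◁ bracket ≫ bracket =
    (α_ X X X).inv ≫ bracket ▷ X ≫ bracket +
      (α_ X X X).inv ≫ (β_ X X).hom ▷ X ≫ (α_ X X X).hom ≫ X ◁ bracket ≫ bracket

/-- A module over a Lie algebra: `[x, y] m = x (y m) - y (x m)`. -/
structure LieMod (L : LieObj C) where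
  X : C
  act : L.X ⊗ X ⟶ X
  bracket_act : L.bracket ▷ X ≫ act =
    (α_ L.X L.X X).hom ≫ L.X ◁ act ≫ act -
      (β_ L.X L.X).hom ▷ X ≫ (α_ L.X L.X X).hom ≫ L.X ◁ act ≫ act

lemma whiskerLeft_neg' (X : C) {Y Z : C} (f : Y ⟶ Z) : X ◁ (-f) = -(X ◁ f) :=
  (tensorLeft X).map_neg

lemma whiskerLeft_sub' (X : C) {Y Z : C} (f g : Y ⟶ Z) : X ◁ (f - g) = X ◁ f - X ◁ g :=
  (tensorLeft X).map_sub

lemma neg_whiskerRight' (X : C) {Y Z : C} (f : Y ⟶ Z) : (-f) ▷ X = -(f ▷ X) :=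
  (tensorRight X).map_neg

lemma sub_whiskerRight' (X : C) {Y Z : C} (f g : Y ⟶ Z) : (f - g) ▷ X = f ▷ X - g ▷ X :=
  (tensorRight X).map_sub

/-- The action of `A` on the first factor of `X ⊗ Y`. -/
def actL {A X : C} (a : A ⊗ X ⟶ X) (Y : C) : A ⊗ (X ⊗ Y) ⟶ X ⊗ Y :=
  (α_ A X Y).inv ≫ a ▷ Y

/-- The action of `A` on the second factor of `X ⊗ Y`. -/
def actR {A Y : C} (X : C) (b : A ⊗ Y ⟶ Y) : A ⊗ (X ⊗ Y) ⟶ X ⊗ Y :=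
  (α_ A X Y).inv ≫ (β_ A X).hom ▷ Y ≫ (α_ X A Y).hom ≫ X ◁ b

lemma neg_tensor' {W X Y Z : C} (f : W ⟶ X) (g : Y ⟶ Z) : ((-f) ⊗ₘ g) = -(f ⊗ₘ g) := by
  simp [MonoidalCategory.tensorHom_def, neg_whiskerRight']

lemma tensor_neg' {W X Y Z : C} (f : W ⟶ X) (g : Y ⟶ Z) : (f ⊗ₘ (-g)) = -(f ⊗ₘ g) := by
  simp [MonoidalCategory.tensorHom_def, whiskerLeft_neg']

lemma actL_add {A X : C} (a b : A ⊗ X ⟶ X) (Y : C) : actL (a + b) Y = actL a Y + actL b Y := by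
  simp [actL]

lemma actR_add {A Y : C} (X : C) (a b : A ⊗ Y ⟶ Y) : actR X (a + b) = actR X a + actR X b := by
  simp [actR]

lemma actL_zero {A X : C} (Y : C) : actL (0 : A ⊗ X ⟶ X) Y = 0 := by
  simp [actL]

lemma actR_zero {A Y : C} (X : C) : actR X (0 : A ⊗ Y ⟶ Y) = 0 := by
  simp [actR]

lemma actL_actL {A B X Y : C} (a : A ⊗ X ⟶ X) (b : B ⊗ X ⟶ X) :
  (α_ A B (X ⊗ Y)).hom ≫ A ◁ actL b Y ≫ actL a Y =
    (α_ (A ⊗ B) X Y).inv ≫ ((α_ A B X).hom ≫ A ◁ b ≫ a) ▷ Y := by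
  simp [actL]

lemma actL_actR {A B X Y : C} (a : A ⊗ X ⟶ X) (b : B ⊗ Y ⟶ Y) :
    (α_ A B (X ⊗ Y)).hom ≫ A ◁ actR X b ≫ actL a Y =
      (β_ A B).hom ▷ (X ⊗ Y) ≫ (α_ B A (X ⊗ Y)).hom ≫ B ◁ actL a Y ≫ actR X b := by
  have h1 : A ◁ X ◁ b ≫ (α_ A X Y).inv ≫ a ▷ Y =
      (α_ A X (B ⊗ Y)).inv ≫ a ▷ (B ⊗ Y) ≫ X ◁ b := by
    rw [← whisker_exchange, associator_inv_naturality_right_assoc]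
  have h2 : B ◁ a ▷ Y ≫ (α_ B X Y).inv ≫ (β_ B X).hom ▷ Y =
      (α_ B (A ⊗ X) Y).inv ≫ (β_ B (A ⊗ X)).hom ▷ Y ≫ a ▷ B ▷ Y := by
    rw [associator_inv_naturality_middle_assoc, ← comp_whiskerRight, ← comp_whiskerRight,
      BraidedCategory.braiding_naturality_right]
  simp only [actL, actR, MonoidalCategory.whiskerLeft_comp, Category.assoc, h1, reassoc_of% h2]
  simp only [BraidedCategory.braiding_tensor_right_hom, comp_whiskerRight, Category.assoc]
  have h3 : (β_ A B).hom ▷ (X ⊗ Y) ≫ (α_ B A (X ⊗ Y)).hom ≫ B ◁ (α_ A X Y).inv ≫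
      (α_ B (A ⊗ X) Y).inv ≫ (α_ B A X).inv ▷ Y ≫ (β_ B A).hom ▷ X ▷ Y =
        (α_ _ _ _).inv := by
    have : (α_ B A (X ⊗ Y)).hom ≫ B ◁ (α_ A X Y).inv ≫
      (α_ B (A ⊗ X) Y).inv ≫ (α_ B A X).inv ▷ Y = (α_ _ _ _).inv := by monoidal
    rw [reassoc_of% this, associator_inv_naturality_left_assoc, ← comp_whiskerRight,
      ← comp_whiskerRight, SymmetricCategory.symmetry]
    simp
  rw [reassoc_of% h3]
  simp only [← MonoidalCategory.whiskerLeft_comp_assoc]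
  monoidal

lemma actR_actR {A B X Y : C} (a : A ⊗ Y ⟶ Y) (b : B ⊗ Y ⟶ Y) :
    (α_ A B (X ⊗ Y)).hom ≫ A ◁ actR X b ≫ actR X a =
      (α_ (A ⊗ B) X Y).inv ≫ (β_ (A ⊗ B) X).hom ▷ Y ≫ (α_ X (A ⊗ B) Y).hom ≫
        X ◁ ((α_ A B Y).hom ≫ A ◁ b ≫ a) := by
  have h1 : A ◁ X ◁ b ≫ (α_ A X Y).inv ≫ (β_ A X).hom ▷ Y =
      (α_ A X (B ⊗ Y)).inv ≫ (β_ A X).hom ▷ (B ⊗ Y) ≫ (X ⊗ A) ◁ b := by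
    rw [← whisker_exchange, associator_inv_naturality_right_assoc]
  simp only [actR, MonoidalCategory.whiskerLeft_comp, Category.assoc, reassoc_of% h1]
  simp [BraidedCategory.braiding_tensor_left_hom]

lemma actL_whiskerRight {A X X' : C} {a : A ⊗ X ⟶ X} {a' : A ⊗ X' ⟶ X'} {f : X ⟶ X'}
    (h : A ◁ f ≫ a' = a ≫ f) (Y : C) : A ◁ f ▷ Y ≫ actL a' Y = actL a Y ≫ f ▷ Y := by
  simp only [actL, Category.assoc, ← comp_whiskerRight, ← h]
  simp

lemma actR_whiskerRight {A X X' Y : C} (b : A ⊗ Y ⟶ Y) (f : X ⟶ X') :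
    A ◁ f ▷ Y ≫ actR X' b = actR X b ≫ f ▷ Y := by
  have h2 : A ◁ f ▷ Y ≫ (α_ A X' Y).inv ≫ (β_ A X').hom ▷ Y =
      (α_ A X Y).inv ≫ (β_ A X).hom ▷ Y ≫ f ▷ A ▷ Y := by
    rw [associator_inv_naturality_middle_assoc, ← comp_whiskerRight, ← comp_whiskerRight,
      BraidedCategory.braiding_naturality_right]
  simp only [actR, Category.assoc, reassoc_of% h2, whisker_exchange]
  simp

lemma actL_whiskerLeft {A X Y Y' : C} (a : A ⊗ X ⟶ X) (f : Y ⟶ Y') :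
    A ◁ X ◁ f ≫ actL a Y' = actL a Y ≫ X ◁ f := by
  simp only [actL, Category.assoc, ← whisker_exchange]
  simp

lemma actR_whiskerLeft {A Y Y' : C} (X : C) {b : A ⊗ Y ⟶ Y} {b' : A ⊗ Y' ⟶ Y'} {f : Y ⟶ Y'}
    (h : A ◁ f ≫ b' = b ≫ f) : A ◁ X ◁ f ≫ actR X b' = actR X b ≫ X ◁ f := by
  simp only [actR, Category.assoc, ← MonoidalCategory.whiskerLeft_comp, ← h]
  have h1 : A ◁ X ◁ f ≫ (α_ A X Y').inv ≫ (β_ A X).hom ▷ Y' =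
      (α_ A X Y).inv ≫ (β_ A X).hom ▷ Y ≫ (X ⊗ A) ◁ f := by
    rw [← whisker_exchange, associator_inv_naturality_right_assoc]
  rw [reassoc_of% h1]
  simp

lemma actL_associator {A X : C} (a : A ⊗ X ⟶ X) (Y Z : C) :
    A ◁ (α_ X Y Z).hom ≫ actL a (Y ⊗ Z) = actL (actL a Y) Z ≫ (α_ X Y Z).hom := by
  simp [actL]

lemma actM_associator {A Y : C} (X : C) (b : A ⊗ Y ⟶ Y) (Z : C) :
    A ◁ (α_ X Y Z).hom ≫ actR X (actL b Z) = actL (actR X b) Z ≫ (α_ X Y Z).hom := by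
  simp [actL, actR]

lemma actR_associator {A Z : C} (X Y : C) (c : A ⊗ Z ⟶ Z) :
    A ◁ (α_ X Y Z).hom ≫ actR X (actR Y c) = actR (X ⊗ Y) c ≫ (α_ X Y Z).hom := by
  simp [actR, BraidedCategory.braiding_tensor_right_hom]

lemma actL_rightUnitor {A X : C} (a : A ⊗ X ⟶ X) :
    A ◁ (ρ_ X).hom ≫ a = actL a (𝟙_ C) ≫ (ρ_ X).hom := by
  simp [actL]

lemma actR_leftUnitor {A X : C} (a : A ⊗ X ⟶ X) :
    A ◁ (λ_ X).hom ≫ a = actR (𝟙_ C) a ≫ (λ_ X).hom := by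
  simp [actR]

lemma actL_braiding {A X Y : C} (a : A ⊗ X ⟶ X) :
    A ◁ (β_ X Y).hom ≫ actR Y a = actL a Y ≫ (β_ X Y).hom := by
  simp only [actL, actR, Category.assoc, BraidedCategory.braiding_naturality_left,
    BraidedCategory.braiding_tensor_left_hom]
  simp

lemma actR_braiding {A X Y : C} (b : A ⊗ Y ⟶ Y) :
    A ◁ (β_ X Y).hom ≫ actL b X = actR X b ≫ (β_ X Y).hom := by
  rw [← cancel_mono (β_ Y X).hom, Category.assoc, ← actL_braiding, Category.assoc,
    SymmetricCategory.symmetry, ← MonoidalCategory.whiskerLeft_comp_assoc,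
    SymmetricCategory.symmetry]
  simp

variable {L : LieObj C}

namespace LieMod

@[ext]
structure Hom (M N : LieMod L) where
  hom : M.X ⟶ N.X
  comm : L.X ◁ hom ≫ N.act = M.act ≫ hom

attribute [simp] Hom.comm

@[simps]
instance : Category (LieMod L) where
  Hom M N := Hom M N
  id M := ⟨𝟙 _, by simp⟩
  comp f g := ⟨f.hom ≫ g.hom, by
    rw [MonoidalCategory.whiskerLeft_comp, Category.assoc, g.comm, reassoc_of% f.comm]⟩

@[ext]
lemma hom_ext {M N : LieMod L} {f g : M ⟶ N} (h : f.hom = g.hom) : f = g := Hom.ext h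

variable (L) in
@[simps]
def forget : LieMod L ⥤ C where
  obj M := M.X
  map f := f.hom

instance : (forget L).Faithful where
  map_injective h := hom_ext h

@[simps]
def isoMk {M N : LieMod L} (e : M.X ≅ N.X) (h : L.X ◁ e.hom ≫ N.act = M.act ≫ e.hom) :
    M ≅ N where
  hom := ⟨e.hom, h⟩
  inv := ⟨e.inv, by
    rw [← cancel_mono e.hom, Category.assoc, ← h, ← MonoidalCategory.whiskerLeft_comp_assoc]
    simp⟩

instance (M N : LieMod L) : Zero (M ⟶ N) := ⟨⟨0, by simp⟩⟩
instance (M N : LieMod L) : Add (M ⟶ N) := ⟨fun f g => ⟨f.hom + g.hom, by simp⟩⟩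
instance (M N : LieMod L) : Neg (M ⟶ N) := ⟨fun f => ⟨-f.hom, by simp [whiskerLeft_neg']⟩⟩
instance (M N : LieMod L) : Sub (M ⟶ N) := ⟨fun f g => ⟨f.hom - g.hom, by simp [whiskerLeft_sub']⟩⟩
@[simp] lemma zero_hom (M N : LieMod L) : (0 : M ⟶ N).hom = 0 := rfl
@[simp] lemma add_hom {M N : LieMod L} (f g : M ⟶ N) : (f + g).hom = f.hom + g.hom := rfl
@[simp] lemma neg_hom {M N : LieMod L} (f : M ⟶ N) : (-f).hom = -f.hom := rfl
@[simp] lemma sub_hom {M N : LieMod L} (f g : M ⟶ N) : (f - g).hom = f.hom - g.hom := rfl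

instance (M N : LieMod L) : AddCommGroup (M ⟶ N) where
  add_assoc _ _ _ := by ext; simp [add_assoc]
  zero_add _ := by ext; simp
  add_zero _ := by ext; simp
  add_comm _ _ := by ext; simp [add_comm]
  neg_add_cancel _ := by ext; simp
  sub_eq_add_neg _ _ := by ext; simp [sub_eq_add_neg]
  nsmul := nsmulRec
  zsmul := zsmulRec

instance : Preadditive (LieMod L) where

instance : (forget L).Additive where

/-- The tensor product of modules, with the action `x (m ⊗ n) = x m ⊗ n + m ⊗ x n`; the unit object is
`𝟙_ C` with the zero action. -/
instance : MonoidalCategoryStruct (LieMod L) where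
  tensorObj M N :=
    { X := M.X ⊗ N.X
      act := actL M.act N.X + actR M.X N.act
      bracket_act := by
        have h3 := actL_actR M.act N.act
        have h4 := (β_ L.X L.X).hom ▷ (M.X ⊗ N.X) ≫= actL_actR M.act N.act
        rw [← comp_whiskerRight_assoc, SymmetricCategory.symmetry, id_whiskerRight,
          Category.id_comp] at h4
        have h1 : L.bracket ▷ (M.X ⊗ N.X) ≫ actL M.act N.X =
            (α_ L.X L.X (M.X ⊗ N.X)).hom ≫ L.X ◁ actL M.act N.X ≫ actL M.act N.X -
              (β_ L.X L.X).hom ▷ (M.X ⊗ N.X) ≫ (α_ L.X L.X (M.X ⊗ N.X)).hom ≫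
                L.X ◁ actL M.act N.X ≫ actL M.act N.X := by
          rw [actL_actL, actL, associator_inv_naturality_left_assoc, ← comp_whiskerRight,
            M.bracket_act, sub_whiskerRight', Preadditive.comp_sub,
            associator_inv_naturality_left_assoc, ← comp_whiskerRight]
        have h2 : L.bracket ▷ (M.X ⊗ N.X) ≫ actR M.X N.act =
            (α_ L.X L.X (M.X ⊗ N.X)).hom ≫ L.X ◁ actR M.X N.act ≫ actR M.X N.act -
              (β_ L.X L.X).hom ▷ (M.X ⊗ N.X) ≫ (α_ L.X L.X (M.X ⊗ N.X)).hom ≫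
                L.X ◁ actR M.X N.act ≫ actR M.X N.act := by
          have key : ∀ f : L.X ⊗ L.X ⟶ L.X ⊗ L.X, f ▷ (M.X ⊗ N.X) ≫ (α_ _ _ _).inv ≫
              (β_ _ _).hom ▷ N.X ≫ (α_ _ _ _).hom =
              (α_ _ _ _).inv ≫ (β_ _ _).hom ▷ N.X ≫ (α_ _ _ _).hom ≫ M.X ◁ f ▷ N.X := by
            intro f
            rw [associator_inv_naturality_left_assoc, ← comp_whiskerRight_assoc,
              BraidedCategory.braiding_naturality_left, comp_whiskerRight_assoc,
              associator_naturality_middle]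
          rw [actR_actR, reassoc_of% key, ← MonoidalCategory.whiskerLeft_comp, actR,
            associator_inv_naturality_left_assoc, ← comp_whiskerRight_assoc,
              BraidedCategory.braiding_naturality_left, comp_whiskerRight_assoc,
              associator_naturality_middle_assoc, ← MonoidalCategory.whiskerLeft_comp,
            N.bracket_act, whiskerLeft_sub', Preadditive.comp_sub, Preadditive.comp_sub,
            Preadditive.comp_sub]
        simp only [Preadditive.comp_add, Preadditive.add_comp,
          MonoidalPreadditive.whiskerLeft_add, h1, h2, ← h3, h4]
        abel }
  tensorUnit := { X := 𝟙_ C, act := 0, bracket_act := by simp }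
  whiskerLeft M _ _ f := ⟨M.X ◁ f.hom, by
    simp [actL_whiskerLeft, actR_whiskerLeft M.X f.comm]⟩
  whiskerRight f N := ⟨f.hom ▷ N.X, by
    simp [actL_whiskerRight f.comm, actR_whiskerRight]⟩
  tensorHom f g := ⟨f.hom ⊗ₘ g.hom, by
    simp [MonoidalCategory.tensorHom_def, actL_whiskerLeft, actR_whiskerLeft _ g.comm,
      reassoc_of% (actL_whiskerRight f.comm), reassoc_of% (actR_whiskerRight)]⟩
  associator M N K := isoMk (α_ M.X N.X K.X) (by
    simp only [actL_add, actR_add, Preadditive.comp_add, Preadditive.add_comp,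
      actL_associator, actR_associator, actM_associator, add_assoc])
  leftUnitor M := isoMk (λ_ M.X) (by
    simp only [actR_leftUnitor, actL_zero, zero_add])
  rightUnitor M := isoMk (ρ_ M.X) (by
    simp only [actL_rightUnitor, actR_zero, add_zero])

section
variable (M N K : LieMod L) {M' N' : LieMod L} (f : M ⟶ M') (g : N ⟶ N')
@[simp] lemma tensorObj_X : (M ⊗ N).X = M.X ⊗ N.X := rfl
lemma tensorObj_act : (M ⊗ N).act = actL M.act N.X + actR M.X N.act := rfl
@[simp] lemma tensorUnit_X : (𝟙_ (LieMod L)).X = 𝟙_ C := rfl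
@[simp] lemma tensorUnit_act : (𝟙_ (LieMod L)).act = 0 := rfl
@[simp] lemma whiskerLeft_hom : (M ◁ g).hom = M.X ◁ g.hom := rfl
@[simp] lemma whiskerRight_hom : (f ▷ N).hom = f.hom ▷ N.X := rfl
@[simp] lemma tensorHom_hom : (f ⊗ₘ g).hom = f.hom ⊗ₘ g.hom := rfl
@[simp] lemma associator_hom_hom : (α_ M N K).hom.hom = (α_ M.X N.X K.X).hom := rfl
@[simp] lemma associator_inv_hom : (α_ M N K).inv.hom = (α_ M.X N.X K.X).inv := rfl
@[simp] lemma leftUnitor_hom_hom : (λ_ M).hom.hom = (λ_ M.X).hom := rfl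
@[simp] lemma leftUnitor_inv_hom : (λ_ M).inv.hom = (λ_ M.X).inv := rfl
@[simp] lemma rightUnitor_hom_hom : (ρ_ M).hom.hom = (ρ_ M.X).hom := rfl
@[simp] lemma rightUnitor_inv_hom : (ρ_ M).inv.hom = (ρ_ M.X).inv := rfl
end

instance : MonoidalCategory (LieMod L) where
  tensorHom_def _ _ := hom_ext (MonoidalCategory.tensorHom_def _ _)
  id_tensorHom_id _ _ := hom_ext (MonoidalCategory.id_tensorHom_id _ _)
  tensorHom_comp_tensorHom _ _ _ _ := hom_ext (MonoidalCategory.tensorHom_comp_tensorHom _ _ _ _)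
  whiskerLeft_id _ _ := hom_ext (MonoidalCategory.whiskerLeft_id _ _)
  id_whiskerRight _ _ := hom_ext (MonoidalCategory.id_whiskerRight _ _)
  associator_naturality _ _ _ := hom_ext (MonoidalCategory.associator_naturality _ _ _)
  leftUnitor_naturality _ := hom_ext (MonoidalCategory.leftUnitor_naturality _)
  rightUnitor_naturality _ := hom_ext (MonoidalCategory.rightUnitor_naturality _)
  pentagon _ _ _ _ := hom_ext (MonoidalCategory.pentagon _ _ _ _)
  triangle _ _ := hom_ext (MonoidalCategory.triangle _ _)

instance : MonoidalPreadditive (LieMod L) where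

instance : BraidedCategory (LieMod L) where
  braiding M N := isoMk (β_ M.X N.X) (by
    rw [tensorObj_act, tensorObj_act, Preadditive.comp_add, Preadditive.add_comp]
    exact (add_comm _ _).trans (congrArg₂ (· + ·) (actL_braiding _) (actR_braiding _)))
  braiding_naturality_right _ _ _ _ := hom_ext (BraidedCategory.braiding_naturality_right _ _)
  braiding_naturality_left _ _ := hom_ext (BraidedCategory.braiding_naturality_left _ _)
  hexagon_forward _ _ _ := hom_ext (BraidedCategory.hexagon_forward _ _ _)
  hexagon_reverse _ _ _ := hom_ext (BraidedCategory.hexagon_reverse _ _ _)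

@[simp] lemma braiding_hom_hom (M N : LieMod L) : (β_ M N).hom.hom = (β_ M.X N.X).hom := rfl

instance : SymmetricCategory (LieMod L) where
  symmetry _ _ := hom_ext (SymmetricCategory.symmetry _ _)

variable (L) in
@[simps]
def trivial : C ⥤ LieMod L where
  obj X := { X := X, act := 0, bracket_act := by simp }
  map f := { hom := f, comm := by simp }

lemma zero_comm {A X Y : C} (f : X ⟶ Y) :
    A ◁ f ≫ (0 : A ⊗ Y ⟶ Y) = (0 : A ⊗ X ⟶ X) ≫ f := by
  simp

lemma trivial_tensor_act (X Y : C) :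
    ((trivial L).obj X ⊗ (trivial L).obj Y).act = 0 := by
  change actL (0 : L.X ⊗ X ⟶ X) Y + actR X (0 : L.X ⊗ Y ⟶ Y) = 0
  rw [actL_zero, actR_zero, add_zero]

variable (L) in
/-- Tensor products of trivial modules are trivial. -/
def trivialMul (X Y : C) :
    (trivial L).obj X ⊗ (trivial L).obj Y ≅ (trivial L).obj (X ⊗ Y) :=
  isoMk (Iso.refl (X ⊗ Y)) ((zero_comm (𝟙 (X ⊗ Y))).trans
    (congrArg (· ≫ 𝟙 (X ⊗ Y)) (trivial_tensor_act (L := L) X Y).symm))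

instance : (trivial L).Additive where

instance : (trivial L).Monoidal :=
  Functor.CoreMonoidal.toMonoidal
    { εIso := isoMk (Iso.refl (𝟙_ C)) (zero_comm (𝟙 (𝟙_ C)))
      μIso := trivialMul L
      μIso_hom_natural_left := fun {X Y} f Z => hom_ext (by
        change f ▷ Z ≫ 𝟙 (Y ⊗ Z) = 𝟙 (X ⊗ Z) ≫ f ▷ Z
        simp)
      μIso_hom_natural_right := fun {X Y} Z f => hom_ext (by
        change Z ◁ f ≫ 𝟙 (Z ⊗ Y) = 𝟙 (Z ⊗ X) ≫ Z ◁ f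
        simp)
      associativity := fun X Y Z => hom_ext (by
        change 𝟙 (X ⊗ Y) ▷ Z ≫ 𝟙 ((X ⊗ Y) ⊗ Z) ≫ (α_ X Y Z).hom =
          (α_ X Y Z).hom ≫ X ◁ 𝟙 (Y ⊗ Z) ≫ 𝟙 (X ⊗ Y ⊗ Z)
        simp)
      left_unitality := fun X => hom_ext (by
        change (λ_ X).hom = 𝟙 (𝟙_ C) ▷ X ≫ 𝟙 (𝟙_ C ⊗ X) ≫ (λ_ X).hom
        simp)
      right_unitality := fun X => hom_ext (by
        change (ρ_ X).hom = X ◁ 𝟙 (𝟙_ C) ≫ 𝟙 (X ⊗ 𝟙_ C) ≫ (ρ_ X).hom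
        simp) }

end LieMod

namespace LieObj

/-- The abelian Lie algebra on an object. -/
@[simps]
def abelian (X : C) : LieObj C where
  X := X
  bracket := 0
  skew := by simp
  jacobi := by simp

/-- The adjoint module of a Lie algebra. -/
@[simps]
def adjoint (L : LieObj C) : LieMod L where
  X := L.X
  act := L.bracket
  bracket_act := by
    have h := congrArg (fun t => (α_ L.X L.X L.X).hom ≫ t) L.jacobi
    simp only [Preadditive.comp_add, Iso.hom_inv_id_assoc] at h
    rw [eq_sub_iff_add_eq]
    exact h.symm

/-- A Lie algebra `K` in `C`, regarded as a Lie algebra in `Mod(L)` with trivial `L`-action. -/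
@[simps]
def withTrivialAction (L K : LieObj C) : LieObj (LieMod L) where
  X := (LieMod.trivial L).obj K.X
  bracket := ⟨K.bracket, (LieMod.zero_comm K.bracket).trans
    (congrArg (· ≫ K.bracket) (LieMod.trivial_tensor_act (L := L) K.X K.X).symm)⟩
  skew := LieMod.hom_ext K.skew
  jacobi := LieMod.hom_ext K.jacobi

end LieObj

section Pairing

lemma braiding_tensorμ (X₁ X₂ Y₁ Y₂ : C) :
    (β_ (X₁ ⊗ X₂) (Y₁ ⊗ Y₂)).hom ≫ tensorμ Y₁ Y₂ X₁ X₂ =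
      tensorμ X₁ X₂ Y₁ Y₂ ≫ ((β_ X₁ Y₁).hom ⊗ₘ (β_ X₂ Y₂).hom) := by
  simp [tensorμ, MonoidalCategory.tensorHom_def, BraidedCategory.braiding_tensor_left_hom,
    BraidedCategory.braiding_tensor_right_hom]
  have h : Y₁ ◁ (β_ X₁ Y₂).hom ▷ X₂ ≫ Y₁ ◁ (β_ Y₂ X₁).hom ▷ X₂ = 𝟙 _ := by
    rw [← MonoidalCategory.whiskerLeft_comp, ← comp_whiskerRight, SymmetricCategory.symmetry]
    simp
  rw [reassoc_of% h]
  simp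

variable {A A' K K' : C}

/-- The map `(a ⊗ x) ⊗ (b ⊗ y) ↦ m(a, b) ⊗ n(x, y)`. -/
def pairing (m : A ⊗ A ⟶ A') (n : K ⊗ K ⟶ K') : (A ⊗ K) ⊗ (A ⊗ K) ⟶ A' ⊗ K' :=
  tensorμ A K A K ≫ (m ⊗ₘ n)

def shuffle (A K : C) : (A ⊗ K) ⊗ ((A ⊗ K) ⊗ (A ⊗ K)) ⟶ (A ⊗ (A ⊗ A)) ⊗ (K ⊗ (K ⊗ K)) :=
  (A ⊗ K) ◁ tensorμ A K A K ≫ tensorμ A K (A ⊗ A) (K ⊗ K)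

lemma assoc_shuffle (A K : C) :
    (α_ (A ⊗ K) (A ⊗ K) (A ⊗ K)).hom ≫ shuffle A K =
      tensorμ A K A K ▷ (A ⊗ K) ≫ tensorμ (A ⊗ A) (K ⊗ K) A K ≫
        ((α_ A A A).hom ⊗ₘ (α_ K K K).hom) :=
  (tensor_associativity A K A K A K).symm

lemma braiding_pairing (m : A ⊗ A ⟶ A') (n : K ⊗ K ⟶ K') :
    (β_ (A ⊗ K) (A ⊗ K)).hom ≫ pairing m n =
      pairing ((β_ A A).hom ≫ m) ((β_ K K).hom ≫ n) := by
  rw [pairing, reassoc_of% (braiding_tensorμ A K A K), tensorHom_comp_tensorHom, pairing]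

lemma pairing_one (m : A ⊗ A ⟶ A) (n : K ⊗ K ⟶ K) (m' : A ⊗ A ⟶ A') (n' : K ⊗ K ⟶ K') :
    (A ⊗ K) ◁ pairing m n ≫ pairing m' n' =
      shuffle A K ≫ ((A ◁ m ≫ m') ⊗ₘ (K ◁ n ≫ n')) := by
  rw [pairing, pairing, MonoidalCategory.whiskerLeft_comp, Category.assoc,
    reassoc_of% (tensorμ_natural_right A K m n), tensorHom_comp_tensorHom, shuffle, Category.assoc]

lemma pairing_two (m : A ⊗ A ⟶ A) (n : K ⊗ K ⟶ K) (m' : A ⊗ A ⟶ A') (n' : K ⊗ K ⟶ K') :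
    (α_ (A ⊗ K) (A ⊗ K) (A ⊗ K)).inv ≫ pairing m n ▷ (A ⊗ K) ≫ pairing m' n' =
      shuffle A K ≫
        (((α_ A A A).inv ≫ m ▷ A ≫ m') ⊗ₘ ((α_ K K K).inv ≫ n ▷ K ≫ n')) := by
  rw [Iso.inv_comp_eq, reassoc_of% (assoc_shuffle A K), tensorHom_comp_tensorHom,
    Iso.hom_inv_id_assoc, Iso.hom_inv_id_assoc, pairing, pairing, comp_whiskerRight,
    Category.assoc, reassoc_of% (tensorμ_natural_left m n A K), tensorHom_comp_tensorHom]

lemma pairing_three (m : A ⊗ A ⟶ A) (n : K ⊗ K ⟶ K) (m' : A ⊗ A ⟶ A') (n' : K ⊗ K ⟶ K') :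
    (α_ (A ⊗ K) (A ⊗ K) (A ⊗ K)).inv ≫ (β_ (A ⊗ K) (A ⊗ K)).hom ▷ (A ⊗ K) ≫
      (α_ (A ⊗ K) (A ⊗ K) (A ⊗ K)).hom ≫ (A ⊗ K) ◁ pairing m n ≫ pairing m' n' =
      shuffle A K ≫
        (((α_ A A A).inv ≫ (β_ A A).hom ▷ A ≫ (α_ A A A).hom ≫ A ◁ m ≫ m') ⊗ₘ
          ((α_ K K K).inv ≫ (β_ K K).hom ▷ K ≫ (α_ K K K).hom ≫ K ◁ n ≫ n')) := by
  rw [Iso.inv_comp_eq, pairing_one, reassoc_of% (assoc_shuffle A K),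
    reassoc_of% (assoc_shuffle A K), tensorHom_comp_tensorHom,
    tensorHom_comp_tensorHom, Iso.hom_inv_id_assoc, Iso.hom_inv_id_assoc,
    ← comp_whiskerRight_assoc, braiding_tensorμ, comp_whiskerRight_assoc,
    reassoc_of% (tensorμ_natural_left (β_ A A).hom (β_ K K).hom A K), tensorHom_comp_tensorHom]

end Pairing

open MonObj

lemma mul_three (A : C) [MonObj A] [IsCommMonObj A] :
    (α_ A A A).inv ≫ (β_ A A).hom ▷ A ≫ (α_ A A A).hom ≫ A ◁ μ[A] ≫ μ[A] = A ◁ μ[A] ≫ μ[A] := by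
  rw [mul_assoc_flip, Iso.hom_inv_id_assoc, ← comp_whiskerRight_assoc, IsCommMonObj.mul_comm]

namespace LieObj

/-- Extension of scalars: for a commutative algebra `A` and a Lie algebra `K`, the Lie algebra
`A ⊗ K` with bracket `[a ⊗ x, b ⊗ y] = a b ⊗ [x, y]`. -/
@[simps]
def extendScalars (A : C) [MonObj A] [IsCommMonObj A] (K : LieObj C) : LieObj C where
  X := A ⊗ K.X
  bracket := pairing μ[A] K.bracket
  skew := by
    rw [braiding_pairing, IsCommMonObj.mul_comm, K.skew, pairing, pairing, tensor_neg',
      Preadditive.comp_neg]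
  jacobi := by
    rw [pairing_three, pairing_one, pairing_two, mul_three, ← mul_assoc_flip,
      ← Preadditive.comp_add, ← MonoidalPreadditive.tensor_add, ← K.jacobi]

/-- An (antisymmetric) `2`-cocycle of a Lie algebra with values in the trivial module `𝟙_ C`. -/
structure IsCocycle (L : LieObj C) (ω : L.X ⊗ L.X ⟶ 𝟙_ C) : Prop where
  skew : (β_ L.X L.X).hom ≫ ω = -ω
  cocycle : L.X ◁ L.bracket ≫ ω =
    (α_ L.X L.X L.X).inv ≫ L.bracket ▷ L.X ≫ ω +
      (α_ L.X L.X L.X).inv ≫ (β_ L.X L.X).hom ▷ L.X ≫ (α_ L.X L.X L.X).hom ≫ L.X ◁ L.bracket ≫ ω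

/-- If `B` is a symmetric invariant form on `K`, and `κ` is an antisymmetric pairing on the
commutative algebra `A` with `κ(a, bc) + κ(b, ac) = κ(ab, c)`, then `κ ⊗ B` is a cocycle of
`A ⊗ K`. -/
lemma isCocycle_extendScalars (A : C) [MonObj A] [IsCommMonObj A] (K : LieObj C)
    (κ : A ⊗ A ⟶ 𝟙_ C) (B : K.X ⊗ K.X ⟶ 𝟙_ C)
    (hκ : (β_ A A).hom ≫ κ = -κ)
    (hκ' : A ◁ μ[A] ≫ κ + (α_ A A A).inv ≫ (β_ A A).hom ▷ A ≫ (α_ A A A).hom ≫ A ◁ μ[A] ≫ κ =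
      (α_ A A A).inv ≫ μ[A] ▷ A ≫ κ)
    (hB : (β_ K.X K.X).hom ≫ B = B)
    (hB' : (α_ K.X K.X K.X).inv ≫ K.bracket ▷ K.X ≫ B + (α_ K.X K.X K.X).inv ≫
      (β_ K.X K.X).hom ▷ K.X ≫ (α_ K.X K.X K.X).hom ≫ K.X ◁ K.bracket ≫ B = 0) :
    IsCocycle (extendScalars A K) (pairing κ B ≫ (λ_ (𝟙_ C)).hom) where
  skew := by
    change (β_ (A ⊗ K.X) (A ⊗ K.X)).hom ≫ pairing κ B ≫ _ = _
    rw [← Category.assoc, braiding_pairing, hκ, hB, pairing, pairing, neg_tensor',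
      Preadditive.comp_neg, Preadditive.neg_comp]
    rfl
  cocycle := by
    have e3 : (α_ K.X K.X K.X).inv ≫ (β_ K.X K.X).hom ▷ K.X ≫ (α_ K.X K.X K.X).hom ≫
        K.X ◁ K.bracket ≫ B = -((α_ K.X K.X K.X).inv ≫ K.bracket ▷ K.X ≫ B) :=
      (neg_eq_of_add_eq_zero_right hB').symm
    have e1 : K.X ◁ K.bracket ≫ B = (α_ K.X K.X K.X).inv ≫ K.bracket ▷ K.X ≫ B := by
      have := congrArg (fun t => (α_ K.X K.X K.X).inv ≫ (β_ K.X K.X).hom ▷ K.X ≫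
        (α_ K.X K.X K.X).hom ≫ t) e3
      simp only [Preadditive.comp_neg, Iso.hom_inv_id_assoc] at this
      rw [← comp_whiskerRight_assoc, ← comp_whiskerRight_assoc, SymmetricCategory.symmetry,
        K.skew, neg_whiskerRight'] at this
      simpa using this
    have key : (A ⊗ K.X) ◁ pairing μ[A] K.bracket ≫ pairing κ B =
        (α_ (A ⊗ K.X) (A ⊗ K.X) (A ⊗ K.X)).inv ≫ pairing μ[A] K.bracket ▷ (A ⊗ K.X) ≫
          pairing κ B +
        (α_ (A ⊗ K.X) (A ⊗ K.X) (A ⊗ K.X)).inv ≫ (β_ (A ⊗ K.X) (A ⊗ K.X)).hom ▷ (A ⊗ K.X) ≫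
        (α_ (A ⊗ K.X) (A ⊗ K.X) (A ⊗ K.X)).hom ≫ (A ⊗ K.X) ◁ pairing μ[A] K.bracket ≫
          pairing κ B := by
      rw [pairing_three, pairing_one, pairing_two, e3, e1, ← Preadditive.comp_add, ← hκ',
        tensor_neg', MonoidalPreadditive.add_tensor, add_neg_cancel_right]
    have key' := congrArg (· ≫ (λ_ (𝟙_ C)).hom) key
    simp only [Preadditive.add_comp, Category.assoc] at key'
    exact key'

end LieObj
/-- A unital Lie algebra: a Lie algebra `X` with a Lie algebra morphism `𝟙_ C ⟶ X`, where `𝟙_ C`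
has zero bracket. -/
structure UnitalLieObj (C : Type u) [Category.{v} C] [Preadditive C] [MonoidalCategory C]
    [SymmetricCategory C] extends LieObj C where
  unit : 𝟙_ C ⟶ X
  unit_bracket : (unit ⊗ₘ unit) ≫ bracket = 0

namespace LieObj
section CentralExtension
variable [HasBinaryBiproducts C] (L : LieObj C) (ω : L.X ⊗ L.X ⟶ 𝟙_ C)

/-- `((s, x), (t, y)) ↦ (ω(x, y), [x, y])` -/
def extBracket : (𝟙_ C ⊞ L.X) ⊗ (𝟙_ C ⊞ L.X) ⟶ 𝟙_ C ⊞ L.X :=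
  (biprod.snd ⊗ₘ biprod.snd) ≫ biprod.lift ω L.bracket

/-- `(x, (t, y)) ↦ (ω(x, y), [x, y])` -/
def extAct : L.X ⊗ (𝟙_ C ⊞ L.X) ⟶ 𝟙_ C ⊞ L.X :=
  L.X ◁ biprod.snd ≫ biprod.lift ω L.bracket

variable {L ω}

lemma extBracket_snd : extBracket L ω ≫ biprod.snd = (biprod.snd ⊗ₘ biprod.snd) ≫ L.bracket := by
  simp [extBracket]

lemma extAct_snd : extAct L ω ≫ biprod.snd = L.X ◁ biprod.snd ≫ L.bracket := by
  simp [extAct]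

lemma lift_jacobi (h : IsCocycle L ω) :
    L.X ◁ L.bracket ≫ biprod.lift ω L.bracket =
      (α_ L.X L.X L.X).inv ≫ L.bracket ▷ L.X ≫ biprod.lift ω L.bracket +
      (α_ L.X L.X L.X).inv ≫ (β_ L.X L.X).hom ▷ L.X ≫ (α_ L.X L.X L.X).hom ≫
        L.X ◁ L.bracket ≫ biprod.lift ω L.bracket := by
  have h1 := h.cocycle
  have h2 := L.jacobi
  apply biprod.hom_ext
  · simpa using h1
  · simpa using h2

variable (L ω) in
/-- The central extension `0 ⟶ 𝟙_ C ⟶ 𝟙_ C ⊞ L ⟶ L ⟶ 0` defined by a cocycle `ω`, as a unital Lie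
algebra in the category of `L`-modules; `L` acts through the adjoint action of the extension. -/
@[simps]
def centralExtension (h : IsCocycle L ω) : UnitalLieObj (LieMod L) where
  X :=
    { X := 𝟙_ C ⊞ L.X
      act := extAct L ω
      bracket_act := by
        have h2 : L.X ◁ extAct L ω ≫ extAct L ω =
            L.X ◁ L.X ◁ biprod.snd ≫ L.X ◁ L.bracket ≫ biprod.lift ω L.bracket := by
          nth_rw 2 [extAct]
          rw [← MonoidalCategory.whiskerLeft_comp_assoc, extAct_snd]
          simp
        have h1 := lift_jacobi h
        rw [← Preadditive.comp_add, Iso.eq_inv_comp] at h1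
        rw [h2, ← associator_naturality_right_assoc, ← whisker_exchange_assoc, extAct,
          ← whisker_exchange_assoc, ← Preadditive.comp_sub]
        congr 1
        rw [eq_sub_iff_add_eq]
        exact h1.symm }
  bracket := ⟨extBracket L ω, by
    have h1 := actL_whiskerRight (A := L.X) (a := extAct L ω) (a' := L.bracket) (f := biprod.snd)
      extAct_snd.symm (𝟙_ C ⊞ L.X)
    have h2 := actR_whiskerLeft (A := L.X) (b := extAct L ω) (b' := L.bracket) (f := biprod.snd)
      L.X extAct_snd.symm
    have h3 := actR_whiskerRight (A := L.X) (extAct L ω) (biprod.snd : 𝟙_ C ⊞ L.X ⟶ L.X)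
    have h4 := actL_whiskerLeft (A := L.X) L.bracket (biprod.snd : 𝟙_ C ⊞ L.X ⟶ L.X)
    have h5 : L.X ◁ L.bracket ≫ biprod.lift ω L.bracket =
        (actL L.bracket L.X + actR L.X L.bracket) ≫ biprod.lift ω L.bracket := by
      rw [lift_jacobi h]
      simp [actL, actR]
    change L.X ◁ extBracket L ω ≫ extAct L ω =
      (actL (extAct L ω) (𝟙_ C ⊞ L.X) + actR (𝟙_ C ⊞ L.X) (extAct L ω)) ≫ extBracket L ω
    have h6 : L.X ◁ extBracket L ω ≫ extAct L ω =
        L.X ◁ (biprod.snd ⊗ₘ biprod.snd) ≫ L.X ◁ L.bracket ≫ biprod.lift ω L.bracket := by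
      rw [extAct, ← MonoidalCategory.whiskerLeft_comp_assoc, extBracket_snd,
        MonoidalCategory.whiskerLeft_comp_assoc]
    rw [h6, h5, extBracket]
    simp only [MonoidalCategory.tensorHom_def, MonoidalCategory.whiskerLeft_comp, Category.assoc,
      Preadditive.add_comp, Preadditive.comp_add]
    rw [← reassoc_of% h1, ← reassoc_of% h3, ← reassoc_of% h4, ← reassoc_of% h2]⟩
  skew := LieMod.hom_ext (by
    change (β_ (𝟙_ C ⊞ L.X) (𝟙_ C ⊞ L.X)).hom ≫ extBracket L ω = -extBracket L ω
    have hs : (β_ L.X L.X).hom ≫ biprod.lift ω L.bracket = -biprod.lift ω L.bracket := by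
      apply biprod.hom_ext
      · simpa using h.skew
      · simpa using L.skew
    rw [extBracket, ← BraidedCategory.braiding_naturality_assoc, hs, Preadditive.comp_neg])
  jacobi := LieMod.hom_ext (by
    change (𝟙_ C ⊞ L.X) ◁ extBracket L ω ≫ extBracket L ω =
      (α_ (𝟙_ C ⊞ L.X) (𝟙_ C ⊞ L.X) (𝟙_ C ⊞ L.X)).inv ≫ extBracket L ω ▷ (𝟙_ C ⊞ L.X) ≫
        extBracket L ω +
      (α_ (𝟙_ C ⊞ L.X) (𝟙_ C ⊞ L.X) (𝟙_ C ⊞ L.X)).inv ≫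
        (β_ (𝟙_ C ⊞ L.X) (𝟙_ C ⊞ L.X)).hom ▷ (𝟙_ C ⊞ L.X) ≫
        (α_ (𝟙_ C ⊞ L.X) (𝟙_ C ⊞ L.X) (𝟙_ C ⊞ L.X)).hom ≫ (𝟙_ C ⊞ L.X) ◁ extBracket L ω ≫
          extBracket L ω
    have e1 : (𝟙_ C ⊞ L.X) ◁ extBracket L ω ≫ extBracket L ω =
        (biprod.snd ⊗ₘ (biprod.snd ⊗ₘ biprod.snd)) ≫ L.X ◁ L.bracket ≫
          biprod.lift ω L.bracket := by
      nth_rw 2 [extBracket]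
      rw [whiskerLeft_comp_tensorHom_assoc, extBracket_snd, tensorHom_comp_whiskerLeft_assoc]
    have e2 : extBracket L ω ▷ (𝟙_ C ⊞ L.X) ≫ extBracket L ω =
        ((biprod.snd ⊗ₘ biprod.snd) ⊗ₘ biprod.snd) ≫ L.bracket ▷ L.X ≫
          biprod.lift ω L.bracket := by
      nth_rw 2 [extBracket]
      rw [whiskerRight_comp_tensorHom_assoc, extBracket_snd, tensorHom_comp_whiskerRight_assoc]
    have e3 := ((biprod.snd : 𝟙_ C ⊞ L.X ⟶ L.X) ⊗ₘ ((biprod.snd : 𝟙_ C ⊞ L.X ⟶ L.X) ⊗ₘ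
      (biprod.snd : 𝟙_ C ⊞ L.X ⟶ L.X))) ≫= lift_jacobi h
    refine (e1.trans e3).trans ?_
    rw [e1, e2, ← associator_naturality_assoc, whiskerRight_comp_tensorHom_assoc,
      ← BraidedCategory.braiding_naturality, ← tensorHom_comp_whiskerRight_assoc,
      ← associator_inv_naturality_assoc, ← associator_inv_naturality_assoc, Preadditive.comp_add])
  unit := ⟨biprod.inl, by simp [extAct, ← MonoidalCategory.whiskerLeft_comp_assoc]⟩
  unit_bracket := LieMod.hom_ext (by
    change ((biprod.inl : 𝟙_ C ⟶ 𝟙_ C ⊞ L.X) ⊗ₘ (biprod.inl : 𝟙_ C ⟶ 𝟙_ C ⊞ L.X)) ≫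
      extBracket L ω = 0
    simp [extBracket])

end CentralExtension
end LieObj
section Commutator
variable (A : C) [MonObj A]

/-- The commutator `x ⊗ y ↦ x y - y x`. -/
def commutator : A ⊗ A ⟶ A := μ[A] - (β_ A A).hom ≫ μ[A]

def swapFst : A ⊗ (A ⊗ A) ⟶ A ⊗ (A ⊗ A) := (α_ A A A).inv ≫ (β_ A A).hom ▷ A ≫ (α_ A A A).hom

lemma swapFst_swapFst : swapFst A ≫ swapFst A = 𝟙 _ := by
  simp only [swapFst, Category.assoc, Iso.hom_inv_id_assoc]
  rw [← comp_whiskerRight_assoc, SymmetricCategory.symmetry]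
  simp

lemma swapSnd_swapSnd : A ◁ (β_ A A).hom ≫ A ◁ (β_ A A).hom = 𝟙 _ := by
  rw [← MonoidalCategory.whiskerLeft_comp, SymmetricCategory.symmetry]
  simp

lemma swap_braid : swapFst A ≫ A ◁ (β_ A A).hom ≫ swapFst A =
    A ◁ (β_ A A).hom ≫ swapFst A ≫ A ◁ (β_ A A).hom := by
  simpa [swapFst] using BraidedCategory.yang_baxter A A A

lemma mul_one_three : A ◁ μ[A] ≫ (β_ A A).hom ≫ μ[A] =
    swapFst A ≫ A ◁ (β_ A A).hom ≫ A ◁ μ[A] ≫ μ[A] := by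
  rw [BraidedCategory.braiding_naturality_right_assoc, BraidedCategory.braiding_tensor_right_hom,
    mul_assoc_flip, swapFst]
  simp

lemma mul_two_three : (α_ A A A).inv ≫ μ[A] ▷ A ≫ (β_ A A).hom ≫ μ[A] =
    A ◁ (β_ A A).hom ≫ swapFst A ≫ A ◁ μ[A] ≫ μ[A] := by
  rw [BraidedCategory.braiding_naturality_left_assoc, BraidedCategory.braiding_tensor_left_hom,
    swapFst]
  simp

lemma whiskerLeft_commutator_mul : A ◁ commutator A ≫ μ[A] =
    A ◁ μ[A] ≫ μ[A] - A ◁ (β_ A A).hom ≫ A ◁ μ[A] ≫ μ[A] := by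
  simp [commutator, whiskerLeft_sub']

lemma commutator_whiskerRight_mul : (α_ A A A).inv ≫ commutator A ▷ A ≫ μ[A] =
    A ◁ μ[A] ≫ μ[A] - swapFst A ≫ A ◁ μ[A] ≫ μ[A] := by
  rw [mul_assoc_flip]
  simp [commutator, sub_whiskerRight', swapFst]

/-- The commutator with a fixed element is a derivation. -/
lemma whiskerLeft_mul_commutator : A ◁ μ[A] ≫ commutator A =
    (α_ A A A).inv ≫ commutator A ▷ A ≫ μ[A] + swapFst A ≫ A ◁ commutator A ≫ μ[A] := by
  rw [commutator_whiskerRight_mul, whiskerLeft_commutator_mul, commutator, Preadditive.comp_sub,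
    mul_one_three]
  simp

lemma one_commutator : A ◁ η[A] ≫ commutator A = 0 := by
  rw [commutator, Preadditive.comp_sub, MonObj.mul_one,
    BraidedCategory.braiding_naturality_right_assoc, MonObj.one_mul]
  simp

/-- The Lie algebra underlying an associative algebra. -/
@[simps]
def LieObj.ofMon : LieObj C where
  X := A
  bracket := commutator A
  skew := by
    simp [commutator]
  jacobi := by
    have h1 : A ◁ commutator A ≫ commutator A = A ◁ μ[A] ≫ μ[A] -
        A ◁ (β_ A A).hom ≫ A ◁ μ[A] ≫ μ[A] - swapFst A ≫ A ◁ (β_ A A).hom ≫ A ◁ μ[A] ≫ μ[A] +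
        A ◁ (β_ A A).hom ≫ swapFst A ≫ A ◁ (β_ A A).hom ≫ A ◁ μ[A] ≫ μ[A] := by
      simp only [commutator, whiskerLeft_sub', Preadditive.sub_comp, Preadditive.comp_sub,
        MonoidalCategory.whiskerLeft_comp, Category.assoc, mul_one_three]
      abel
    have h2 : (α_ A A A).inv ≫ commutator A ▷ A ≫ commutator A = A ◁ μ[A] ≫ μ[A] -
        swapFst A ≫ A ◁ μ[A] ≫ μ[A] - A ◁ (β_ A A).hom ≫ swapFst A ≫ A ◁ μ[A] ≫ μ[A] +
        swapFst A ≫ A ◁ (β_ A A).hom ≫ swapFst A ≫ A ◁ μ[A] ≫ μ[A] := by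
      have e : ∀ {Z : C} (f : A ⊗ A ⊗ A ⟶ Z), (α_ A A A).inv ≫ (β_ A A).hom ▷ A ≫
          (α_ A A A).hom ≫ f = swapFst A ≫ f := by
        intro Z f
        simp [swapFst]
      have e0 := mul_two_three A
      have e1 : μ[A] ▷ A ≫ (β_ A A).hom ≫ μ[A] = (α_ A A A).hom ≫ A ◁ (β_ A A).hom ≫
          swapFst A ≫ A ◁ μ[A] ≫ μ[A] := by
        rw [← e0, Iso.hom_inv_id_assoc]
      simp only [commutator, sub_whiskerRight', Preadditive.sub_comp, Preadditive.comp_sub,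
        comp_whiskerRight, Category.assoc, e1, MonObj.mul_assoc, e, Iso.inv_hom_id_assoc]
      abel
    have h3 : (α_ A A A).inv ≫ (β_ A A).hom ▷ A ≫ (α_ A A A).hom ≫ A ◁ commutator A ≫
        commutator A = swapFst A ≫ A ◁ commutator A ≫ commutator A := by
      simp [swapFst]
    have hs := congrArg (· ≫ A ◁ μ[A] ≫ μ[A]) (swap_braid A)
    simp only [Category.assoc] at hs
    have hs' := congrArg (fun t => A ◁ (β_ A A).hom ≫ t ≫ swapFst A ≫ A ◁ μ[A] ≫ μ[A])
      (swapFst_swapFst A)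
    rw [h3, h2, h1]
    simp only [Preadditive.comp_sub, Preadditive.comp_add]
    have k1 : swapFst A ≫ swapFst A ≫ A ◁ (β_ A A).hom ≫ A ◁ μ[A] ≫ μ[A] =
        A ◁ (β_ A A).hom ≫ A ◁ μ[A] ≫ μ[A] := by
      rw [reassoc_of% (swapFst_swapFst A)]
    have k2 : swapFst A ≫ A ◁ (β_ A A).hom ≫ swapFst A ≫ A ◁ (β_ A A).hom ≫ A ◁ μ[A] ≫ μ[A] =
        A ◁ (β_ A A).hom ≫ swapFst A ≫ A ◁ μ[A] ≫ μ[A] := by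
      rw [reassoc_of% (swap_braid A), reassoc_of% (swapSnd_swapSnd A)]
    rw [k1, k2, hs]
    abel

end Commutator

/-- `f` is a morphism of Lie algebras. -/
def IsLieHom (K L : LieObj C) (f : K.X ⟶ L.X) : Prop :=
  K.bracket ≫ f = (f ⊗ₘ f) ≫ L.bracket

/-- `U`, together with `i : L ⟶ U`, is the (universal) enveloping algebra of `L`: every Lie algebra
morphism from `L` to (the commutator Lie algebra of) an associative algebra factors uniquely through
`i` and a morphism of algebras. -/
structure IsEnvelopingAlgebra (L : LieObj C) (U : Mon C) (i : L.X ⟶ U.X) : Prop where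
  isLieHom : IsLieHom L (LieObj.ofMon U.X) i
  existsUnique : ∀ (A : Mon C) (f : L.X ⟶ A.X), IsLieHom L (LieObj.ofMon A.X) f →
    ∃! g : U ⟶ A, i ≫ g.hom = f

/-- `E`, together with `j : M ⟶ E`, is the unital enveloping algebra of the unital Lie algebra `M`:
the universal algebra with a Lie algebra morphism from `M` that is compatible with the units. -/
structure IsUnitalEnvelopingAlgebra (M : UnitalLieObj C) (E : Mon C) (j : M.X ⟶ E.X) : Prop where
  isLieHom : IsLieHom M.toLieObj (LieObj.ofMon E.X) j
  unit_comp : M.unit ≫ j = η[E.X]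
  existsUnique : ∀ (A : Mon C) (f : M.X ⟶ A.X), IsLieHom M.toLieObj (LieObj.ofMon A.X) f →
    M.unit ≫ f = η[A.X] → ∃! g : E ⟶ A, j ≫ g.hom = f

/-- Restriction of modules along a morphism of Lie algebras. -/
@[simps]
def LieMod.restrict {K L : LieObj C} (f : K.X ⟶ L.X) (hf : IsLieHom K L f) (M : LieMod L) :
    LieMod K where
  X := M.X
  act := f ▷ M.X ≫ M.act
  bracket_act := by
    have h : ∀ {Z : C} (g : L.X ⊗ (L.X ⊗ M.X) ⟶ Z), (α_ K.X K.X M.X).hom ≫ K.X ◁ f ▷ M.X ≫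
        f ▷ (L.X ⊗ M.X) ≫ g = (f ⊗ₘ f) ▷ M.X ≫ (α_ L.X L.X M.X).hom ≫ g := by
      intro Z g
      rw [← associator_naturality_middle_assoc, ← associator_naturality_left_assoc,
        ← comp_whiskerRight_assoc, MonoidalCategory.tensorHom_def']
    rw [← comp_whiskerRight_assoc, hf, comp_whiskerRight_assoc, M.bracket_act]
    simp only [MonoidalCategory.whiskerLeft_comp, Category.assoc]
    rw [whisker_exchange_assoc, h, ← comp_whiskerRight_assoc,
      ← BraidedCategory.braiding_naturality, comp_whiskerRight_assoc, Preadditive.comp_sub]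

/-- For a Lie algebra morphism `i` from `L` to an algebra `U`, the algebra `U` with the adjoint
action `x · u = i(x) u - u i(x)` of `L`, as an algebra in `Mod(L)`. -/
def adjointAlgebra (L : LieObj C) (U : Mon C) (i : L.X ⟶ U.X)
    (hi : IsLieHom L (LieObj.ofMon U.X) i) : Mon (LieMod L) where
  X := LieMod.restrict i hi (LieObj.ofMon U.X).adjoint
  mon :=
    { one := ⟨η[U.X], by
        change L.X ◁ η[U.X] ≫ i ▷ U.X ≫ commutator U.X = 0 ≫ η[U.X]
        rw [whisker_exchange_assoc, one_commutator, comp_zero, zero_comp]⟩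
      mul := ⟨μ[U.X], by
        change L.X ◁ μ[U.X] ≫ i ▷ U.X ≫ commutator U.X =
          (actL (i ▷ U.X ≫ commutator U.X) U.X + actR U.X (i ▷ U.X ≫ commutator U.X)) ≫ μ[U.X]
        rw [whisker_exchange_assoc, whiskerLeft_mul_commutator, Preadditive.comp_add,
          Preadditive.add_comp]
        congr 1
        · simp [actL]
        · simp only [actR, swapFst, Category.assoc, MonoidalCategory.whiskerLeft_comp]
          rw [associator_inv_naturality_left_assoc, ← comp_whiskerRight_assoc,
            BraidedCategory.braiding_naturality_left, comp_whiskerRight_assoc,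
            associator_naturality_middle_assoc]⟩
      one_mul := LieMod.hom_ext (MonObj.one_mul U.X)
      mul_one := LieMod.hom_ext (MonObj.mul_one U.X)
      mul_assoc := LieMod.hom_ext (MonObj.mul_assoc U.X) }
section Invariants
open Functor

lemma comp_homEquiv_eq_zero_iff {A X Y Z : C} {R : C ⥤ C} (adj : tensorLeft A ⊣ R)
    (a : A ⊗ X ⟶ Z) (f : Y ⟶ X) :
    f ≫ adj.homEquiv X Z a = 0 ↔ A ◁ f ≫ a = 0 := by
  rw [← adj.homEquiv_naturality_left, ← (adj.homEquiv Y Z).injective.eq_iff]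
  have h : adj.homEquiv Y Z 0 = 0 := by
    have := adj.homEquiv_naturality_left (0 : Y ⟶ X) a
    simpa using this
  rw [h]
  rfl

/-- For dualizable `A` and `B`, there is a largest subobject killed by two given maps out of
`A ⊗ X` and `B ⊗ X`. -/
lemma exists_killed [HasBinaryBiproducts C] [HasKernels C] {A B X Z W : C}
    [(tensorLeft A).IsLeftAdjoint] [(tensorLeft B).IsLeftAdjoint]
    (a : A ⊗ X ⟶ Z) (b : B ⊗ X ⟶ W) :
    ∃ (K : C) (k : K ⟶ X), Mono k ∧ A ◁ k ≫ a = 0 ∧ B ◁ k ≫ b = 0 ∧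
      ∀ (Y : C) (f : Y ⟶ X), A ◁ f ≫ a = 0 → B ◁ f ≫ b = 0 → ∃ g : Y ⟶ K, g ≫ k = f := by
  let adjA := Adjunction.ofIsLeftAdjoint (tensorLeft A)
  let adjB := Adjunction.ofIsLeftAdjoint (tensorLeft B)
  let t := biprod.lift (adjA.homEquiv X Z a) (adjB.homEquiv X W b)
  have ht : ∀ {Y : C} (f : Y ⟶ X), f ≫ t = 0 ↔ A ◁ f ≫ a = 0 ∧ B ◁ f ≫ b = 0 := by
    intro Y f
    rw [← comp_homEquiv_eq_zero_iff adjA, ← comp_homEquiv_eq_zero_iff adjB]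
    constructor
    · intro h
      exact ⟨by simpa [t] using congrArg (· ≫ biprod.fst) h,
        by simpa [t] using congrArg (· ≫ biprod.snd) h⟩
    · rintro ⟨h1, h2⟩
      apply biprod.hom_ext
      · simpa [t] using h1
      · simpa [t] using h2
  have h := (ht (kernel.ι t)).1 (kernel.condition t)
  exact ⟨kernel t, kernel.ι t, inferInstance, h.1, h.2,
    fun Y f h1 h2 => ⟨kernel.lift t f ((ht f).2 ⟨h1, h2⟩), kernel.lift_ι _ _ _⟩⟩

lemma trivial_isLeftAdjoint {L : LieObj C}
    (h : ∀ M : LieMod L, ∃ (K : C) (k : K ⟶ M.X), Mono k ∧ L.X ◁ k ≫ M.act = 0 ∧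
      ∀ (Y : C) (f : Y ⟶ M.X), L.X ◁ f ≫ M.act = 0 → ∃ g : Y ⟶ K, g ≫ k = f) :
    (LieMod.trivial L).IsLeftAdjoint := by
  have : ∀ M : LieMod L, HasTerminal (CostructuredArrow (LieMod.trivial L) M) := by
    intro M
    obtain ⟨K, k, hk, hk0, hK⟩ := h M
    have hf : ∀ {Y : C} (f : (LieMod.trivial L).obj Y ⟶ M),
        L.X ◁ f.hom ≫ M.act = 0 := by
      intro Y f
      exact f.comm.trans zero_comp
    let T : CostructuredArrow (LieMod.trivial L) M :=
      CostructuredArrow.mk (Y := K) ⟨k, hk0.trans zero_comp.symm⟩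
    refine IsTerminal.hasTerminal (X := T) (IsTerminal.ofUniqueHom (fun Y => ?_) ?_)
    · refine CostructuredArrow.homMk (Classical.choose (hK Y.left Y.hom.hom (hf Y.hom))) ?_
      exact LieMod.hom_ext (Classical.choose_spec (hK Y.left Y.hom.hom (hf Y.hom)))
    · intro Y m
      apply CostructuredArrow.hom_ext
      have h1 := congrArg LieMod.Hom.hom (CostructuredArrow.w m)
      have h2 := Classical.choose_spec (hK Y.left Y.hom.hom (hf Y.hom))
      exact (cancel_mono k).1 (h1.trans h2.symm)
  exact isLeftAdjoint_of_costructuredArrowTerminals _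

instance trivial_isLeftAdjoint_of_dualizable [HasBinaryBiproducts C] [HasKernels C] (L : LieObj C)
    [(tensorLeft L.X).IsLeftAdjoint] : (LieMod.trivial L).IsLeftAdjoint :=
  trivial_isLeftAdjoint fun M => by
    obtain ⟨K, k, h1, h2, -, h3⟩ := exists_killed M.act M.act
    exact ⟨K, k, h1, h2, fun Y f hf => h3 Y f hf hf⟩

/-- The invariants functor `M ↦ M ^ L`: the right adjoint of the functor which equips an object with
the zero action of `L`. -/
def invariants (L : LieObj C) [(LieMod.trivial L).IsLeftAdjoint] : LieMod L ⥤ C :=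
  (LieMod.trivial L).rightAdjoint

/-- The adjunction between the trivial extension functor and the invariants functor. -/
def invariantsAdj (L : LieObj C) [(LieMod.trivial L).IsLeftAdjoint] :
    LieMod.trivial L ⊣ invariants L :=
  Adjunction.ofIsLeftAdjoint _

/-- The invariants functor is lax monoidal, being the right adjoint of a monoidal functor. In
particular, the invariants of an algebra in `Mod(L)` form an algebra in `C`. -/
instance (L : LieObj C) [(LieMod.trivial L).IsLeftAdjoint] : (invariants L).LaxMonoidal :=
  (invariantsAdj L).rightAdjointLaxMonoidal

end Invariants

/-- A quadratic structure on a Lie algebra `L`: a dual of the adjoint module `L` in the tensor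
category `Mod(L)` (so `L` is rigid), and an isomorphism of `L`-modules `Lᵛ ≅ L` for which the
resulting invariant bilinear form is symmetric. -/
class QuadraticLieObj (L : LieObj C) where
  dual : LieMod L
  exactPairing : ExactPairing L.adjoint dual
  iso : dual ≅ L.adjoint
  symm : (β_ L.adjoint L.adjoint).hom ≫ iso.inv ▷ L.adjoint ≫ ε_ L.adjoint dual =
    iso.inv ▷ L.adjoint ≫ ε_ L.adjoint dual

namespace QuadraticLieObj
variable (L : LieObj C) [q : QuadraticLieObj L]

/-- The invariant bilinear form of a quadratic Lie algebra. -/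
def form : L.X ⊗ L.X ⟶ 𝟙_ C :=
  letI := q.exactPairing
  (q.iso.inv ▷ L.adjoint ≫ ε_ L.adjoint q.dual).hom

lemma form_symm : (β_ L.X L.X).hom ≫ form L = form L :=
  congrArg LieMod.Hom.hom q.symm

lemma form_invariant : (α_ L.X L.X L.X).inv ≫ L.bracket ▷ L.X ≫ form L +
    (α_ L.X L.X L.X).inv ≫ (β_ L.X L.X).hom ▷ L.X ≫ (α_ L.X L.X L.X).hom ≫
      L.X ◁ L.bracket ≫ form L = 0 := by
  let _ := q.exactPairing
  have h := (q.iso.inv ▷ L.adjoint ≫ ε_ L.adjoint q.dual).comm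
  change L.X ◁ form L ≫ 0 = (actL L.bracket L.X + actR L.X L.bracket) ≫ form L at h
  rw [comp_zero, Preadditive.add_comp] at h
  simpa [actL, actR] using h.symm

instance tensorLeft_isLeftAdjoint : (tensorLeft L.X).IsLeftAdjoint := by
  let _ := q.exactPairing
  let p : ExactPairing L.X q.dual.X :=
    { coevaluation' := (η_ L.adjoint q.dual).hom
      evaluation' := (ε_ L.adjoint q.dual).hom
      coevaluation_evaluation' :=
        congrArg LieMod.Hom.hom (ExactPairing.coevaluation_evaluation L.adjoint q.dual)
      evaluation_coevaluation' :=
        congrArg LieMod.Hom.hom (ExactPairing.evaluation_coevaluation L.adjoint q.dual) }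
  have : (tensorLeft q.dual.X).IsLeftAdjoint :=
    (tensorLeftAdjunction L.X q.dual.X).isLeftAdjoint
  let e : tensorLeft q.dual.X ≅ tensorLeft L.X :=
    (tensoringLeft C).mapIso ((LieMod.forget L).mapIso q.iso)
  exact Functor.isLeftAdjoint_of_iso e

end QuadraticLieObj
section Biproducts
variable [HasBinaryBiproducts C] {L : LieObj C}

/-- The direct sum of two modules. -/
def LieMod.biprodBicone (M N : LieMod L) : BinaryBicone M N where
  pt :=
    { X := M.X ⊞ N.X
      act := biprod.lift (L.X ◁ biprod.fst ≫ M.act) (L.X ◁ biprod.snd ≫ N.act)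
      bracket_act := by
        have key : ∀ {K : LieMod L} (p : M.X ⊞ N.X ⟶ K.X)
            (a : L.X ⊗ (M.X ⊞ N.X) ⟶ M.X ⊞ N.X) (_ : a ≫ p = L.X ◁ p ≫ K.act),
            L.bracket ▷ (M.X ⊞ N.X) ≫ a ≫ p =
              ((α_ L.X L.X (M.X ⊞ N.X)).hom ≫ L.X ◁ a ≫ a -
                (β_ L.X L.X).hom ▷ (M.X ⊞ N.X) ≫ (α_ L.X L.X (M.X ⊞ N.X)).hom ≫
                  L.X ◁ a ≫ a) ≫ p := by
          intro K p a ha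
          have h1 : L.X ◁ a ≫ a ≫ p = L.X ◁ L.X ◁ p ≫ L.X ◁ K.act ≫ K.act := by
            rw [ha, ← MonoidalCategory.whiskerLeft_comp_assoc, ha,
              MonoidalCategory.whiskerLeft_comp_assoc]
          simp only [Preadditive.sub_comp, Category.assoc, h1]
          rw [ha, ← whisker_exchange_assoc, K.bracket_act, ← associator_naturality_right_assoc,
            ← whisker_exchange_assoc, Preadditive.comp_sub]
        apply biprod.hom_ext
        · rw [Category.assoc, key biprod.fst _ (biprod.lift_fst _ _)]
        · rw [Category.assoc, key biprod.snd _ (biprod.lift_snd _ _)] }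
  fst := ⟨biprod.fst, by simp⟩
  snd := ⟨biprod.snd, by simp⟩
  inl := ⟨biprod.inl, by
    apply biprod.hom_ext <;> simp [← MonoidalCategory.whiskerLeft_comp_assoc]⟩
  inr := ⟨biprod.inr, by
    apply biprod.hom_ext <;> simp [← MonoidalCategory.whiskerLeft_comp_assoc]⟩
  inl_fst := LieMod.hom_ext biprod.inl_fst
  inl_snd := LieMod.hom_ext biprod.inl_snd
  inr_fst := LieMod.hom_ext biprod.inr_fst
  inr_snd := LieMod.hom_ext biprod.inr_snd

instance : HasBinaryBiproducts (LieMod L) where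
  has_binary_biproduct M N :=
    HasBinaryBiproduct.mk
      { bicone := LieMod.biprodBicone M N
        isBilimit := isBinaryBilimitOfTotal _ (LieMod.hom_ext biprod.total) }

end Biproducts
section DualNumbers
variable [HasBinaryBiproducts C] (P : C)

/-- The multiplication `(s, p) (t, q) = (s t, s q + p t)` of the symmetric algebra
`S(P) = 𝟙_ C ⊞ P` of an object `P` with `S²(P) = 0`. -/
def dualNumbersMul : (𝟙_ C ⊞ P) ⊗ (𝟙_ C ⊞ P) ⟶ 𝟙_ C ⊞ P :=
  biprod.lift ((biprod.fst ⊗ₘ biprod.fst) ≫ (λ_ _).hom)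
    ((biprod.fst ⊗ₘ biprod.snd) ≫ (λ_ _).hom + (biprod.snd ⊗ₘ biprod.fst) ≫ (ρ_ _).hom)

variable {P}

lemma dualNumbersMul_fst :
    dualNumbersMul P ≫ biprod.fst = (biprod.fst ⊗ₘ biprod.fst) ≫ (λ_ _).hom :=
  biprod.lift_fst _ _

lemma dualNumbersMul_snd : dualNumbersMul P ≫ biprod.snd =
    (biprod.fst ⊗ₘ biprod.snd) ≫ (λ_ _).hom + (biprod.snd ⊗ₘ biprod.fst) ≫ (ρ_ _).hom :=
  biprod.lift_snd _ _

lemma comp_tensor {X Y Z X' Y' Z' W : C} (f : X ⟶ X') (g : Y ⟶ Y') (h : Z ⟶ Z')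
    (m : X' ⊗ Y' ⟶ W) : ((f ⊗ₘ g) ≫ m ⊗ₘ h) =
      (α_ X Y Z).hom ≫ (f ⊗ₘ (g ⊗ₘ h)) ≫ (α_ X' Y' Z').inv ≫ m ▷ Z' := by
  rw [← associator_naturality_assoc, Iso.hom_inv_id_assoc, tensorHom_comp_whiskerRight]

lemma tensor_comp {X Y Z X' Y' Z' W : C} (f : X ⟶ X') (g : Y ⟶ Y') (h : Z ⟶ Z')
    (m : Y' ⊗ Z' ⟶ W) : (f ⊗ₘ (g ⊗ₘ h) ≫ m) = (f ⊗ₘ (g ⊗ₘ h)) ≫ X' ◁ m := by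
  simp [MonoidalCategory.tensorHom_def]

instance dualNumbersMonObj : MonObj (𝟙_ C ⊞ P) where
  one := biprod.inl
  mul := dualNumbersMul P
  one_mul := by
    apply biprod.hom_ext
    · rw [Category.assoc, dualNumbersMul_fst, whiskerRight_comp_tensorHom_assoc, biprod.inl_fst]
      simp
    · rw [Category.assoc, dualNumbersMul_snd, Preadditive.comp_add,
        whiskerRight_comp_tensorHom_assoc, whiskerRight_comp_tensorHom_assoc, biprod.inl_fst,
        biprod.inl_snd]
      simp
  mul_one := by
    apply biprod.hom_ext
    · rw [Category.assoc, dualNumbersMul_fst, whiskerLeft_comp_tensorHom_assoc, biprod.inl_fst]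
      simp [unitors_equal]
    · rw [Category.assoc, dualNumbersMul_snd, Preadditive.comp_add,
        whiskerLeft_comp_tensorHom_assoc, whiskerLeft_comp_tensorHom_assoc, biprod.inl_fst,
        biprod.inl_snd]
      simp
  mul_assoc := by
    apply biprod.hom_ext
    · simp only [Category.assoc]
      rw [dualNumbersMul_fst, whiskerRight_comp_tensorHom_assoc, whiskerLeft_comp_tensorHom_assoc,
        dualNumbersMul_fst, comp_tensor, tensor_comp]
      monoidal
    · simp only [Category.assoc]
      rw [dualNumbersMul_snd]
      simp only [Preadditive.comp_add]
      rw [whiskerRight_comp_tensorHom_assoc, whiskerLeft_comp_tensorHom_assoc,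
        whiskerRight_comp_tensorHom_assoc, whiskerLeft_comp_tensorHom_assoc,
        dualNumbersMul_fst, dualNumbersMul_snd]
      simp only [MonoidalPreadditive.add_tensor, MonoidalPreadditive.tensor_add,
        Preadditive.add_comp, Preadditive.comp_add, comp_tensor, tensor_comp, Category.assoc]
      rw [add_assoc]
      congr 1
      · simp
      · congr 1 
        · simp
        · simp [unitors_equal]

instance : IsCommMonObj (𝟙_ C ⊞ P) where
  mul_comm := by
    change (β_ (𝟙_ C ⊞ P) (𝟙_ C ⊞ P)).hom ≫ dualNumbersMul P = dualNumbersMul P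
    apply biprod.hom_ext
    · rw [Category.assoc, dualNumbersMul_fst, ← BraidedCategory.braiding_naturality_assoc]
      simp [← unitors_equal]
    · rw [Category.assoc, dualNumbersMul_snd, Preadditive.comp_add,
        ← BraidedCategory.braiding_naturality_assoc, ← BraidedCategory.braiding_naturality_assoc]
      simp [add_comm]

/-- The contraction of the components in `P` by a pairing `e : P ⊗ P ⟶ 𝟙_ C`. -/
def topPairing (e : P ⊗ P ⟶ 𝟙_ C) : (𝟙_ C ⊞ P) ⊗ (𝟙_ C ⊞ P) ⟶ 𝟙_ C :=
  (biprod.snd ⊗ₘ biprod.snd) ≫ e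

lemma braiding_topPairing (hP : (β_ P P).hom = -𝟙 _) (e : P ⊗ P ⟶ 𝟙_ C) :
    (β_ (𝟙_ C ⊞ P) (𝟙_ C ⊞ P)).hom ≫ topPairing e = -topPairing e := by
  rw [topPairing, ← BraidedCategory.braiding_naturality_assoc, hP]
  simp

lemma topPairing_cocycle (hP : (β_ P P).hom = -𝟙 _) (e : P ⊗ P ⟶ 𝟙_ C) :
    (𝟙_ C ⊞ P) ◁ dualNumbersMul P ≫ topPairing e + (α_ _ _ _).inv ≫
      (β_ (𝟙_ C ⊞ P) (𝟙_ C ⊞ P)).hom ▷ (𝟙_ C ⊞ P) ≫ (α_ _ _ _).hom ≫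
        (𝟙_ C ⊞ P) ◁ dualNumbersMul P ≫ topPairing e =
      (α_ _ _ _).inv ≫ dualNumbersMul P ▷ (𝟙_ C ⊞ P) ≫ topPairing e := by
  have h1 : (𝟙_ C ⊞ P) ◁ dualNumbersMul P ≫ topPairing e =
      (biprod.snd ⊗ₘ (biprod.fst ⊗ₘ biprod.snd)) ≫ P ◁ (λ_ P).hom ≫ e +
      (biprod.snd ⊗ₘ (biprod.snd ⊗ₘ biprod.fst)) ≫ P ◁ (ρ_ P).hom ≫ e := by
    rw [topPairing, whiskerLeft_comp_tensorHom_assoc, dualNumbersMul_snd,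
      MonoidalPreadditive.tensor_add, tensor_comp, tensor_comp]
    simp
  have h2 : dualNumbersMul P ▷ (𝟙_ C ⊞ P) ≫ topPairing e =
      (α_ _ _ _).hom ≫ (biprod.fst ⊗ₘ (biprod.snd ⊗ₘ biprod.snd)) ≫ (λ_ _).hom ≫ e +
      (α_ _ _ _).hom ≫ (biprod.snd ⊗ₘ (biprod.fst ⊗ₘ biprod.snd)) ≫ P ◁ (λ_ P).hom ≫ e := by
    rw [topPairing, whiskerRight_comp_tensorHom_assoc, dualNumbersMul_snd,
      MonoidalPreadditive.add_tensor, comp_tensor, comp_tensor]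
    simp
  have h3 : ∀ {X Y Z : C} (f : 𝟙_ C ⊞ P ⟶ X) (g : 𝟙_ C ⊞ P ⟶ Y) (h : 𝟙_ C ⊞ P ⟶ Z)
      {W : C} (t : X ⊗ (Y ⊗ Z) ⟶ W),
      (α_ _ _ _).inv ≫ (β_ (𝟙_ C ⊞ P) (𝟙_ C ⊞ P)).hom ▷ (𝟙_ C ⊞ P) ≫ (α_ _ _ _).hom ≫
        (f ⊗ₘ (g ⊗ₘ h)) ≫ t = (g ⊗ₘ (f ⊗ₘ h)) ≫ (α_ _ _ _).inv ≫ (β_ Y X).hom ▷ Z ≫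
          (α_ _ _ _).hom ≫ t := by
    intro X Y Z f g h W t
    rw [← associator_naturality_assoc, whiskerRight_comp_tensorHom_assoc,
      ← BraidedCategory.braiding_naturality, ← tensorHom_comp_whiskerRight_assoc,
      associator_inv_naturality_assoc]
  rw [h1, h2]
  simp only [Preadditive.comp_add, h3, Iso.inv_hom_id_assoc, hP, neg_whiskerRight']
  simp only [id_whiskerRight, Preadditive.neg_comp, Preadditive.comp_neg, Category.id_comp,
    Iso.inv_hom_id_assoc]
  have h4 : (α_ (𝟙_ C) P P).inv ≫ (β_ (𝟙_ C) P).hom ▷ P ≫ (α_ P (𝟙_ C) P).hom ≫ P ◁ (λ_ P).hom =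
    (λ_ (P ⊗ P)).hom := by
    simp
  rw [reassoc_of% h4]
  abel

/-- The odd endomorphism `P ⊗ (𝟙_ C ⊞ P) ⟶ 𝟙_ C ⊞ P` of `𝟙_ C ⊞ P` that vanishes on `𝟙_ C` and maps
`P` to `𝟙_ C` by `e`. -/
def dualNumbersD (e : P ⊗ P ⟶ 𝟙_ C) : P ⊗ (𝟙_ C ⊞ P) ⟶ 𝟙_ C ⊞ P :=
  P ◁ biprod.snd ≫ e ≫ biprod.inl

lemma dualNumbersD_snd (e : P ⊗ P ⟶ 𝟙_ C) : dualNumbersD e ≫ biprod.snd = 0 := by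
  simp [dualNumbersD]

lemma dualNumbersD_fst (e : P ⊗ P ⟶ 𝟙_ C) :
    dualNumbersD e ≫ biprod.fst = P ◁ biprod.snd ≫ e := by
  simp [dualNumbersD]

lemma dualNumbersD_comp (e : P ⊗ P ⟶ 𝟙_ C) : P ◁ dualNumbersD e ≫ dualNumbersD e = 0 := by
  nth_rw 2 [dualNumbersD]
  rw [← MonoidalCategory.whiskerLeft_comp_assoc, dualNumbersD_snd]
  simp

lemma whiskerLeft_pairing_unitor (hP : (β_ P P).hom = -𝟙 _) (e : P ⊗ P ⟶ 𝟙_ C) :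
    P ◁ e ≫ (ρ_ P).hom = (α_ P P P).inv ≫ e ▷ P ≫ (λ_ P).hom := by
  have h := BraidedCategory.braiding_naturality_right P e =≫ (λ_ P).hom
  rw [Category.assoc, braiding_leftUnitor, BraidedCategory.braiding_tensor_right_hom, hP] at h
  rw [h]
  simp [neg_whiskerRight', whiskerLeft_neg']

lemma dualNumbersD_mul (hP : (β_ P P).hom = -𝟙 _) (e : P ⊗ P ⟶ 𝟙_ C) :
    P ◁ dualNumbersMul P ≫ dualNumbersD e =
      (actL (dualNumbersD e) (𝟙_ C ⊞ P) + actR (𝟙_ C ⊞ P) (dualNumbersD e)) ≫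
        dualNumbersMul P := by
  have hL : ∀ {X Y : C} (f : 𝟙_ C ⊞ P ⟶ X) (g : 𝟙_ C ⊞ P ⟶ Y),
      actL (dualNumbersD e) (𝟙_ C ⊞ P) ≫ (f ⊗ₘ g) =
        (α_ _ _ _).inv ≫ (dualNumbersD e ≫ f ⊗ₘ g) := by
    intro X Y f g
    rw [actL, Category.assoc, whiskerRight_comp_tensorHom]
  have hR : ∀ {X Y : C} (f : 𝟙_ C ⊞ P ⟶ X) (g : 𝟙_ C ⊞ P ⟶ Y),
      actR (𝟙_ C ⊞ P) (dualNumbersD e) ≫ (f ⊗ₘ g) =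
        (α_ _ _ _).inv ≫ (β_ _ _).hom ▷ _ ≫ (α_ _ _ _).hom ≫ (f ⊗ₘ dualNumbersD e ≫ g) := by
    intro X Y f g
    simp only [actR, Category.assoc, whiskerLeft_comp_tensorHom]
  have hL' : ∀ {Y : C} (g : 𝟙_ C ⊞ P ⟶ Y),
      (α_ _ _ _).inv ≫ (P ◁ (biprod.snd : 𝟙_ C ⊞ P ⟶ P) ≫ e ⊗ₘ g) =
        P ◁ (biprod.snd ⊗ₘ g) ≫ (α_ _ _ _).inv ≫ e ▷ Y := by
    intro Y g
    rw [← id_tensorHom, comp_tensor, Iso.inv_hom_id_assoc, id_tensorHom]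
  have hR' : ∀ {X : C} (f : 𝟙_ C ⊞ P ⟶ X),
      (α_ _ _ _).inv ≫ (β_ P (𝟙_ C ⊞ P)).hom ▷ (𝟙_ C ⊞ P) ≫ (α_ _ _ _).hom ≫
        (f ⊗ₘ P ◁ (biprod.snd : 𝟙_ C ⊞ P ⟶ P) ≫ e) =
        P ◁ (f ⊗ₘ biprod.snd) ≫ (α_ _ _ _).inv ≫ (β_ P X).hom ▷ P ≫ (α_ _ _ _).hom ≫
          X ◁ e := by
    intro X f
    rw [← id_tensorHom, tensor_comp, ← associator_naturality_assoc,
      whiskerRight_comp_tensorHom_assoc, ← BraidedCategory.braiding_naturality,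
      ← tensorHom_comp_whiskerRight_assoc, ← associator_inv_naturality_assoc, id_tensorHom]
  apply biprod.hom_ext
  · simp only [Category.assoc, dualNumbersMul_fst, dualNumbersD_fst, Preadditive.add_comp,
      reassoc_of% hL, reassoc_of% hR]
    rw [reassoc_of% hL', reassoc_of% hR', ← MonoidalCategory.whiskerLeft_comp_assoc,
      dualNumbersMul_snd]
    have hu : (ρ_ (𝟙_ C)).inv ≫ (λ_ (𝟙_ C)).hom = 𝟙 _ := by
      rw [unitors_equal]
      simp
    simp [add_comm, hu]
  · simp only [Category.assoc, dualNumbersMul_snd, dualNumbersD_snd, comp_zero,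
      Preadditive.comp_add, Preadditive.add_comp,
      reassoc_of% hL, reassoc_of% hR, MonoidalPreadditive.zero_tensor,
      MonoidalPreadditive.tensor_zero, zero_comp, zero_add, add_zero, dualNumbersD_fst]
    rw [reassoc_of% hL', reassoc_of% hR', whiskerLeft_pairing_unitor hP, hP, neg_whiskerRight']
    simp

end DualNumbers

section QuotientAlgebra

variable [HasCokernels C] [∀ X : C, PreservesFiniteColimits (tensorLeft X)]

instance (X : C) : PreservesFiniteColimits (tensorRight X) :=
  preservesFiniteColimits_of_natIso (BraidedCategory.tensorLeftIsoTensorRight X)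

lemma exists_whiskerLeft_desc {B Z W : C} (b : B ⟶ Z) (X : C) (f : X ⊗ Z ⟶ W)
    (hf : X ◁ b ≫ f = 0) : ∃ g : X ⊗ cokernel b ⟶ W, X ◁ cokernel.π b ≫ g = f := by
  have h := (CokernelCofork.ofπ (cokernel.π b) (cokernel.condition b)).mapIsColimit
    (cokernelIsCokernel b) (tensorLeft X)
  exact ⟨h.desc (CokernelCofork.ofπ f hf), h.fac (CokernelCofork.ofπ f hf) .one⟩

lemma exists_whiskerRight_desc {B Z W : C} (b : B ⟶ Z) (X : C) (f : Z ⊗ X ⟶ W)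
    (hf : b ▷ X ≫ f = 0) : ∃ g : cokernel b ⊗ X ⟶ W, cokernel.π b ▷ X ≫ g = f := by
  have h := (CokernelCofork.ofπ (cokernel.π b) (cokernel.condition b)).mapIsColimit
    (cokernelIsCokernel b) (tensorRight X)
  exact ⟨h.desc (CokernelCofork.ofπ f hf), h.fac (CokernelCofork.ofπ f hf) .one⟩

instance {X Y : C} (Z : C) (f : X ⟶ Y) [Epi f] : Epi (Z ◁ f) :=
  inferInstanceAs (Epi ((tensorLeft Z).map f))

instance {X Y : C} (Z : C) (f : X ⟶ Y) [Epi f] : Epi (f ▷ Z) :=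
  inferInstanceAs (Epi ((tensorRight Z).map f))

instance {X Y X' Y' : C} (f : X ⟶ Y) (g : X' ⟶ Y') [Epi f] [Epi g] : Epi (f ⊗ₘ g) := by
  rw [MonoidalCategory.tensorHom_def]
  infer_instance

variable {Z : C} [MonObj Z] {B : C} (b : B ⟶ Z)

lemma exists_quotientMul (hl : b ▷ Z ≫ μ[Z] ≫ cokernel.π b = 0)
    (hr : Z ◁ b ≫ μ[Z] ≫ cokernel.π b = 0) :
    ∃ m : cokernel b ⊗ cokernel b ⟶ cokernel b,
      (cokernel.π b ⊗ₘ cokernel.π b) ≫ m = μ[Z] ≫ cokernel.π b := by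
  obtain ⟨g, hg⟩ := exists_whiskerLeft_desc b Z (μ[Z] ≫ cokernel.π b) hr
  obtain ⟨m, hm⟩ := exists_whiskerRight_desc b (cokernel b) g (by
    rw [← cancel_epi (B ◁ cokernel.π b), whisker_exchange_assoc, hg, hl, comp_zero])
  exact ⟨m, by rw [MonoidalCategory.tensorHom_def', Category.assoc, hm, hg]⟩

/-- The quotient of the algebra `Z` by the image of `b`, if the latter is a two-sided ideal. The
multiplication is determined by the requirement that the projection be multiplicative. -/
def quotientAlgebra (hl : b ▷ Z ≫ μ[Z] ≫ cokernel.π b = 0)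
    (hr : Z ◁ b ≫ μ[Z] ≫ cokernel.π b = 0) : Mon C where
  X := cokernel b
  mon :=
    { one := η[Z] ≫ cokernel.π b
      mul := Classical.choose (exists_quotientMul b hl hr)
      one_mul := by
        have hm := Classical.choose_spec (exists_quotientMul b hl hr)
        rw [← cancel_epi (𝟙_ C ◁ cokernel.π b), ← MonoidalCategory.tensorHom_def'_assoc,
          ← whiskerRight_comp_tensorHom_assoc, hm, leftUnitor_naturality, MonObj.one_mul_assoc]
      mul_one := by
        have hm := Classical.choose_spec (exists_quotientMul b hl hr)
        rw [← cancel_epi (cokernel.π b ▷ 𝟙_ C), ← MonoidalCategory.tensorHom_def_assoc,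
          ← whiskerLeft_comp_tensorHom_assoc, hm, rightUnitor_naturality, MonObj.mul_one_assoc]
      mul_assoc := by
        have hm := Classical.choose_spec (exists_quotientMul b hl hr)
        rw [← cancel_epi ((cokernel.π b ⊗ₘ cokernel.π b) ⊗ₘ cokernel.π b),
          tensorHom_comp_whiskerRight_assoc, hm, associator_naturality_assoc,
          tensorHom_comp_whiskerLeft_assoc, hm, ← whiskerRight_comp_tensorHom_assoc,
          ← whiskerLeft_comp_tensorHom_assoc, hm, MonObj.mul_assoc_assoc] }

end QuotientAlgebra

/-- An odd endomorphism of square zero, as an action of an abelian Lie algebra. -/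
def LieMod.ofSquareZero {P X : C} (d : P ⊗ X ⟶ X) (h : P ◁ d ≫ d = 0) :
    LieMod (LieObj.abelian P) where
  X := X
  act := d
  bracket_act := by
    change (0 : P ⊗ P ⟶ P) ▷ X ≫ d = (α_ P P X).hom ≫ P ◁ d ≫ d -
      (β_ P P).hom ▷ X ≫ (α_ P P X).hom ≫ P ◁ d ≫ d
    rw [h]
    simp

section Nested

/-- A subobject that is stable under the action is a module. -/
def LieMod.sub {L : LieObj C} (M : LieMod L) {K : C} (k : K ⟶ M.X) [Mono k] (e : L.X ⊗ K ⟶ K)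
    (he : e ≫ k = L.X ◁ k ≫ M.act) : LieMod L where
  X := K
  act := e
  bracket_act := by
    have h1 : L.X ◁ e ≫ e ≫ k = L.X ◁ L.X ◁ k ≫ L.X ◁ M.act ≫ M.act := by
      rw [he, ← MonoidalCategory.whiskerLeft_comp_assoc, he,
        MonoidalCategory.whiskerLeft_comp_assoc]
    rw [← cancel_mono k]
    simp only [Preadditive.sub_comp, Category.assoc, h1]
    rw [he, ← whisker_exchange_assoc, M.bracket_act, ← associator_naturality_right_assoc,
      ← whisker_exchange_assoc, Preadditive.comp_sub]

lemma trivial_isLeftAdjoint_nested {Q : LieObj C} (L : LieObj (LieMod Q))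
    (h : ∀ M : LieMod L, ∃ (K : C) (k : K ⟶ M.X.X), Mono k ∧ L.X.X ◁ k ≫ M.act.hom = 0 ∧
      ∀ (Y : C) (f : Y ⟶ M.X.X), L.X.X ◁ f ≫ M.act.hom = 0 → ∃ g : Y ⟶ K, g ≫ k = f) :
    (LieMod.trivial L).IsLeftAdjoint := by
  refine trivial_isLeftAdjoint fun M => ?_
  obtain ⟨K, k, hk, hk0, hK⟩ := h M
  have hs : L.X.X ◁ (Q.X ◁ k ≫ M.X.act) ≫ M.act.hom = 0 := by
    have h1 : Q.X ◁ M.act.hom ≫ M.X.act =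
        (actL L.X.act M.X.X + actR L.X.X M.X.act) ≫ M.act.hom := M.act.comm
    have h2 := Q.X ◁ L.X.X ◁ k ≫= h1
    rw [← MonoidalCategory.whiskerLeft_comp_assoc, hk0, Preadditive.add_comp, Preadditive.comp_add,
      reassoc_of% (actL_whiskerLeft L.X.act k), hk0] at h2
    simp only [MonoidalPreadditive.whiskerLeft_zero, zero_comp, comp_zero, zero_add] at h2
    have h3 : Q.X ◁ L.X.X ◁ k ≫ actR L.X.X M.X.act =
        (α_ _ _ _).inv ≫ (β_ _ _).hom ▷ K ≫ (α_ _ _ _).hom ≫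
          L.X.X ◁ (Q.X ◁ k ≫ M.X.act) := by
      have h4 : Q.X ◁ L.X.X ◁ k ≫ (α_ Q.X L.X.X M.X.X).inv ≫ (β_ Q.X L.X.X).hom ▷ M.X.X =
          (α_ Q.X L.X.X K).inv ≫ (β_ Q.X L.X.X).hom ▷ K ≫ (L.X.X ⊗ Q.X) ◁ k := by
        rw [← whisker_exchange, associator_inv_naturality_right_assoc]
      rw [actR, reassoc_of% h4]
      simp
    rw [reassoc_of% h3] at h2
    rw [← cancel_epi ((α_ Q.X L.X.X K).inv ≫ (β_ Q.X L.X.X).hom ▷ K ≫ (α_ L.X.X Q.X K).hom)]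
    simpa using h2.symm
  obtain ⟨e, he⟩ := hK _ _ hs
  let k' : M.X.sub k e he ⟶ M.X := ⟨k, he.symm⟩
  refine ⟨M.X.sub k e he, k', (LieMod.forget Q).mono_of_mono_map hk, LieMod.hom_ext hk0, ?_⟩
  intro Y f hf
  obtain ⟨g, hg⟩ := hK Y.X f.hom (congrArg LieMod.Hom.hom hf)
  refine ⟨⟨g, ?_⟩, LieMod.hom_ext hg⟩
  change Q.X ◁ g ≫ e = Y.act ≫ g
  rw [← cancel_mono k, Category.assoc, he, ← MonoidalCategory.whiskerLeft_comp_assoc, hg,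
    Category.assoc, hg, f.comm]

end Nested

section InvariantsIncl
variable {L : LieObj C} [(LieMod.trivial L).IsLeftAdjoint]

/-- The inclusion of the invariants. -/
def invariantsIncl (M : LieMod L) : (invariants L).obj M ⟶ M.X :=
  ((invariantsAdj L).counit.app M).hom

lemma act_invariantsIncl (M : LieMod L) : L.X ◁ invariantsIncl M ≫ M.act = 0 :=
  ((invariantsAdj L).counit.app M).comm.trans zero_comp

instance (M : LieMod L) : Mono (invariantsIncl M) where
  right_cancellation {Y} f g h := by
    apply ((invariantsAdj L).homEquiv Y M).symm.injective
    rw [Adjunction.homEquiv_counit, Adjunction.homEquiv_counit]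
    exact LieMod.hom_ext h

/-- The factorization through the invariants of a morphism which is killed by `L`. -/
def invariantsLift {Y : C} (M : LieMod L) (f : Y ⟶ M.X) (hf : L.X ◁ f ≫ M.act = 0) :
    Y ⟶ (invariants L).obj M :=
  (invariantsAdj L).homEquiv Y M ⟨f, hf.trans zero_comp.symm⟩

lemma invariantsLift_incl {Y : C} (M : LieMod L) (f : Y ⟶ M.X) (hf : L.X ◁ f ≫ M.act = 0) :
    invariantsLift M f hf ≫ invariantsIncl M = f := by
  have h := ((invariantsAdj L).homEquiv Y M).symm_apply_apply ⟨f, hf.trans zero_comp.symm⟩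
  rw [Adjunction.homEquiv_counit] at h
  exact congrArg LieMod.Hom.hom h

lemma mul_invariantsIncl (A : Mon (LieMod L)) :
    μ[((invariants L).mapMon.obj A).X] ≫ invariantsIncl A.X =
      (invariantsIncl A.X ⊗ₘ invariantsIncl A.X) ≫ μ[A.X].hom := by
  have h1 := congrArg LieMod.Hom.hom ((invariantsAdj L).map_μ_comp_counit_app_tensor A.X A.X)
  have h2 := congrArg LieMod.Hom.hom ((invariantsAdj L).counit.naturality μ[A.X])
  change Functor.LaxMonoidal.μ (invariants L) A.X A.X ≫ invariantsIncl (A.X ⊗ A.X) =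
    𝟙 _ ≫ (invariantsIncl A.X ⊗ₘ invariantsIncl A.X) at h1
  change (invariants L).map μ[A.X] ≫ invariantsIncl A.X =
    invariantsIncl (A.X ⊗ A.X) ≫ μ[A.X].hom at h2
  change (Functor.LaxMonoidal.μ (invariants L) A.X A.X ≫ (invariants L).map μ[A.X]) ≫ _ = _
  rw [Category.assoc, h2, reassoc_of% h1]

end InvariantsIncl

section Boundary
variable {P A Z W : C} {d : P ⊗ A ⟶ A} {m : A ⊗ A ⟶ A} (mZ : Z ⊗ Z ⟶ Z) (i : Z ⟶ A) [Mono i]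
  (b : P ⊗ A ⟶ Z) {p : Z ⟶ W}

lemma boundary_mul (hb : b ≫ i = d) (hi : P ◁ i ≫ d = 0) (hm : mZ ≫ i = (i ⊗ₘ i) ≫ m)
    (hd : P ◁ m ≫ d = (actL d A + actR A d) ≫ m) (hp : b ≫ p = 0) : b ▷ Z ≫ mZ ≫ p = 0 := by
  have h := P ◁ A ◁ i ≫= hd
  have h0 : P ◁ A ◁ i ≫ actR A d = 0 := by
    have h4 : P ◁ A ◁ i ≫ (α_ P A A).inv ≫ (β_ P A).hom ▷ A = (α_ _ _ _).inv ≫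
        (β_ _ _).hom ▷ _ ≫ (A ⊗ P) ◁ i := by
      rw [← whisker_exchange, associator_inv_naturality_right_assoc]
    rw [actR, reassoc_of% h4, associator_naturality_right_assoc,
      ← MonoidalCategory.whiskerLeft_comp, hi]
    simp
  rw [Preadditive.add_comp, Preadditive.comp_add, reassoc_of% h0, zero_comp, add_zero, actL] at h
  have key : b ▷ Z ≫ mZ = (α_ _ _ _).hom ≫ P ◁ (A ◁ i ≫ m) ≫ b := by
    rw [← cancel_mono i]
    simp only [Category.assoc, hb, hm, MonoidalCategory.whiskerLeft_comp]
    rw [h, whiskerRight_comp_tensorHom_assoc, hb, MonoidalCategory.tensorHom_def']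
    simp
  rw [reassoc_of% key, hp]
  simp

lemma mul_boundary (hb : b ≫ i = d) (hi : P ◁ i ≫ d = 0) (hm : mZ ≫ i = (i ⊗ₘ i) ≫ m)
    (hd : P ◁ m ≫ d = (actL d A + actR A d) ≫ m) (hp : b ≫ p = 0) : Z ◁ b ≫ mZ ≫ p = 0 := by
  have h := P ◁ i ▷ A ≫= hd
  have h0 : P ◁ i ▷ A ≫ actL d A = 0 := by
    rw [actL, associator_inv_naturality_middle_assoc, ← comp_whiskerRight, hi]
    simp
  rw [Preadditive.add_comp, Preadditive.comp_add, reassoc_of% h0, zero_comp, zero_add,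
    reassoc_of% (actR_whiskerRight d i), actR] at h
  have h6 : ∀ {X : C} (t : Z ⊗ (P ⊗ A) ⟶ X), (α_ _ _ _).inv ≫ (β_ _ _).hom ▷ _ ≫
      (α_ _ _ _).hom ≫ (α_ _ _ _).inv ≫ (β_ _ _).hom ▷ _ ≫ (α_ _ _ _).hom ≫ t = t := by
    intro X t
    rw [Iso.hom_inv_id_assoc, ← comp_whiskerRight_assoc, SymmetricCategory.symmetry]
    simp
  have key : Z ◁ b ≫ mZ = (α_ _ _ _).inv ≫ (β_ _ _).hom ▷ _ ≫ (α_ _ _ _).hom ≫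
      P ◁ (i ▷ A ≫ m) ≫ b := by
    rw [← cancel_mono i]
    simp only [Category.assoc, hb, hm, MonoidalCategory.whiskerLeft_comp]
    rw [h, whiskerLeft_comp_tensorHom_assoc, hb, MonoidalCategory.tensorHom_def']
    simp only [Category.assoc]
    rw [h6]
  rw [reassoc_of% key, hp]
  simp

end Boundary

end General

section Super
open MonObj
variable {C : Type u} [Category.{v} C] [Abelian C] [MonoidalCategory C] [MonoidalPreadditive C]
  [SymmetricCategory C]

/-- The second symmetric power. -/
def symSq (X : C) : C := cokernel (𝟙 (X ⊗ X) - (β_ X X).hom)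

/-- The second exterior power. -/
def altSq (X : C) : C := cokernel (𝟙 (X ⊗ X) + (β_ X X).hom)

/-- A supercategory: a well-powered and complete `ℚ`-linear abelian tensor category, equipped with
an object `P` (the field `oddObj`) such that `Λ²(P) ≅ 𝟙_ C` and `S²(P) ≅ 0`. The tensor product is right exact and it
commutes with countable direct sums. -/
class Supercategory (C : Type u) [Category.{v} C] [Abelian C] [MonoidalCategory C]
    [MonoidalPreadditive C] [SymmetricCategory C] [Linear ℚ C] where
  wellPowered : WellPowered.{v} C
  hasLimits : HasLimits C
  hasCountableCoproducts : HasCountableCoproducts C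
  tensor_rightExact (X : C) : PreservesFiniteColimits (tensorLeft X)
  tensor_coproducts (X : C) : PreservesColimitsOfShape (Discrete ℕ) (tensorLeft X)
  oddObj : C
  altIso : altSq oddObj ≅ 𝟙_ C
  symSq_isZero : IsZero (symSq oddObj)

namespace Supercategory

attribute [instance] tensor_rightExact

variable (C) [Linear ℚ C] [Supercategory C]

/-- The chosen object `P`. -/
abbrev P : C := oddObj

lemma braiding_P : (β_ (P C) (P C)).hom = -𝟙 _ := by
  have h : Epi (𝟙 (P C ⊗ P C) - (β_ (P C) (P C)).hom) :=
    Preadditive.epi_of_isZero_cokernel _ symSq_isZero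
  have h1 : (𝟙 (P C ⊗ P C) - (β_ (P C) (P C)).hom) ≫ (𝟙 (P C ⊗ P C) + (β_ (P C) (P C)).hom) =
      0 := by
    simp
  rw [← neg_eq_iff_eq_neg, eq_comm, ← add_eq_zero_iff_eq_neg]
  rw [← cancel_epi (𝟙 (P C ⊗ P C) - (β_ (P C) (P C)).hom), h1, comp_zero]

/-- The isomorphism `P ⊗ P = Λ²(P) ≅ 𝟙_ C`. -/
def oddPairing : P C ⊗ P C ⟶ 𝟙_ C :=
  cokernel.π _ ≫ altIso.hom

instance : IsIso (oddPairing C) := by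
  have h : 𝟙 (P C ⊗ P C) + (β_ (P C) (P C)).hom = 0 := by
    rw [braiding_P, add_neg_cancel]
  have : IsIso (cokernel.π (𝟙 (P C ⊗ P C) + (β_ (P C) (P C)).hom)) := by
    have : ∀ f : P C ⊗ P C ⟶ P C ⊗ P C, f = 0 → IsIso (cokernel.π f) := by
      rintro _ rfl
      infer_instance
    exact this _ h
  exact IsIso.comp_isIso' this (Iso.isIso_hom altIso)

instance : (tensorLeft (P C)).IsLeftAdjoint := by
  let e : tensorLeft (P C) ⋙ tensorLeft (P C) ≅ 𝟭 C :=
    (tensorLeftTensor (P C) (P C)).symm ≪≫ (tensoringLeft C).mapIso (asIso (oddPairing C)) ≪≫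
      leftUnitorNatIso C
  have : (tensorLeft (P C)).IsEquivalence :=
    (CategoryTheory.Equivalence.mk (tensorLeft (P C)) (tensorLeft (P C)) e.symm e).isEquivalence_functor
  infer_instance

/-- The abelian Lie algebra on `P`; its modules are the objects `X` equipped with an odd
endomorphism `d : P ⊗ X ⟶ X` of square zero. -/
abbrev Q : LieObj C := LieObj.abelian (P C)

instance : (tensorLeft (Q C).X).IsLeftAdjoint :=
  inferInstanceAs (tensorLeft (P C)).IsLeftAdjoint

/-- The symmetric algebra `S(P) = 𝟙_ C ⊞ P` with the differential mapping `P` identically to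
`𝟙_ C`. -/
def D : LieMod (Q C) :=
  LieMod.ofSquareZero (dualNumbersD (oddPairing C)) (dualNumbersD_comp (oddPairing C))

instance : MonObj (D C) where
  one := ⟨(biprod.inl : 𝟙_ C ⟶ 𝟙_ C ⊞ P C), by
    change P C ◁ biprod.inl ≫ dualNumbersD (oddPairing C) = 0 ≫ _
    simp [dualNumbersD, ← MonoidalCategory.whiskerLeft_comp_assoc]⟩
  mul := ⟨dualNumbersMul (P C), dualNumbersD_mul (braiding_P C) (oddPairing C)⟩
  one_mul := LieMod.hom_ext (MonObj.one_mul (𝟙_ C ⊞ P C))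
  mul_one := LieMod.hom_ext (MonObj.mul_one (𝟙_ C ⊞ P C))
  mul_assoc := LieMod.hom_ext (MonObj.mul_assoc (𝟙_ C ⊞ P C))

instance : IsCommMonObj (D C) where
  mul_comm := LieMod.hom_ext (IsCommMonObj.mul_comm (𝟙_ C ⊞ P C))

/-- The pairing of `D` with itself that contracts the components in `P`. -/
def kappa : D C ⊗ D C ⟶ 𝟙_ (LieMod (Q C)) :=
  ⟨topPairing (oddPairing C), by
    change P C ◁ topPairing (oddPairing C) ≫ 0 =
      (actL (dualNumbersD (oddPairing C)) (𝟙_ C ⊞ P C) +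
        actR (𝟙_ C ⊞ P C) (dualNumbersD (oddPairing C))) ≫ topPairing (oddPairing C)
    simp only [topPairing, actL, actR, Preadditive.add_comp, Category.assoc,
      whiskerRight_comp_tensorHom_assoc, whiskerLeft_comp_tensorHom_assoc, dualNumbersD_snd]
    simp⟩

variable {C}

/-- The doubled Lie algebra `L = D ⊗ L₀` in `Mod(Q)`. -/
def doubled (L₀ : LieObj C) : LieObj (LieMod (Q C)) :=
  LieObj.extendScalars (D C) (LieObj.withTrivialAction (Q C) L₀)

section Weil
variable (L₀ : LieObj C) [QuadraticLieObj L₀]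

/-- The form of `L₀`, as a morphism of modules with trivial action. -/
def trivialForm : (LieObj.withTrivialAction (Q C) L₀).X ⊗ (LieObj.withTrivialAction (Q C) L₀).X ⟶
    𝟙_ (LieMod (Q C)) :=
  ⟨QuadraticLieObj.form L₀, (LieMod.zero_comm (QuadraticLieObj.form L₀)).trans
    (congrArg (· ≫ QuadraticLieObj.form L₀)
      (LieMod.trivial_tensor_act (L := Q C) L₀.X L₀.X).symm)⟩

/-- The cocycle of `L = D ⊗ L₀` which is the tensor product of the pairing of `D` and of the form
of `L₀`; it pairs the component `P ⊗ L₀` of `L` with itself. -/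
def weilCocycle : (doubled L₀).X ⊗ (doubled L₀).X ⟶ 𝟙_ (LieMod (Q C)) :=
  pairing (kappa C) (trivialForm L₀) ≫ (λ_ _).hom

lemma isCocycle_weilCocycle : LieObj.IsCocycle (doubled L₀) (weilCocycle L₀) :=
  LieObj.isCocycle_extendScalars (D C) _ (kappa C) (trivialForm L₀)
    (LieMod.hom_ext (braiding_topPairing (braiding_P C) (oddPairing C)))
    (LieMod.hom_ext (topPairing_cocycle (braiding_P C) (oddPairing C)))
    (LieMod.hom_ext (QuadraticLieObj.form_symm L₀))
    (LieMod.hom_ext (QuadraticLieObj.form_invariant L₀))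

/-- The unital Weil object `M_L` of a quadratic Lie algebra, as a unital Lie algebra in
`𝓛 = Mod(L)`: the central extension of `L = D ⊗ L₀` by the unit object. -/
def weil : UnitalLieObj (LieMod (doubled L₀)) :=
  LieObj.centralExtension (doubled L₀) (weilCocycle L₀) (isCocycle_weilCocycle L₀)

end Weil

section Double

instance tensorLeft_tensor_isLeftAdjoint (A B : C) [(tensorLeft A).IsLeftAdjoint]
    [(tensorLeft B).IsLeftAdjoint] : (tensorLeft (A ⊗ B)).IsLeftAdjoint :=
  Functor.isLeftAdjoint_of_iso (tensorLeftTensor A B).symm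

instance tensorLeft_unit_isLeftAdjoint : (tensorLeft (𝟙_ C)).IsLeftAdjoint :=
  Functor.isLeftAdjoint_of_iso (leftUnitorNatIso C).symm

lemma eq_zero_of_biprod {A B L Y Z : C} (g : ((A ⊞ B) ⊗ L) ⊗ Y ⟶ Z)
    (h1 : biprod.inl ▷ L ▷ Y ≫ g = 0) (h2 : biprod.inr ▷ L ▷ Y ≫ g = 0) : g = 0 := by
  have h : 𝟙 (((A ⊞ B) ⊗ L) ⊗ Y) = biprod.fst ▷ L ▷ Y ≫ biprod.inl ▷ L ▷ Y +
      biprod.snd ▷ L ▷ Y ≫ biprod.inr ▷ L ▷ Y := by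
    simp only [← comp_whiskerRight, ← MonoidalPreadditive.add_whiskerRight, biprod.total,
      id_whiskerRight]
  rw [← Category.id_comp g, h, Preadditive.add_comp, Category.assoc, Category.assoc, h1, h2]
  simp

instance trivial_doubled_isLeftAdjoint (L₀ : LieObj C) [(tensorLeft L₀.X).IsLeftAdjoint] :
    (LieMod.trivial (doubled L₀)).IsLeftAdjoint :=
  trivial_isLeftAdjoint_nested _ fun M => by
    let m : ((𝟙_ C ⊞ P C) ⊗ L₀.X) ⊗ M.X.X ⟶ M.X.X := M.act.hom
    obtain ⟨K, k, hk, h1, h2, h3⟩ := exists_killed (A := 𝟙_ C ⊗ L₀.X) (B := P C ⊗ L₀.X)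
      ((biprod.inl : 𝟙_ C ⟶ 𝟙_ C ⊞ P C) ▷ L₀.X ▷ M.X.X ≫ m)
      ((biprod.inr : P C ⟶ 𝟙_ C ⊞ P C) ▷ L₀.X ▷ M.X.X ≫ m)
    refine ⟨K, k, hk, ?_, fun Y f hf => h3 Y f ?_ ?_⟩
    · change ((𝟙_ C ⊞ P C) ⊗ L₀.X) ◁ k ≫ m = 0
      apply eq_zero_of_biprod
      · rw [← whisker_exchange_assoc, h1]
      · rw [← whisker_exchange_assoc, h2]
    · change ((𝟙_ C ⊞ P C) ⊗ L₀.X) ◁ f ≫ m = 0 at hf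
      rw [whisker_exchange_assoc, hf, comp_zero]
    · change ((𝟙_ C ⊞ P C) ⊗ L₀.X) ◁ f ≫ m = 0 at hf
      rw [whisker_exchange_assoc, hf, comp_zero]

end Double

section Cohomology

lemma comp_self_eq_zero {X : C} (d : P C ⊗ X ⟶ X)
    (h : (0 : P C ⊗ P C ⟶ P C) ▷ X ≫ d = (α_ (P C) (P C) X).hom ≫ P C ◁ d ≫ d -
      (β_ (P C) (P C)).hom ▷ X ≫ (α_ (P C) (P C) X).hom ≫ P C ◁ d ≫ d) : P C ◁ d ≫ d = 0 := by
  rw [braiding_P, neg_whiskerRight', id_whiskerRight, Preadditive.neg_comp, Category.id_comp,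
    sub_neg_eq_add, MonoidalPreadditive.zero_whiskerRight, zero_comp, ← two_smul ℚ, eq_comm,
    smul_eq_zero, or_iff_right two_ne_zero, ← comp_zero (f := (α_ (P C) (P C) X).hom),
    cancel_epi] at h
  exact h

/-- The differential `d : P ⊗ X ⟶ ker d` of a module `(X, d)` over `Q`. -/
def boundary (X : LieMod (Q C)) : P C ⊗ X.X ⟶ (invariants (Q C)).obj X :=
  invariantsLift X X.act (comp_self_eq_zero X.act X.bracket_act)

lemma boundary_incl (X : LieMod (Q C)) : boundary X ≫ invariantsIncl X = X.act :=
  invariantsLift_incl X X.act (comp_self_eq_zero X.act X.bracket_act)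

/-- The cohomology `H(A) = ker d / im d` of an algebra `A` in `Mod(Q)`, as an algebra in `C`. -/
def cohomology (A : Mon (LieMod (Q C))) : Mon C :=
  quotientAlgebra (Z := ((invariants (Q C)).mapMon.obj A).X) (boundary A.X)
    (boundary_mul (Z := (invariants (Q C)).obj A.X) μ[((invariants (Q C)).mapMon.obj A).X]
      (invariantsIncl A.X) (boundary A.X) (boundary_incl A.X)
      (act_invariantsIncl A.X) (mul_invariantsIncl A)
      μ[A.X].comm (cokernel.condition (boundary A.X)))
    (mul_boundary (Z := (invariants (Q C)).obj A.X) μ[((invariants (Q C)).mapMon.obj A).X]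
      (invariantsIncl A.X) (boundary A.X) (boundary_incl A.X)
      (act_invariantsIncl A.X) (mul_invariantsIncl A)
      μ[A.X].comm (cokernel.condition (boundary A.X)))

/-- The `𝓛`-cohomology `H(E) = H(E ^ L)` of an algebra `E` in `𝓛 = Mod(L)`, `L = D ⊗ L₀`: the
cohomology of the algebra in `Mod(Q)` of `L`-invariants. -/
def LCohomology (L₀ : LieObj C) [(tensorLeft L₀.X).IsLeftAdjoint]
    (E : Mon (LieMod (doubled L₀))) : Mon C :=
  cohomology ((invariants (doubled L₀)).mapMon.obj E)

end Cohomology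

end Supercategory
end Super
end SuperCat
end

/-! Put V = P ⊗ L₀. As an algebra in C, E_L is generated by L₀ and V; the relations are those of
U(L₀), the action of L₀ on V by commutators, and v w - w v = ω(v, w), where ω is the product of the
pairing of P with the form B. All signs are hidden in the braiding. Since P is odd and B is
symmetric, ω is skew, so V generates a Weyl algebra (a Clifford algebra from the point of view of
L₀). As L₀ preserves ω, the quadratic element spin(x) = ½ ∑ (x eᵢ) eⁱ has the same commutators with
V as x. Hence the elements x - spin(x) commute with V; they again satisfy the relations of L₀ and
define a morphism of algebras θ : U(L₀) → E_L into the centralizer of V (`IsWeil.twisted`,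
`IsWeil.exists_hom`).

The main point is that θ is an isomorphism onto this centralizer (`IsWeil.exists_centralizer`). Let
T = S(V). When v acts by multiplication plus half of the contraction, T ⊗ U(L₀) becomes an
E_L-module, and acting on 1 ⊗ 1 gives a symbol map σ : E_L → T ⊗ U(L₀). In the other direction the
operators a ↦ ½ (v a + a v) commute with one another and give a symmetrization map φ with φ ∘ σ =
id. The symbol turns commutators with V into contractions. Over ℚ, a tensor that is killed by all
contractions, hence by the Euler operator, is constant in T. So the centralizer of V is the image of
θ, and the constant term of σ is a left inverse of θ. No PBW theorem is needed.

The Lie algebra L acts on E_L by commutators. Invariance under P ⊗ L₀ means lying in the image of θ,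
and since θ is equivariant for the adjoint actions of L₀, the invariants of L are U(L₀)^{L₀}. The
differential d vanishes on them: the parity automorphism τ, which fixes L₀ and is -1 on V,
anticommutes with d and fixes the image of θ, while d preserves invariants; therefore d u = τ(d u) =
-d(τ u) = -d u (`IsWeil.whiskerLeft_derivation_eq_zero`). With zero differential the cohomology is
the algebra of invariants itself.

In the absence of elements, an algebra given by generators and relations is handled through its
modules: `FreeOn` says that A ⊗ Y is the free module on Y among objects with an action of the
generators that satisfies the relations. Morphisms, derivations and identities all come from this
freeness. The algebra is built in C, then receives the derivation extending d
(`FreeOn.exists_module`) and the adjoint action of L (`FreeOn.isUnitalEnvelopingAlgebra`). -/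

noncomputable section
set_option linter.unusedSectionVars false
namespace SuperCat
-- Calculus of actions, contractions and commutators
section Operators
variable {C : Type u} [Category.{v} C] [Preadditive C] [MonoidalCategory C] [MonoidalPreadditive C]
  [SymmetricCategory C]

/-- Exchange of the first two factors of a right-nested tensor product. -/
def sw (X Y Z : C) : X ⊗ (Y ⊗ Z) ⟶ Y ⊗ (X ⊗ Z) :=
  (α_ X Y Z).inv ≫ (β_ X Y).hom ▷ Z ≫ (α_ Y X Z).hom

/-- Application of `k : X ⊗ Y ⟶ W` to the first two factors. -/
def opw {X Y W : C} (k : X ⊗ Y ⟶ W) (Z : C) : X ⊗ (Y ⊗ Z) ⟶ W ⊗ Z := (α_ X Y Z).inv ≫ k ▷ Z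

/-- Contraction of the first two factors by a pairing. -/
def opi {X Y : C} (k : X ⊗ Y ⟶ 𝟙_ C) (Z : C) : X ⊗ (Y ⊗ Z) ⟶ Z := opw k Z ≫ (λ_ Z).hom

/-- Application of `q : X ⟶ Y ⊗ W` to the first factor. -/
def cop {X Y W : C} (q : X ⟶ Y ⊗ W) (Z : C) : X ⊗ Z ⟶ Y ⊗ (W ⊗ Z) := q ▷ Z ≫ (α_ Y W Z).hom

/-- Insertion of a copairing. -/
def coi {Y W : C} (c : 𝟙_ C ⟶ Y ⊗ W) (Z : C) : Z ⟶ Y ⊗ (W ⊗ Z) := (λ_ Z).inv ≫ cop c Z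

@[simp]
lemma sw_sw (X Y Z : C) : sw X Y Z ≫ sw Y X Z = 𝟙 _ := by
  simp only [sw, Category.assoc, Iso.hom_inv_id_assoc]
  rw [← comp_whiskerRight_assoc, SymmetricCategory.symmetry]
  simp

@[simp]
lemma sw_sw_assoc (X Y Z : C) {T : C} (h : X ⊗ (Y ⊗ Z) ⟶ T) : sw X Y Z ≫ sw Y X Z ≫ h = h := by
  rw [reassoc_of% (sw_sw X Y Z)]

instance (X Y Z : C) : IsIso (sw X Y Z) := ⟨sw Y X Z, sw_sw X Y Z, sw_sw Y X Z⟩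

@[simp]
lemma whiskerLeft_sw_sw (W X Y Z : C) : W ◁ sw X Y Z ≫ W ◁ sw Y X Z = 𝟙 _ := by
  rw [← MonoidalCategory.whiskerLeft_comp, sw_sw, MonoidalCategory.whiskerLeft_id]

@[simp]
lemma whiskerLeft_sw_sw_assoc (W X Y Z : C) {T : C} (h : W ⊗ (X ⊗ (Y ⊗ Z)) ⟶ T) :
    W ◁ sw X Y Z ≫ W ◁ sw Y X Z ≫ h = h := by
  rw [reassoc_of% (whiskerLeft_sw_sw W X Y Z)]

lemma sw_naturality (X Y : C) {Z Z' : C} (f : Z ⟶ Z') :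
    X ◁ Y ◁ f ≫ sw X Y Z' = sw X Y Z ≫ Y ◁ X ◁ f := by
  simp only [sw, Category.assoc, associator_inv_naturality_right_assoc]
  rw [whisker_exchange_assoc, associator_naturality_right]

lemma sw_naturality_assoc (X Y : C) {Z Z' T : C} (f : Z ⟶ Z') (h : Y ⊗ (X ⊗ Z') ⟶ T) :
    X ◁ Y ◁ f ≫ sw X Y Z' ≫ h = sw X Y Z ≫ Y ◁ X ◁ f ≫ h := by
  rw [reassoc_of% (sw_naturality X Y f)]

lemma sw_naturality_left {X X' : C} (f : X ⟶ X') (Y Z : C) :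
    f ▷ (Y ⊗ Z) ≫ sw X' Y Z = sw X Y Z ≫ Y ◁ f ▷ Z := by
  simp only [sw, Category.assoc]
  rw [associator_inv_naturality_left_assoc, ← comp_whiskerRight_assoc,
    BraidedCategory.braiding_naturality_left, comp_whiskerRight_assoc,
    associator_naturality_middle]

lemma sw_naturality_middle (X : C) {Y Y' : C} (f : Y ⟶ Y') (Z : C) :
    X ◁ f ▷ Z ≫ sw X Y' Z = sw X Y Z ≫ f ▷ (X ⊗ Z) := by
  rw [← cancel_mono (sw Y' X Z), Category.assoc, Category.assoc, sw_sw, sw_naturality_left,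
    sw_sw_assoc, Category.comp_id]

lemma opw_naturality {X Y W : C} (k : X ⊗ Y ⟶ W) {Z Z' : C} (f : Z ⟶ Z') :
    X ◁ Y ◁ f ≫ opw k Z' = opw k Z ≫ W ◁ f := by
  simp only [opw, Category.assoc, associator_inv_naturality_right_assoc, whisker_exchange]

lemma opi_naturality {X Y : C} (k : X ⊗ Y ⟶ 𝟙_ C) {Z Z' : C} (f : Z ⟶ Z') :
    X ◁ Y ◁ f ≫ opi k Z' = opi k Z ≫ f := by
  simp only [opi, Category.assoc, reassoc_of% @opw_naturality, leftUnitor_naturality]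

lemma cop_naturality {X Y W : C} (q : X ⟶ Y ⊗ W) {Z Z' : C} (f : Z ⟶ Z') :
    X ◁ f ≫ cop q Z' = cop q Z ≫ Y ◁ W ◁ f := by
  simp only [cop, Category.assoc, whisker_exchange_assoc, associator_naturality_right]

lemma coi_naturality {Y W : C} (c : 𝟙_ C ⟶ Y ⊗ W) {Z Z' : C} (f : Z ⟶ Z') :
    f ≫ coi c Z' = coi c Z ≫ Y ◁ W ◁ f := by
  simp only [coi, Category.assoc, ← cop_naturality, leftUnitor_inv_naturality_assoc]

/-- A strand A may pass an operation k before or after it is performed: this is the hexagon identity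
for A and X ⊗ Y, together with naturality of the braiding. The rules for contractions and copairings
below are variants of it. -/
lemma whiskerLeft_opw_sw (A : C) {X Y W : C} (k : X ⊗ Y ⟶ W) (Z : C) :
    A ◁ opw k Z ≫ sw A W Z = sw A X (Y ⊗ Z) ≫ X ◁ sw A Y Z ≫ opw k (A ⊗ Z) := by
  have h : A ◁ (α_ X Y Z).inv ≫ sw A (X ⊗ Y) Z =
      sw A X (Y ⊗ Z) ≫ X ◁ sw A Y Z ≫ (α_ X Y (A ⊗ Z)).inv := by
    simp [sw, BraidedCategory.braiding_tensor_right_hom]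
  simp only [opw, MonoidalCategory.whiskerLeft_comp, Category.assoc, sw_naturality_middle,
    reassoc_of% h]

lemma opw_sw {X Y W : C} (k : X ⊗ Y ⟶ W) (B Z : C) :
    opw k (B ⊗ Z) ≫ sw W B Z = X ◁ sw Y B Z ≫ sw X B (Y ⊗ Z) ≫ B ◁ opw k Z := by
  rw [← cancel_mono (sw B W Z), Category.assoc, Category.assoc, Category.assoc, sw_sw,
    whiskerLeft_opw_sw, sw_sw_assoc, whiskerLeft_sw_sw_assoc, Category.comp_id]

lemma whiskerLeft_opi (A : C) {X Y : C} (k : X ⊗ Y ⟶ 𝟙_ C) (Z : C) :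
    A ◁ opi k Z = sw A X (Y ⊗ Z) ≫ X ◁ sw A Y Z ≫ opi k (A ⊗ Z) := by
  have h : A ◁ (λ_ Z).hom = sw A (𝟙_ C) Z ≫ (λ_ (A ⊗ Z)).hom := by
    simp [sw]
  rw [opi, MonoidalCategory.whiskerLeft_comp, h, reassoc_of% @whiskerLeft_opw_sw, opi]

lemma sw_whiskerLeft_cop (A : C) {X Y W : C} (q : X ⟶ Y ⊗ W) (Z : C) :
    A ◁ cop q Z ≫ sw A Y (W ⊗ Z) ≫ Y ◁ sw A W Z = sw A X Z ≫ cop q (A ⊗ Z) := by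
  have h : A ◁ (α_ Y W Z).hom ≫ sw A Y (W ⊗ Z) ≫ Y ◁ sw A W Z =
      sw A (Y ⊗ W) Z ≫ (α_ Y W (A ⊗ Z)).hom := by
    simp [sw, BraidedCategory.braiding_tensor_right_hom]
  rw [cop, MonoidalCategory.whiskerLeft_comp, Category.assoc, h, reassoc_of% @sw_naturality_middle, cop]

lemma cop_sw_sw {X Y W : C} (q : X ⟶ Y ⊗ W) (A Z : C) :
    cop q (A ⊗ Z) ≫ Y ◁ sw W A Z ≫ sw Y A (W ⊗ Z) = sw X A Z ≫ A ◁ cop q Z := by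
  rw [← cancel_epi (sw A X Z), ← reassoc_of% @sw_whiskerLeft_cop, whiskerLeft_sw_sw_assoc, sw_sw,
    sw_sw_assoc, Category.comp_id]

lemma sw_coi (A : C) {Y W : C} (c : 𝟙_ C ⟶ Y ⊗ W) (Z : C) :
    A ◁ coi c Z ≫ sw A Y (W ⊗ Z) ≫ Y ◁ sw A W Z = coi c (A ⊗ Z) := by
  have h : A ◁ (λ_ Z).inv ≫ sw A (𝟙_ C) Z = (λ_ (A ⊗ Z)).inv := by
    simp [sw]
  rw [coi, MonoidalCategory.whiskerLeft_comp, Category.assoc, sw_whiskerLeft_cop,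
    reassoc_of% h, coi]

lemma sw_opw {X Y W : C} (k : X ⊗ Y ⟶ W) (Z : C) : sw Y X Z ≫ opw k Z = opw ((β_ Y X).hom ≫ k) Z := by
  simp [sw, opw]

lemma sw_opi {X Y : C} (k : X ⊗ Y ⟶ 𝟙_ C) (Z : C) :
    sw Y X Z ≫ opi k Z = opi ((β_ Y X).hom ≫ k) Z := by
  rw [opi, reassoc_of% @sw_opw, opi]

/-- The braid relation is the passage of the strand X past the operation β of Y and W. -/
lemma sw_braid (X Y W Z : C) : sw X Y (W ⊗ Z) ≫ Y ◁ sw X W Z ≫ sw Y W (X ⊗ Z) =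
    X ◁ sw Y W Z ≫ sw X W (Y ⊗ Z) ≫ W ◁ sw X Y Z := by
  have h := whiskerLeft_opw_sw X (𝟙 (Y ⊗ W)) Z
  have h1 : sw Y W Z = opw (β_ Y W).hom Z ≫ (α_ _ _ _).hom := by simp [sw, opw]
  have h2 : X ◁ (α_ W Y Z).hom ≫ sw X W (Y ⊗ Z) ≫ W ◁ sw X Y Z =
      sw X (W ⊗ Y) Z ≫ (α_ _ _ _).hom := by
    simp [sw, BraidedCategory.braiding_tensor_right_hom]
  rw [h1, MonoidalCategory.whiskerLeft_comp, Category.assoc, h2, reassoc_of% @whiskerLeft_opw_sw]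
  simp [sw, opw]

lemma opw_add {X Y W : C} (k l : X ⊗ Y ⟶ W) (Z : C) : opw (k + l) Z = opw k Z + opw l Z := by
  simp [opw]

lemma opw_neg {X Y W : C} (k : X ⊗ Y ⟶ W) (Z : C) : opw (-k) Z = -opw k Z := by
  simp [opw, neg_whiskerRight']

@[simp]
lemma opw_zero {X Y W : C} (Z : C) : opw (0 : X ⊗ Y ⟶ W) Z = 0 := by
  simp [opw]

lemma opi_neg {X Y : C} (k : X ⊗ Y ⟶ 𝟙_ C) (Z : C) : opi (-k) Z = -opi k Z := by
  simp [opi, opw_neg]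

@[simp]
lemma opi_zero {X Y : C} (Z : C) : opi (0 : X ⊗ Y ⟶ 𝟙_ C) Z = 0 := by
  simp [opi]

lemma opw_comp {X Y W W' : C} (k : X ⊗ Y ⟶ W) (f : W ⟶ W') (Z : C) :
    opw (k ≫ f) Z = opw k Z ≫ f ▷ Z := by
  simp [opw]

lemma opw_whisker {X Y X' Y' W : C} (f : X ⟶ X') (g : Y ⟶ Y') (k : X' ⊗ Y' ⟶ W) (Z : C) :
    opw ((f ⊗ₘ g) ≫ k) Z = X ◁ g ▷ Z ≫ f ▷ (Y' ⊗ Z) ≫ opw k Z := by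
  simp only [opw, MonoidalCategory.tensorHom_def', comp_whiskerRight, Category.assoc,
    associator_inv_naturality_left_assoc, associator_inv_naturality_middle_assoc]

lemma opi_whisker {X Y X' Y' : C} (f : X ⟶ X') (g : Y ⟶ Y') (k : X' ⊗ Y' ⟶ 𝟙_ C) (Z : C) :
    opi ((f ⊗ₘ g) ≫ k) Z = X ◁ g ▷ Z ≫ f ▷ (Y' ⊗ Z) ≫ opi k Z := by
  rw [opi, opw_whisker]
  simp [opi]

lemma actL_eq_opw {A X : C} (a : A ⊗ X ⟶ X) (Y : C) : actL a Y = opw a Y := rfl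

lemma actR_eq_sw {A Y : C} (X : C) (b : A ⊗ Y ⟶ Y) : actR X b = sw A X Y ≫ X ◁ b := by
  simp [actR, sw]

/-- The failure of `F : K ⊗ A ⟶ M` to commute with the actions `a` and `b` of `X`. -/
def icomm {K X A M : C} (F : K ⊗ A ⟶ M) (a : X ⊗ A ⟶ A) (b : X ⊗ M ⟶ M) :
    K ⊗ (X ⊗ A) ⟶ M := K ◁ a ≫ F - sw K X A ≫ X ◁ F ≫ b

section
variable {K X A M : C}

lemma icomm_eq_iff {F : K ⊗ A ⟶ M} {a : X ⊗ A ⟶ A} {b : X ⊗ M ⟶ M} {e : K ⊗ (X ⊗ A) ⟶ M} :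
    icomm F a b = e ↔ K ◁ a ≫ F = sw K X A ≫ X ◁ F ≫ b + e := by
  rw [icomm, sub_eq_iff_eq_add, add_comm]

lemma icomm_add_left (F G : K ⊗ A ⟶ M) (a : X ⊗ A ⟶ A) (b : X ⊗ M ⟶ M) :
    icomm (F + G) a b = icomm F a b + icomm G a b := by
  simp only [icomm, Preadditive.comp_add, Preadditive.add_comp, MonoidalPreadditive.whiskerLeft_add]
  abel

lemma icomm_sub_left (F G : K ⊗ A ⟶ M) (a : X ⊗ A ⟶ A) (b : X ⊗ M ⟶ M) :
    icomm (F - G) a b = icomm F a b - icomm G a b := by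
  simp only [icomm, Preadditive.comp_sub, Preadditive.sub_comp, whiskerLeft_sub']
  abel

lemma icomm_add_right (F : K ⊗ A ⟶ M) (a a' : X ⊗ A ⟶ A) (b b' : X ⊗ M ⟶ M) :
    icomm F (a + a') (b + b') = icomm F a b + icomm F a' b' := by
  simp only [icomm, Preadditive.comp_add, Preadditive.add_comp, MonoidalPreadditive.whiskerLeft_add]
  abel

lemma icomm_sub_right (F : K ⊗ A ⟶ M) (a a' : X ⊗ A ⟶ A) (b b' : X ⊗ M ⟶ M) :
    icomm F (a - a') (b - b') = icomm F a b - icomm F a' b' := by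
  simp only [icomm, Preadditive.comp_sub, Preadditive.sub_comp, whiskerLeft_sub']
  abel

lemma icomm_swap {Y : C} (a : X ⊗ M ⟶ M) (b : Y ⊗ M ⟶ M) :
    icomm b a a = -(sw Y X M ≫ icomm a b b) := by
  simp only [icomm, Preadditive.comp_sub, sw_sw_assoc, neg_sub]

lemma icomm_whisker {K' X' : C} (f : K' ⟶ K) (g : X' ⟶ X) (F : K ⊗ A ⟶ M) (a : X ⊗ A ⟶ A)
    (b : X ⊗ M ⟶ M) : icomm (f ▷ A ≫ F) (g ▷ A ≫ a) (g ▷ M ≫ b) =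
      K' ◁ g ▷ A ≫ f ▷ (X ⊗ A) ≫ icomm F a b := by
  simp only [icomm, Preadditive.comp_sub, MonoidalCategory.whiskerLeft_comp, Category.assoc]
  rw [whisker_exchange_assoc, reassoc_of% @sw_naturality_left, reassoc_of% @sw_naturality_middle,
    ← whisker_exchange_assoc, ← whisker_exchange_assoc, ← whisker_exchange_assoc]

lemma icomm_comp {A' M' : C} (F : K ⊗ A ⟶ M) {a : X ⊗ A ⟶ A} {b : X ⊗ M ⟶ M}
    {a' : X ⊗ A' ⟶ A'} {b' : X ⊗ M' ⟶ M'} {f : A' ⟶ A} {g : M ⟶ M'}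
    (hf : a' ≫ f = X ◁ f ≫ a) (hg : b ≫ g = X ◁ g ≫ b') :
    icomm (K ◁ f ≫ F ≫ g) a' b' = K ◁ X ◁ f ≫ icomm F a b ≫ g := by
  simp only [icomm, Preadditive.comp_sub, Preadditive.sub_comp, MonoidalCategory.whiskerLeft_comp,
    Category.assoc, hg]
  rw [sw_naturality_assoc, ← MonoidalCategory.whiskerLeft_comp_assoc, hf,
    MonoidalCategory.whiskerLeft_comp_assoc]

lemma icomm_tensor {b : X ⊗ M ⟶ M} (F : K ⊗ A ⟶ M) (a : X ⊗ A ⟶ A) (Y : C) :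
    icomm (opw F Y) (opw a Y) (opw b Y) =
      K ◁ (α_ X A Y).inv ≫ opw (icomm F a b) Y := by
  simp [icomm, opw, sw, sub_whiskerRight']

end
end Operators
-- Curved modules and algebras given by generators and relations
section Curved
open MonObj
variable {C : Type u} [Category.{v} C] [Preadditive C] [MonoidalCategory C] [MonoidalPreadditive C]
  [SymmetricCategory C]

/-- `a` is an action of `X` on `M` with `x (y m) - y (x m) = [x, y] m + ω(x, y) m`. -/
def IsCurved {X M : C} (br : X ⊗ X ⟶ X) (ω : X ⊗ X ⟶ 𝟙_ C) (a : X ⊗ M ⟶ M) : Prop :=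
  icomm a a a = opw br M ≫ a + opi ω M

/-- Left multiplication by the image of `i`. -/
def lmul {X A : C} [MonObj A] (i : X ⟶ A) : X ⊗ A ⟶ A := i ▷ A ≫ μ[A]

/-- Commutator with the image of `i`. -/
def adop {X A : C} [MonObj A] (i : X ⟶ A) : X ⊗ A ⟶ A := i ▷ A ≫ commutator A

/-- The image of `i : X ⟶ A` generates the algebra `A`: a linear map out of the `A`-module `A ⊗ Y`
is determined by its restriction to `Y`. -/
def Generates {X : C} (A : C) [MonObj A] (i : X ⟶ A) : Prop :=
  ∀ (Y M : C) (b : X ⊗ M ⟶ M) (F : A ⊗ Y ⟶ M), opw (lmul i) Y ≫ F = X ◁ F ≫ b →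
    η[A] ▷ Y ≫ F = 0 → F = 0

/-- The algebra `A` is generated by `X` with the relations `x y - y x = [x, y] + ω(x, y)`. This is
expressed by saying that `A ⊗ Y` is the free curved module on `Y`. -/
structure FreeOn {X : C} (br : X ⊗ X ⟶ X) (ω : X ⊗ X ⟶ 𝟙_ C) (A : C) [MonObj A] (i : X ⟶ A) :
    Prop where
  curved : IsCurved br ω (lmul i)
  generates : Generates A i
  exists_ext : ∀ (Y M : C) (b : X ⊗ M ⟶ M), IsCurved br ω b → ∀ f : Y ⟶ M,
    ∃ F : A ⊗ Y ⟶ M, opw (lmul i) Y ≫ F = X ◁ F ≫ b ∧ η[A] ▷ Y ≫ F = (λ_ Y).hom ≫ f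

variable {X : C} {br : X ⊗ X ⟶ X} {ω : X ⊗ X ⟶ 𝟙_ C}

lemma IsCurved.of_iso {M M' : C} {a : X ⊗ M ⟶ M} {a' : X ⊗ M' ⟶ M'} (h : IsCurved br ω a)
    (f : M' ⟶ M) [IsIso f] (hf : a' ≫ f = X ◁ f ≫ a) : IsCurved br ω a' := by
  have hg : a ≫ inv f = X ◁ inv f ≫ a' := by
    rw [IsIso.comp_inv_eq, Category.assoc, hf, ← MonoidalCategory.whiskerLeft_comp_assoc]
    simp
  have e : a' = X ◁ f ≫ a ≫ inv f := by
    rw [hg, ← MonoidalCategory.whiskerLeft_comp_assoc]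
    simp
  have h1 := icomm_comp a hf hg
  rw [← e, h] at h1
  rw [IsCurved, h1, Preadditive.add_comp, Preadditive.comp_add, Category.assoc,
    reassoc_of% (opw_naturality br f), ← e, reassoc_of% (opi_naturality ω f), IsIso.hom_inv_id,
    Category.comp_id]

lemma IsCurved.opw {M : C} {a : X ⊗ M ⟶ M} (h : IsCurved br ω a) (Y : C) :
    IsCurved br ω (opw a Y) := by
  rw [IsCurved, icomm_tensor, h]
  simp [SuperCat.opw, opi]

lemma opw_braiding {A : C} (a : X ⊗ A ⟶ A) (K : C) :
    opw a K ≫ (β_ A K).hom = X ◁ (β_ A K).hom ≫ sw X K A ≫ K ◁ a := by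
  rw [← actL_eq_opw, ← actL_braiding, actR_eq_sw]

lemma IsCurved.sw {M : C} {a : X ⊗ M ⟶ M} (h : IsCurved br ω a) (K : C) :
    IsCurved br ω (sw X K M ≫ K ◁ a) := by
  refine (h.opw K).of_iso (β_ K M).hom ?_
  have := opw_braiding a K
  rw [← cancel_mono (β_ M K).hom, Category.assoc, Category.assoc, SymmetricCategory.symmetry,
    Category.assoc, this, ← MonoidalCategory.whiskerLeft_comp_assoc, SymmetricCategory.symmetry]
  simp

section Generates
variable {A : C} [MonObj A] {i : X ⟶ A}

lemma Generates.hom_ext (h : Generates A i) {Y M : C} (b : X ⊗ M ⟶ M) {F G : A ⊗ Y ⟶ M}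
    (hF : SuperCat.opw (lmul i) Y ≫ F = X ◁ F ≫ b) (hG : SuperCat.opw (lmul i) Y ≫ G = X ◁ G ≫ b)
    (h1 : η[A] ▷ Y ≫ F = η[A] ▷ Y ≫ G) : F = G := by
  rw [← sub_eq_zero]
  refine h Y M b _ ?_ ?_
  · rw [Preadditive.comp_sub, hF, hG, whiskerLeft_sub', Preadditive.sub_comp]
  · rw [Preadditive.comp_sub, h1, sub_self]

/-- In `Generates` the parameter stands to the right of A. For a parameter on the left one composes
with the braiding, and commuting with X becomes linearity. -/
lemma Generates.eq_zero (h : Generates A i) {K M : C} (b : X ⊗ M ⟶ M) {F : K ⊗ A ⟶ M}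
    (hF : icomm F (lmul i) b = 0) (h1 : K ◁ η[A] ≫ F = 0) : F = 0 := by
  have h2 : (β_ A K).hom ≫ F = 0 := by
    refine h K M b _ ?_ ?_
    · rw [← Category.assoc, opw_braiding, Category.assoc, Category.assoc, sub_eq_zero.1 hF]
      simp
    · rw [BraidedCategory.braiding_naturality_left_assoc, h1, comp_zero]
  rwa [← cancel_epi (β_ A K).hom, comp_zero]

lemma Generates.ext_left (h : Generates A i) {K M : C} (b : X ⊗ M ⟶ M) {F G : K ⊗ A ⟶ M}
    (hF : icomm F (lmul i) b = icomm G (lmul i) b) (h1 : K ◁ η[A] ≫ F = K ◁ η[A] ≫ G) :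
    F = G := by
  rw [← sub_eq_zero]
  refine h.eq_zero b ?_ ?_
  · rw [icomm_sub_left, hF, sub_self]
  · rw [Preadditive.comp_sub, h1, sub_self]

lemma Generates.ext (h : Generates A i) {M : C} (b : X ⊗ M ⟶ M) {F G : A ⟶ M}
    (hF : lmul i ≫ F = X ◁ F ≫ b) (hG : lmul i ≫ G = X ◁ G ≫ b) (h1 : η[A] ≫ F = η[A] ≫ G) :
    F = G := by
  have key : ∀ {F : A ⟶ M}, lmul i ≫ F = X ◁ F ≫ b →
      SuperCat.opw (lmul i) (𝟙_ C) ≫ (ρ_ A).hom ≫ F = X ◁ ((ρ_ A).hom ≫ F) ≫ b := by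
    intro F hF
    simp [SuperCat.opw, ← hF]
  have h2 := h.hom_ext (Y := 𝟙_ C) b (key hF) (key hG) (by simp [h1])
  simpa using h2

/-- This form serves for commutators of two derivations, which depend on two parameters. -/
lemma Generates.eq_zero₂ (h : Generates A i) {K K' M : C} (b : X ⊗ M ⟶ M) {F : K ⊗ (K' ⊗ A) ⟶ M}
    (hF : K ◁ K' ◁ lmul i ≫ F = K ◁ SuperCat.sw K' X A ≫ SuperCat.sw K X (K' ⊗ A) ≫ X ◁ F ≫ b)
    (h1 : K ◁ K' ◁ η[A] ≫ F = 0) : F = 0 := by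
  have h2 : (α_ K K' A).hom ≫ F = 0 := by
    refine h.eq_zero b ?_ ?_
    · rw [icomm, associator_naturality_right_assoc, hF]
      simp [SuperCat.sw, BraidedCategory.braiding_tensor_left_hom]
    · rw [associator_naturality_right_assoc, h1, comp_zero]
  rwa [← cancel_epi (α_ K K' A).hom, comp_zero]

end Generates

namespace FreeOn
variable {A : C} [MonObj A] {i : X ⟶ A}

lemma exists_ext' (h : FreeOn br ω A i) {M : C} (b : X ⊗ M ⟶ M) (hb : IsCurved br ω b)
    (m : 𝟙_ C ⟶ M) : ∃ F : A ⟶ M, lmul i ≫ F = X ◁ F ≫ b ∧ η[A] ≫ F = m := by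
  obtain ⟨F, h1, h2⟩ := h.exists_ext (𝟙_ C) M b hb m
  refine ⟨(ρ_ A).inv ≫ F, ?_, ?_⟩
  · have h3 : (ρ_ (X ⊗ A)).inv = X ◁ (ρ_ A).inv ≫ (α_ _ _ _).inv := by simp
    rw [MonoidalCategory.whiskerLeft_comp, Category.assoc, ← h1, opw,
      rightUnitor_inv_naturality_assoc, h3, Category.assoc, Category.assoc]
  · rw [rightUnitor_inv_naturality_assoc, h2]
    simp [unitors_equal]

/-- Existence of derivations with prescribed values on generators. -/
lemma exists_derivation [HasBinaryBiproducts C] (h : FreeOn br ω A i) {K M : C} (b : X ⊗ M ⟶ M)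
    (hb : IsCurved br ω b) (e : X ⊗ (K ⊗ A) ⟶ M)
    (he : X ◁ (SuperCat.sw X K A ≫ K ◁ lmul i) ≫ e + X ◁ e ≫ b -
      SuperCat.sw X X (K ⊗ A) ≫ (X ◁ (SuperCat.sw X K A ≫ K ◁ lmul i) ≫ e + X ◁ e ≫ b) =
        SuperCat.opw br (K ⊗ A) ≫ e) :
    ∃ δ : K ⊗ A ⟶ M, icomm δ (lmul i) b = SuperCat.sw K X A ≫ e ∧ K ◁ η[A] ≫ δ = 0 := by
  let c := SuperCat.sw X K A ≫ K ◁ lmul i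
  have hc : IsCurved br ω c := h.curved.sw K
  -- A derivation is a linear map into a triangular module. Let X act on pairs by x (u, m) = (x u, x
  -- m + e(x, u)); `he` is the condition that the off-diagonal part of the curvature is correct. The
  -- linear extension of k ↦ (k ⊗ 1, 0) has the derivation as its second component.
  let N := (K ⊗ A) ⊞ M
  let bN : X ⊗ N ⟶ N := biprod.lift (X ◁ biprod.fst ≫ c) (X ◁ biprod.snd ≫ b + X ◁ biprod.fst ≫ e)
  have b1 : bN ≫ biprod.fst = X ◁ biprod.fst ≫ c := biprod.lift_fst _ _
  have b2 : bN ≫ biprod.snd = X ◁ biprod.snd ≫ b + X ◁ biprod.fst ≫ e := biprod.lift_snd _ _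
  have h1 : X ◁ bN ≫ bN ≫ biprod.fst = X ◁ X ◁ biprod.fst ≫ X ◁ c ≫ c := by
    rw [b1, ← MonoidalCategory.whiskerLeft_comp_assoc, b1, MonoidalCategory.whiskerLeft_comp_assoc]
  have h2 : X ◁ bN ≫ bN ≫ biprod.snd = X ◁ X ◁ biprod.snd ≫ X ◁ b ≫ b +
      X ◁ X ◁ biprod.fst ≫ (X ◁ c ≫ e + X ◁ e ≫ b) := by
    rw [b2, Preadditive.comp_add, ← MonoidalCategory.whiskerLeft_comp_assoc, b2,
      ← MonoidalCategory.whiskerLeft_comp_assoc, b1]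
    simp only [MonoidalCategory.whiskerLeft_comp, MonoidalPreadditive.whiskerLeft_add,
      Preadditive.add_comp, Preadditive.comp_add, Category.assoc]
    abel
  have hN : IsCurved br ω bN := by
    have hb' : X ◁ b ≫ b - _ = _ := hb
    have hc' : X ◁ c ≫ c - _ = _ := hc
    apply biprod.hom_ext
    · rw [icomm, Preadditive.sub_comp, Preadditive.add_comp]
      simp only [Category.assoc]
      rw [h1, b1, ← reassoc_of% @sw_naturality, ← Preadditive.comp_sub, hc', Preadditive.comp_add,
        reassoc_of% @opw_naturality, opi_naturality]
    · rw [icomm, Preadditive.sub_comp, Preadditive.add_comp]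
      simp only [Category.assoc]
      have k1 := X ◁ X ◁ (biprod.snd : N ⟶ M) ≫= hb'
      have k2 := X ◁ X ◁ (biprod.fst : N ⟶ K ⊗ A) ≫= he
      rw [h2, b2, ← opi_naturality]
      simp only [Preadditive.comp_add, Preadditive.comp_sub] at k1 k2 ⊢
      rw [← sw_naturality_assoc X X biprod.snd, ← sw_naturality_assoc X X biprod.fst (X ◁ c ≫ e),
        ← sw_naturality_assoc X X biprod.fst, ← reassoc_of% (opw_naturality br (biprod.snd : N ⟶ M)),
        ← reassoc_of% (opw_naturality br (biprod.fst : N ⟶ K ⊗ A)), ← k2, add_right_comm, ← k1]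
      abel
  obtain ⟨F, hF, hF1⟩ := h.exists_ext K N bN hN (biprod.lift ((ρ_ K).inv ≫ K ◁ η[A]) 0)
  -- Linearity forces the first component to be the flip, so the inhomogeneous term e is evaluated
  -- at k ⊗ a itself.
  have hfst : F ≫ biprod.fst = (β_ A K).hom := by
    refine h.generates.hom_ext c ?_ (opw_braiding _ _) ?_
    · rw [reassoc_of% hF, b1, MonoidalCategory.whiskerLeft_comp, Category.assoc]
    · rw [reassoc_of% hF1, biprod.lift_fst]
      simp
  refine ⟨(β_ K A).hom ≫ F ≫ biprod.snd, ?_, ?_⟩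
  · have h3 := opw_braiding (lmul i) K
    have h4 : K ◁ lmul i ≫ (β_ K A).hom =
        SuperCat.sw K X A ≫ X ◁ (β_ K A).hom ≫ SuperCat.opw (lmul i) K := by
      rw [← cancel_mono (β_ A K).hom]
      simp only [Category.assoc, h3]
      rw [← MonoidalCategory.whiskerLeft_comp_assoc, SymmetricCategory.symmetry]
      simp
    have h5 : X ◁ (β_ K A).hom ≫ X ◁ F ≫ X ◁ biprod.fst = 𝟙 _ := by
      simp only [← MonoidalCategory.whiskerLeft_comp, hfst]
      simp
    rw [icomm, reassoc_of% h4, reassoc_of% hF, b2]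
    simp only [Preadditive.comp_add, MonoidalCategory.whiskerLeft_comp, Category.assoc]
    rw [reassoc_of% h5]
    abel
  · rw [BraidedCategory.braiding_naturality_right_assoc, reassoc_of% hF1, biprod.lift_snd]
    simp

end FreeOn
end Curved
-- Existence of algebras with given generators and relations
section Construction
open MonObj
variable {C : Type u} [Category.{v} C] [Preadditive C] [MonoidalCategory C] [MonoidalPreadditive C]
  [SymmetricCategory C]

section Coproducts
variable [HasColimitsOfShape (Discrete ℕ) C]
  [∀ X : C, PreservesColimitsOfShape (Discrete ℕ) (tensorLeft X)] (F : ℕ → C)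

lemma exists_whiskerLeft_sigmaDesc (X : C) {Z : C} (f : ∀ n, X ⊗ F n ⟶ Z) :
    ∃ g : X ⊗ (∐ F) ⟶ Z, ∀ n, X ◁ Sigma.ι F n ≫ g = f n := by
  let h := isColimitOfPreserves (tensorLeft X) (coproductIsCoproduct F)
  exact ⟨h.desc ⟨Z, Discrete.natTrans fun n => f n.as⟩, fun n => h.fac _ ⟨n⟩⟩

lemma whiskerLeft_sigma_hom_ext (X : C) {Z : C} {f g : X ⊗ (∐ F) ⟶ Z}
    (h : ∀ n, X ◁ Sigma.ι F n ≫ f = X ◁ Sigma.ι F n ≫ g) : f = g :=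
  (isColimitOfPreserves (tensorLeft X) (coproductIsCoproduct F)).hom_ext fun n => h n.as

lemma exists_whiskerRight_sigmaDesc (X : C) {Z : C} (f : ∀ n, F n ⊗ X ⟶ Z) :
    ∃ g : (∐ F) ⊗ X ⟶ Z, ∀ n, Sigma.ι F n ▷ X ≫ g = f n := by
  obtain ⟨g, hg⟩ := exists_whiskerLeft_sigmaDesc F X fun n => (β_ X (F n)).hom ≫ f n
  refine ⟨(β_ _ _).hom ≫ g, fun n => ?_⟩
  rw [BraidedCategory.braiding_naturality_left_assoc, hg, SymmetricCategory.symmetry_assoc]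

lemma whiskerRight_sigma_hom_ext (X : C) {Z : C} {f g : (∐ F) ⊗ X ⟶ Z}
    (h : ∀ n, Sigma.ι F n ▷ X ≫ f = Sigma.ι F n ▷ X ≫ g) : f = g := by
  rw [← cancel_epi (β_ X _).hom]
  refine whiskerLeft_sigma_hom_ext F X fun n => ?_
  rw [BraidedCategory.braiding_naturality_right_assoc, h,
    BraidedCategory.braiding_naturality_right_assoc]

/-- Tensor powers. -/
def tensorPow (X : C) : ℕ → C
  | 0 => 𝟙_ C
  | n + 1 => X ⊗ tensorPow X n

def tensorPowSucc (X : C) (n : ℕ) : X ⊗ tensorPow X n ≅ tensorPow X (n + 1) := Iso.refl _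

/-- The tensor algebra, as a free module. -/
lemma exists_tensorAlgebra (X : C) : ∃ (T : C) (o : 𝟙_ C ⟶ T) (a : X ⊗ T ⟶ T),
    (∀ (Y M : C) (b : X ⊗ M ⟶ M) (f : Y ⟶ M),
      ∃ F : T ⊗ Y ⟶ M, opw a Y ≫ F = X ◁ F ≫ b ∧ o ▷ Y ≫ F = (λ_ Y).hom ≫ f) ∧
    (∀ (Y M : C) (b : X ⊗ M ⟶ M) (F : T ⊗ Y ⟶ M), opw a Y ≫ F = X ◁ F ≫ b → o ▷ Y ≫ F = 0 →
      F = 0) := by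
  obtain ⟨a, ha⟩ := exists_whiskerLeft_sigmaDesc (tensorPow X) X
    fun n => (tensorPowSucc X n).hom ≫ Sigma.ι (tensorPow X) (n + 1)
  refine ⟨∐ tensorPow X, Sigma.ι (tensorPow X) 0, a, fun Y M b f => ?_, fun Y M b F hF h0 => ?_⟩
  · let G : ∀ n, tensorPow X n ⊗ Y ⟶ M := fun n => Nat.rec ((λ_ Y).hom ≫ f)
      (fun n g => (tensorPowSucc X n).inv ▷ Y ≫
        (α_ X (tensorPow X n) Y).hom ≫ X ◁ g ≫ b) n
    have hG : ∀ n, (tensorPowSucc X n).hom ▷ Y ≫ G (n + 1) =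
        (α_ X (tensorPow X n) Y).hom ≫ X ◁ G n ≫ b := fun n => by
      simp [G]
    obtain ⟨F, hF⟩ := exists_whiskerRight_sigmaDesc (tensorPow X) Y G
    refine ⟨F, ?_, hF 0⟩
    -- The coproduct sits in the middle factor; it is moved to the left, where maps can be compared
    -- on its summands.
    rw [← cancel_epi (α_ X _ Y).hom, opw, Category.assoc, Iso.hom_inv_id_assoc,
      ← cancel_epi ((β_ _ X).hom ▷ Y), ← cancel_epi (α_ _ X Y).inv]
    · refine whiskerRight_sigma_hom_ext _ _ fun n => ?_
      have h1 : Sigma.ι (tensorPow X) n ▷ (X ⊗ Y) ≫ (α_ _ X Y).inv ≫ (β_ _ X).hom ▷ Y =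
          (α_ _ X Y).inv ≫ (β_ _ X).hom ▷ Y ≫ (X ◁ Sigma.ι (tensorPow X) n) ▷ Y := by
        rw [associator_inv_naturality_left_assoc, ← comp_whiskerRight,
          BraidedCategory.braiding_naturality_left, comp_whiskerRight]
      rw [reassoc_of% h1, reassoc_of% h1, ← comp_whiskerRight_assoc (X ◁ _), ha, comp_whiskerRight_assoc _ (Sigma.ι _ _), hF,
        associator_naturality_middle_assoc, ← MonoidalCategory.whiskerLeft_comp_assoc, hF, hG]
  · refine whiskerRight_sigma_hom_ext _ _ fun n => ?_
    rw [comp_zero]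
    induction n with
    | zero => exact h0
    | succ n ih =>
      rw [← cancel_epi ((tensorPowSucc X n).hom ▷ Y), ← comp_whiskerRight_assoc, ← ha,
        comp_whiskerRight, Category.assoc, ← cancel_epi (α_ X _ Y).inv,
        ← associator_inv_naturality_middle_assoc]
      have hF' : (α_ _ _ _).inv ≫ a ▷ Y ≫ F = X ◁ F ≫ b := by simpa [opw] using hF
      rw [hF', ← MonoidalCategory.whiskerLeft_comp_assoc, ih]
      simp

end Coproducts

lemma icomm_hom {X M N : C} {a : X ⊗ M ⟶ M} {b : X ⊗ N ⟶ N} {f : M ⟶ N} (h : a ≫ f = X ◁ f ≫ b) :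
    X ◁ X ◁ f ≫ icomm b b b = icomm a a a ≫ f := by
  simp only [icomm, Preadditive.comp_sub, Preadditive.sub_comp, Category.assoc]
  rw [← MonoidalCategory.whiskerLeft_comp_assoc, ← h, MonoidalCategory.whiskerLeft_comp_assoc, ← h,
    sw_naturality_assoc, ← MonoidalCategory.whiskerLeft_comp_assoc X (X ◁ f), ← h,
    MonoidalCategory.whiskerLeft_comp_assoc, ← h]

section Quotient
variable {X : C} (br : X ⊗ X ⟶ X) (ω : X ⊗ X ⟶ 𝟙_ C)

/-- The failure of an action to be curved. -/
def curvature {M : C} (a : X ⊗ M ⟶ M) : X ⊗ (X ⊗ M) ⟶ M :=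
  icomm a a a - (opw br M ≫ a + opi ω M)

/-- Applied to a linear map from the tensor algebra to a curved module, this shows that the map
kills the relations. -/
lemma curvature_hom {M N : C} {a : X ⊗ M ⟶ M} {b : X ⊗ N ⟶ N} {f : M ⟶ N}
    (h : a ≫ f = X ◁ f ≫ b) : X ◁ X ◁ f ≫ curvature br ω b = curvature br ω a ≫ f := by
  rw [curvature, Preadditive.comp_sub, icomm_hom h, Preadditive.comp_add,
    reassoc_of% (opw_naturality br f), ← h, opi_naturality, curvature, Preadditive.sub_comp,
    Preadditive.add_comp, Category.assoc]

lemma curvature_opw {M : C} (a : X ⊗ M ⟶ M) (Y : C) :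
    curvature br ω (opw a Y) = X ◁ (α_ X M Y).inv ≫ opw (curvature br ω a) Y := by
  rw [curvature, icomm_tensor]
  simp [opw, opi, curvature, sub_whiskerRight']

lemma isCurved_iff {M : C} (a : X ⊗ M ⟶ M) : IsCurved br ω a ↔ curvature br ω a = 0 :=
  sub_eq_zero.symm

/-- The curvature of the free action takes the values (x y - y x - [x, y] - ω(x, y)) t with t
arbitrary in T. Its linear extension κ : T ⊗ R ⟶ T therefore has the two-sided ideal of relations as
its image. The cokernel inherits freeness because the tensor product is right exact. -/
lemma exists_free_quotient [HasCokernels C] [∀ X : C, PreservesFiniteColimits (tensorLeft X)]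
    {T : C} (o : 𝟙_ C ⟶ T) (a : X ⊗ T ⟶ T)
    (hT : ∀ (Y M : C) (b : X ⊗ M ⟶ M) (f : Y ⟶ M),
      ∃ F : T ⊗ Y ⟶ M, opw a Y ≫ F = X ◁ F ≫ b ∧ o ▷ Y ≫ F = (λ_ Y).hom ≫ f)
    (hT' : ∀ (Y M : C) (b : X ⊗ M ⟶ M) (F : T ⊗ Y ⟶ M), opw a Y ≫ F = X ◁ F ≫ b → o ▷ Y ≫ F = 0 →
      F = 0) :
    ∃ (U : C) (o : 𝟙_ C ⟶ U) (a : X ⊗ U ⟶ U), IsCurved br ω a ∧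
    (∀ (Y M : C) (b : X ⊗ M ⟶ M), IsCurved br ω b → ∀ f : Y ⟶ M,
      ∃ F : U ⊗ Y ⟶ M, opw a Y ≫ F = X ◁ F ≫ b ∧ o ▷ Y ≫ F = (λ_ Y).hom ≫ f) ∧
    (∀ (Y M : C) (b : X ⊗ M ⟶ M) (F : U ⊗ Y ⟶ M), opw a Y ≫ F = X ◁ F ≫ b → o ▷ Y ≫ F = 0 →
      F = 0) := by
  let R := X ⊗ (X ⊗ T)
  obtain ⟨κ, h1, h2⟩ := hT R T a (curvature br ω a)
  let p := cokernel.π κ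
  have hp : κ ≫ p = 0 := cokernel.condition κ
  obtain ⟨a', ha'⟩ := exists_whiskerLeft_desc κ X (a ≫ p) (by
    rw [← reassoc_of% h1, hp, comp_zero])
  have ha : X ◁ p ≫ a' = a ≫ p := ha'
  have hcurv : curvature br ω a ≫ p = 0 := by
    rw [← cancel_epi (λ_ R).hom, ← reassoc_of% h2, hp, comp_zero, comp_zero]
  refine ⟨cokernel κ, o ≫ p, a', ?_, fun Y M b hb f => ?_, fun Y M b F hF h0 => ?_⟩
  · rw [isCurved_iff, ← cancel_epi (X ◁ X ◁ p), curvature_hom br ω ha.symm, hcurv, comp_zero]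
  · obtain ⟨F, hF, hF1⟩ := hT Y M b f
    have hr : curvature br ω a ▷ Y ≫ F = 0 := by
      have h3 := curvature_hom br ω hF
      rw [(isCurved_iff br ω b).1 hb, comp_zero, curvature_opw, opw, Category.assoc,
        Category.assoc] at h3
      rw [← cancel_epi (α_ X (X ⊗ T) Y).inv, ← cancel_epi (X ◁ (α_ X T Y).inv), ← h3]
      simp
    -- The composite is a linear map out of T ⊗ (R ⊗ Y), so it suffices that it vanishes on R ⊗ Y.
    have hκ : κ ▷ Y ≫ F = 0 := by
      rw [← cancel_epi (α_ T R Y).inv, comp_zero]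
      refine hT' _ M b _ ?_ ?_
      · have h3 : opw a (R ⊗ Y) ≫ (α_ T R Y).inv = X ◁ (α_ T R Y).inv ≫ opw (opw a R) Y := by
          simp [opw]
        have h4 : opw (opw a R) Y ≫ κ ▷ Y = X ◁ κ ▷ Y ≫ opw a Y := by
          rw [← opw_comp, h1]
          simp [opw]
        rw [reassoc_of% h3, reassoc_of% h4, hF]
        simp
      · rw [associator_inv_naturality_left_assoc, ← comp_whiskerRight_assoc, h2, comp_whiskerRight,
          Category.assoc, hr]
        simp
    obtain ⟨G, hG'⟩ := exists_whiskerRight_desc κ Y F hκ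
    have hG : p ▷ Y ≫ G = F := hG'
    refine ⟨G, ?_, ?_⟩
    · rw [← cancel_epi (X ◁ p ▷ Y), opw, Category.assoc,
        associator_inv_naturality_middle_assoc, ← comp_whiskerRight_assoc, ha,
        comp_whiskerRight_assoc, hG, ← MonoidalCategory.whiskerLeft_comp_assoc, hG, ← hF, opw,
        Category.assoc]
    · rw [comp_whiskerRight_assoc, hG, hF1]
  · rw [← cancel_epi (p ▷ Y), comp_zero]
    refine hT' Y M b _ ?_ ?_
    · rw [MonoidalCategory.whiskerLeft_comp, Category.assoc, ← hF, opw, opw, Category.assoc,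
        Category.assoc, associator_inv_naturality_middle_assoc, ← comp_whiskerRight_assoc,
        ← comp_whiskerRight_assoc, ha]
    · rw [← h0, comp_whiskerRight_assoc]

/-- The multiplication of U is the linear extension of the identity of U. The axioms of an algebra
compare linear maps out of free modules with the same restriction to the generating object. The
generators are the elements x · 1. -/
lemma exists_freeOn_of_free {U : C} (o : 𝟙_ C ⟶ U) (a : X ⊗ U ⟶ U) (hU : IsCurved br ω a)
    (hT : ∀ (Y M : C) (b : X ⊗ M ⟶ M), IsCurved br ω b → ∀ f : Y ⟶ M,
      ∃ F : U ⊗ Y ⟶ M, opw a Y ≫ F = X ◁ F ≫ b ∧ o ▷ Y ≫ F = (λ_ Y).hom ≫ f)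
    (hT' : ∀ (Y M : C) (b : X ⊗ M ⟶ M) (F : U ⊗ Y ⟶ M), opw a Y ≫ F = X ◁ F ≫ b → o ▷ Y ≫ F = 0 →
      F = 0) : ∃ (A : Mon C) (i : X ⟶ A.X), FreeOn br ω A.X i := by
  obtain ⟨m, hm, hm1⟩ := hT U U a hU (𝟙 U)
  rw [Category.comp_id] at hm1
  have ext : ∀ {Y M : C} (b : X ⊗ M ⟶ M) {F G : U ⊗ Y ⟶ M}, opw a Y ≫ F = X ◁ F ≫ b →
      opw a Y ≫ G = X ◁ G ≫ b → o ▷ Y ≫ F = o ▷ Y ≫ G → F = G := by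
    intro Y M b F G hF hG h
    rw [← sub_eq_zero]
    refine hT' Y M b _ ?_ ?_
    · rw [Preadditive.comp_sub, hF, hG, whiskerLeft_sub', Preadditive.sub_comp]
    · rw [Preadditive.comp_sub, h, sub_self]
  let _ : MonObj U :=
      { one := o
        mul := m
        one_mul := hm1
        mul_one := by
          refine ext a ?_ ?_ ?_
          · rw [MonoidalCategory.whiskerLeft_comp, Category.assoc, ← hm,
              reassoc_of% (opw_naturality a o)]
          · simp [opw]
          · rw [← whisker_exchange_assoc, hm1]
            simp [unitors_equal]
        mul_assoc := by
          have h1 : opw (opw a U) U ≫ m ▷ U = X ◁ m ▷ U ≫ opw a U := by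
            rw [← opw_comp, hm]
            simp [opw]
          have h2 : ∀ Y Z : C, opw a (Y ⊗ Z) ≫ (α_ U Y Z).inv =
              X ◁ (α_ U Y Z).inv ≫ opw (opw a Y) Z := by
            intro Y Z
            simp [opw]
          rw [← cancel_epi (α_ U U U).inv, Iso.inv_hom_id_assoc]
          refine ext a ?_ ?_ ?_
          · rw [reassoc_of% (h2 U U), reassoc_of% h1, hm]
            simp
          · rw [MonoidalCategory.whiskerLeft_comp, Category.assoc, ← hm,
              reassoc_of% (opw_naturality a m)]
          · rw [associator_inv_naturality_left_assoc, ← comp_whiskerRight_assoc, hm1,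
              ← whisker_exchange_assoc, hm1]
            simp }
  have hl : lmul (A := U) ((ρ_ X).inv ≫ X ◁ o ≫ a) = a := by
    change ((ρ_ X).inv ≫ X ◁ o ≫ a) ▷ U ≫ m = a
    have h1 : a ▷ U ≫ m = (α_ X U U).hom ≫ X ◁ m ≫ a := by
      rw [← hm, opw, Category.assoc, Iso.hom_inv_id_assoc]
    rw [comp_whiskerRight, comp_whiskerRight, Category.assoc, Category.assoc, h1,
      associator_naturality_middle_assoc, ← MonoidalCategory.whiskerLeft_comp_assoc, hm1]
    simp
  refine ⟨⟨U⟩, (ρ_ X).inv ≫ X ◁ o ≫ a, ?_, ?_, ?_⟩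
  · exact hl.symm ▸ hU
  · intro Y M b F h1 h2
    rw [hl] at h1
    exact hT' Y M b F h1 h2
  · rw [hl]
    exact hT

theorem exists_freeOn [HasColimitsOfShape (Discrete ℕ) C]
    [∀ X : C, PreservesColimitsOfShape (Discrete ℕ) (tensorLeft X)]
    [HasCokernels C] [∀ X : C, PreservesFiniteColimits (tensorLeft X)] :
    ∃ (A : Mon C) (i : X ⟶ A.X), FreeOn br ω A.X i := by
  obtain ⟨T, o, a, h1, h2⟩ := exists_tensorAlgebra X
  obtain ⟨U, o', a', h3, h4, h5⟩ := exists_free_quotient br ω o a h1 h2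
  exact exists_freeOn_of_free br ω o' a' h3 h4 h5

end Quotient
end Construction
-- Left multiplications, inner derivations and algebra morphisms
section Algebras
open MonObj
variable {C : Type u} [Category.{v} C] [Preadditive C] [MonoidalCategory C] [MonoidalPreadditive C]
  [SymmetricCategory C]

section
variable {X Y A : C} [MonObj A] (f : X ⟶ A) (g : Y ⟶ A)

lemma whiskerLeft_one_lmul : X ◁ η[A] ≫ lmul f = (ρ_ X).hom ≫ f := by
  rw [lmul, whisker_exchange_assoc, MonObj.mul_one, rightUnitor_naturality]

lemma whiskerLeft_one_adop : X ◁ η[A] ≫ adop f = 0 := by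
  rw [adop, whisker_exchange_assoc, one_commutator, comp_zero]

lemma lmul_lmul : X ◁ lmul g ≫ lmul f = opw ((f ⊗ₘ g) ≫ μ[A]) A ≫ μ[A] := by
  simp only [opw, lmul, comp_whiskerRight, MonoidalCategory.whiskerLeft_comp, Category.assoc,
    MonObj.mul_assoc, MonoidalCategory.tensorHom_def']
  rw [whisker_exchange_assoc]
  simp

lemma icomm_lmul : icomm (lmul f) (lmul g) (lmul g) =
    opw ((f ⊗ₘ g) ≫ commutator A) A ≫ μ[A] := by
  rw [icomm, lmul_lmul, lmul_lmul, commutator, reassoc_of% @sw_opw, ← Preadditive.sub_comp,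
    Preadditive.comp_sub, BraidedCategory.braiding_naturality_assoc]
  simp [opw, sub_whiskerRight']

/-- By the Leibniz rule for commutators, both sides are multiplication by [x, y]. -/
lemma icomm_adop_lmul : icomm (adop f) (lmul g) (lmul g) = icomm (lmul f) (lmul g) (lmul g) := by
  have h := X ◁ g ▷ A ≫= f ▷ (A ⊗ A) ≫= whiskerLeft_mul_commutator A
  rw [Preadditive.comp_add, Preadditive.comp_add] at h
  rw [icomm_lmul, icomm_eq_iff, opw_whisker]
  have h2 : X ◁ lmul g ≫ adop f = X ◁ g ▷ A ≫ f ▷ (A ⊗ A) ≫ A ◁ μ[A] ≫ commutator A := by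
    rw [lmul, adop, MonoidalCategory.whiskerLeft_comp, Category.assoc, whisker_exchange_assoc]
  have h3 : X ◁ g ▷ A ≫ f ▷ (A ⊗ A) ≫ swapFst A ≫ A ◁ commutator A ≫ μ[A] =
      sw X Y A ≫ Y ◁ adop f ≫ lmul g := by
    have : swapFst A = sw A A A := rfl
    rw [this, reassoc_of% @sw_naturality_left, reassoc_of% @sw_naturality_middle, lmul, adop,
      MonoidalCategory.whiskerLeft_comp, Category.assoc, ← whisker_exchange_assoc,
      ← whisker_exchange_assoc]
  rw [h2, h, h3, add_comm]
  simp [opw]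

lemma icomm_adop_adop : icomm (adop f) (adop g) (adop g) =
    opw ((f ⊗ₘ g) ≫ commutator A) A ≫ commutator A := by
  have h1 : commutator A ▷ A ≫ commutator A = (α_ A A A).hom ≫ A ◁ commutator A ≫ commutator A -
    (β_ A A).hom ▷ A ≫ (α_ A A A).hom ≫ A ◁ commutator A ≫ commutator A :=
    (LieObj.ofMon A).adjoint.bracket_act
  have h2 : icomm (commutator A) (commutator A) (commutator A) =
      opw (commutator A) A ≫ commutator A := by
    rw [opw, Category.assoc, h1, icomm]
    simp [sw]
  rw [opw_whisker, Category.assoc, Category.assoc, ← h2, ← icomm_whisker]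
  rfl

lemma unit_whiskerRight_commutator : η[A] ▷ A ≫ commutator A = 0 := by
  have h := (LieObj.ofMon A).skew
  change (β_ A A).hom ≫ commutator A = -commutator A at h
  rw [← neg_eq_iff_eq_neg.2 h, Preadditive.comp_neg, BraidedCategory.braiding_naturality_left_assoc,
    one_commutator, comp_zero, neg_zero]

variable {B : C} [MonObj B] (φ : A ⟶ B) [IsMonHom φ]

lemma lmul_hom : lmul f ≫ φ = X ◁ φ ≫ lmul (f ≫ φ) := by
  rw [lmul, Category.assoc, IsMonHom.mul_hom, lmul, MonoidalCategory.tensorHom_def,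
    comp_whiskerRight, Category.assoc, Category.assoc, whisker_exchange_assoc,
    whisker_exchange_assoc]

lemma commutator_hom : commutator A ≫ φ = (φ ⊗ₘ φ) ≫ commutator B := by
  rw [commutator, Preadditive.sub_comp, Category.assoc, IsMonHom.mul_hom, commutator,
    Preadditive.comp_sub, BraidedCategory.braiding_naturality_assoc]

lemma adop_hom : adop f ≫ φ = X ◁ φ ≫ adop (f ≫ φ) := by
  rw [adop, Category.assoc, commutator_hom, adop, MonoidalCategory.tensorHom_def,
    comp_whiskerRight, Category.assoc, Category.assoc, whisker_exchange_assoc,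
    whisker_exchange_assoc]

lemma lmul_cop {Z : C} (q : Z ⟶ X ⊗ Y) :
    lmul (q ≫ (f ⊗ₘ g) ≫ μ[A]) = cop q A ≫ X ◁ lmul g ≫ lmul f := by
  rw [lmul_lmul, cop, lmul, opw]
  simp

/-- An element is recovered from its left multiplication by evaluation at the unit, so relations
between the operators are relations in A. -/
lemma isCurved_lmul_iff {br : X ⊗ X ⟶ X} {ω : X ⊗ X ⟶ 𝟙_ C} :
    IsCurved br ω (lmul f) ↔ (f ⊗ₘ f) ≫ commutator A = br ≫ f + ω ≫ η[A] := by
  have h1 : opw br A ≫ lmul f + opi ω A = opw (br ≫ f + ω ≫ η[A]) A ≫ μ[A] := by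
    simp [opw_add, opw_comp, lmul, opi]
  rw [IsCurved, icomm_lmul, h1]
  constructor
  · intro h
    have h2 : ∀ k : X ⊗ X ⟶ A, X ◁ X ◁ η[A] ≫ opw k A ≫ μ[A] = X ◁ (ρ_ X).hom ≫ k := by
      intro k
      rw [reassoc_of% (opw_naturality k), MonObj.mul_one, opw, Category.assoc,
        rightUnitor_naturality]
      simp
    have h3 := X ◁ X ◁ η[A] ≫= h
    rwa [h2, h2, cancel_epi] at h3
  · intro h
    rw [h]

end

namespace FreeOn
variable {X A : C} [MonObj A] {i : X ⟶ A} {br : X ⊗ X ⟶ X} {ω : X ⊗ X ⟶ 𝟙_ C}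

lemma generator_eq (i : X ⟶ A) : i = (ρ_ X).inv ≫ X ◁ η[A] ≫ lmul i := by
  rw [whiskerLeft_one_lmul, Iso.inv_hom_id_assoc]

/-- The maps g(a a') and g(a) g(a') are both linear in a, for the action on B through f, and they
agree at a = 1. -/
lemma isMonHom_of_linear (h : Generates A i) {B : C} [MonObj B] (f : X ⟶ B) {g : A ⟶ B}
    (h1 : lmul i ≫ g = X ◁ g ≫ lmul f) (h2 : η[A] ≫ g = η[B]) : IsMonHom g where
  one_hom := h2
  mul_hom := by
    have hl : ∀ {A : C} [MonObj A] (i : X ⟶ A), opw (lmul i) A ≫ μ[A] = X ◁ μ[A] ≫ lmul i := by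
      intro A _ i
      simp only [opw, lmul, comp_whiskerRight, Category.assoc, MonObj.mul_assoc]
      rw [whisker_exchange_assoc]
      simp
    refine h.hom_ext (lmul f) ?_ ?_ ?_
    · rw [reassoc_of% hl, h1, MonoidalCategory.whiskerLeft_comp, Category.assoc]
    · rw [MonoidalCategory.tensorHom_def, Category.assoc, ← Category.assoc, ← opw_comp, h1,
        opw_comp, MonoidalCategory.whiskerLeft_comp]
      have : opw (X ◁ g) A = X ◁ g ▷ A ≫ (α_ _ _ _).inv := by simp [opw]
      have h3 : X ◁ (B ◁ g ≫ μ[B]) ≫ lmul f = opw (lmul f) A ≫ B ◁ g ≫ μ[B] := by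
        rw [MonoidalCategory.whiskerLeft_comp, Category.assoc, ← hl,
          reassoc_of% (opw_naturality (lmul f))]
      simp only [Category.assoc]
      rw [h3, this]
      simp [opw]
    · rw [MonObj.one_mul_assoc, MonoidalCategory.tensorHom_def, Category.assoc,
        ← comp_whiskerRight_assoc, h2, ← whisker_exchange_assoc, MonObj.one_mul,
        leftUnitor_naturality]

lemma comp_hom_eq {B : C} [MonObj B] {f : X ⟶ B} {g : A ⟶ B}
    (h1 : lmul i ≫ g = X ◁ g ≫ lmul f) (h2 : η[A] ≫ g = η[B]) : i ≫ g = f := by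
  rw [generator_eq i, Category.assoc, Category.assoc, h1, ← MonoidalCategory.whiskerLeft_comp_assoc,
    h2, ← generator_eq]

/-- Left multiplication by f makes B a curved module, and the linear map with 1 ↦ 1 is
multiplicative. Conversely a morphism of algebras extending f is linear, which gives uniqueness. -/
theorem existsUnique_hom (h : FreeOn br ω A i) (B : Mon C) (f : X ⟶ B.X)
    (hf : (f ⊗ₘ f) ≫ commutator B.X = br ≫ f + ω ≫ η[B.X]) :
    ∃! g : (⟨A⟩ : Mon C) ⟶ B, i ≫ g.hom = f := by
  obtain ⟨g, h1, h2⟩ := h.exists_ext' (lmul f) ((isCurved_lmul_iff f).2 hf) η[B.X]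
  have := isMonHom_of_linear h.generates f h1 h2
  refine ⟨⟨g⟩, comp_hom_eq h1 h2, fun g' hg' => ?_⟩
  ext
  refine h.generates.ext (lmul f) ?_ h1 ?_
  · have h3 := lmul_hom i g'.hom
    rwa [hg'] at h3
  · rw [h2]
    exact IsMonHom.one_hom g'.hom

theorem isEnvelopingAlgebra {L : LieObj C} {A : Mon C} {i : L.X ⟶ A.X}
    (h : FreeOn L.bracket 0 A.X i) : IsEnvelopingAlgebra L A i where
  isLieHom := by
    have := (isCurved_lmul_iff i).1 h.curved
    rw [zero_comp, add_zero] at this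
    exact this.symm
  existsUnique B f hf := h.existsUnique_hom B f (by
    rw [zero_comp, add_zero]
    exact hf.symm)

end FreeOn
end Algebras
-- Symplectic modules and the spin representation
section Symplectic
open MonObj
variable {C : Type u} [Category.{v} C] [Preadditive C] [MonoidalCategory C] [MonoidalPreadditive C]
  [SymmetricCategory C]

section Scalars
variable [Linear ℚ C]

@[simp]
lemma whiskerLeft_smul' (X : C) {Y Z : C} (r : ℚ) (f : Y ⟶ Z) : X ◁ (r • f) = r • (X ◁ f) :=
  map_rat_smul (tensorLeft X).mapAddHom r f

@[simp]
lemma smul_whiskerRight' (X : C) {Y Z : C} (r : ℚ) (f : Y ⟶ Z) : (r • f) ▷ X = r • (f ▷ X) :=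
  map_rat_smul (tensorRight X).mapAddHom r f

lemma icomm_smul_left {K X A M : C} (r : ℚ) (F : K ⊗ A ⟶ M) (a : X ⊗ A ⟶ A) (b : X ⊗ M ⟶ M) :
    icomm (r • F) a b = r • icomm F a b := by
  simp [icomm, smul_sub]

lemma icomm_smul_right {K X A M : C} (r : ℚ) (F : K ⊗ A ⟶ M) (a : X ⊗ A ⟶ A) (b : X ⊗ M ⟶ M) :
    icomm F (r • a) (r • b) = r • icomm F a b := by
  simp [icomm, smul_sub]

end Scalars

/-- A skew-symmetric invariant form `ω` on a module, with the inverse copairing `c`. -/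
structure SymplecticForm {L : LieObj C} (V : LieMod L) where
  form : V ⊗ V ⟶ 𝟙_ (LieMod L)
  coform : 𝟙_ (LieMod L) ⟶ V ⊗ V
  skew : (β_ V V).hom ≫ form = -form
  left_inv : coform ▷ V ≫ (α_ V V V).hom ≫ V ◁ form = (λ_ V).hom ≫ (ρ_ V).inv
  right_inv : V ◁ coform ≫ (α_ V V V).inv ≫ form ▷ V = (ρ_ V).hom ≫ (λ_ V).inv

namespace SymplecticForm
variable {L : LieObj C} {V : LieMod L} (S : SymplecticForm V)

def om : V.X ⊗ V.X ⟶ 𝟙_ C := S.form.hom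

def co : 𝟙_ C ⟶ V.X ⊗ V.X := S.coform.hom

lemma sw_om (M : C) : sw V.X V.X M ≫ opi S.om M = -opi S.om M := by
  rw [sw_opi, ← opi_neg]
  exact congrArg (fun t => opi t M) (congrArg LieMod.Hom.hom S.skew)

lemma coi_om (M : C) : coi S.co (V.X ⊗ M) ≫ V.X ◁ opi S.om M = 𝟙 _ := by
  have h : S.co ▷ V.X ≫ (α_ V.X V.X V.X).hom ≫ V.X ◁ S.om = (λ_ V.X).hom ≫ (ρ_ V.X).inv :=
    congrArg LieMod.Hom.hom S.left_inv
  have h1 := congrArg (fun t => (λ_ V.X).inv ▷ M ≫ t ▷ M ≫ (ρ_ V.X).hom ▷ M) h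
  simpa [coi, cop, opi, opw] using h1

lemma whiskerLeft_coi_om (M : C) : V.X ◁ coi S.co M ≫ opi S.om (V.X ⊗ M) = 𝟙 _ := by
  have h : V.X ◁ S.co ≫ (α_ V.X V.X V.X).inv ≫ S.om ▷ V.X = (ρ_ V.X).hom ≫ (λ_ V.X).inv :=
    congrArg LieMod.Hom.hom S.right_inv
  have h1 := congrArg (fun t => (ρ_ V.X).inv ▷ M ≫ t ▷ M ≫ (λ_ V.X).hom ▷ M) h
  simpa [coi, cop, opi, opw] using h1

lemma opw_act_om (M : C) : opw V.act (V.X ⊗ M) ≫ opi S.om M =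
    -(sw L.X V.X (V.X ⊗ M) ≫ V.X ◁ opw V.act M ≫ opi S.om M) := by
  have h : L.X ◁ S.om ≫ 0 = (actL V.act V.X + actR V.X V.act) ≫ S.om := S.form.comm
  rw [comp_zero, Preadditive.add_comp, eq_comm, actR_eq_sw] at h
  have h1 := (L.X ◁ (α_ V.X V.X M).inv ≫ (α_ _ _ _).inv) ≫=
    congrArg (fun t => t ▷ M ≫ (λ_ M).hom) (eq_neg_of_add_eq_zero_left h)
  simpa [opi, opw, actL, sw, neg_whiskerRight'] using h1

/-- Invariance gives ω(x u, v) = -ω(u, x v), and skew-symmetry turns this into ω(x v, u): the form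
ω(x ·, ·) is symmetric, as for any element of the symplectic Lie algebra. -/
lemma opw_act_om_symm (M : C) : opw V.act (V.X ⊗ M) ≫ opi S.om M =
    L.X ◁ sw V.X V.X M ≫ opw V.act (V.X ⊗ M) ≫ opi S.om M := by
  conv_lhs => rw [opw_act_om, ← Preadditive.comp_neg, ← Preadditive.comp_neg, ← sw_om,
    reassoc_of% @whiskerLeft_opw_sw, sw_sw_assoc]

lemma whiskerLeft_coi_act (M : C) : L.X ◁ coi S.co M ≫ (opw V.act (V.X ⊗ M) +
    sw L.X V.X (V.X ⊗ M) ≫ V.X ◁ opw V.act M) = 0 := by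
  have h : L.X ◁ S.co ≫ (actL V.act V.X + actR V.X V.act) = 0 ≫ S.co := S.coform.comm
  rw [zero_comp, actR_eq_sw] at h
  have h1 := (L.X ◁ (λ_ M).inv ≫ (α_ _ _ _).inv) ≫= congrArg (fun t => t ▷ M ≫ (α_ _ _ _).hom) h
  simpa [coi, cop, opw, actL, sw] using h1

/-- `x ↦ ∑ (x eᵢ) ⊗ eⁱ` -/
def quad : L.X ⟶ V.X ⊗ V.X := (ρ_ L.X).inv ≫ L.X ◁ S.co ≫ opw V.act V.X

lemma cop_quad (M : C) : cop S.quad M = L.X ◁ coi S.co M ≫ opw V.act (V.X ⊗ M) := by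
  simp [cop, quad, coi, opw]

lemma cop_quad_om (M : C) : cop S.quad (V.X ⊗ M) ≫ V.X ◁ opi S.om M = opw V.act M := by
  rw [cop_quad, Category.assoc, ← opw_naturality, ← MonoidalCategory.whiskerLeft_comp_assoc,
    coi_om, MonoidalCategory.whiskerLeft_id, Category.id_comp]

/-- Since ω(x eᵢ, v) = ω(x v, eᵢ), the sum ∑ ω(x eᵢ, v) eⁱ equals x v. By `cop_quad_om` the other
contraction of quad(x) with v is x v as well; the two equal contributions explain the factor ½ in
`spin`. -/
lemma cop_quad_sw_om (M : C) : cop S.quad (V.X ⊗ M) ≫ V.X ◁ sw V.X V.X M ≫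
    opi S.om (V.X ⊗ M) = opw V.act M := by
  have h : coi S.co (V.X ⊗ M) ≫ V.X ◁ sw V.X V.X M ≫ sw V.X V.X (V.X ⊗ M) = V.X ◁ coi S.co M := by
    rw [← sw_coi]
    simp
  rw [cop_quad, Category.assoc, ← reassoc_of% (opw_naturality V.act (sw V.X V.X M)),
    opw_act_om_symm, ← MonoidalCategory.whiskerLeft_comp_assoc,
    ← MonoidalCategory.whiskerLeft_comp_assoc, Category.assoc, h,
    reassoc_of% (opw_naturality V.act (coi S.co M)), whiskerLeft_coi_om, Category.comp_id]

lemma isCurved_act (V : LieMod L) : IsCurved L.bracket 0 V.act := by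
  rw [IsCurved, opi_zero, add_zero, opw, Category.assoc, V.bracket_act, icomm]
  simp [sw]

/-- The copairing is invariant and V is a module, so `quad` intertwines the adjoint action with the
action on V ⊗ V. -/
lemma cop_quad_act (M : C) : L.X ◁ cop S.quad M ≫ (opw V.act (V.X ⊗ M) +
    sw L.X V.X (V.X ⊗ M) ≫ V.X ◁ opw V.act M) = opw L.bracket M ≫ cop S.quad M := by
  have h1 := icomm_eq_iff.1 ((isCurved_act V).opw (V.X ⊗ M))
  have h2 := L.X ◁ L.X ◁ coi S.co M ≫= h1
  have h3 : L.X ◁ opw V.act (V.X ⊗ M) ≫ sw L.X V.X (V.X ⊗ M) ≫ V.X ◁ opw V.act M =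
      sw L.X L.X (V.X ⊗ (V.X ⊗ M)) ≫ L.X ◁ (sw L.X V.X (V.X ⊗ M) ≫ V.X ◁ opw V.act M) ≫
        opw V.act (V.X ⊗ M) := by
    rw [reassoc_of% @whiskerLeft_opw_sw, ← opw_naturality, MonoidalCategory.whiskerLeft_comp,
      Category.assoc]
  have h4 := congrArg (fun t => sw L.X L.X M ≫ L.X ◁ t ≫ opw V.act (V.X ⊗ M))
    (S.whiskerLeft_coi_act M)
  simp only [MonoidalPreadditive.whiskerLeft_zero, zero_comp, comp_zero,
    MonoidalPreadditive.whiskerLeft_add, Preadditive.add_comp, Preadditive.comp_add,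
    MonoidalCategory.whiskerLeft_comp, Category.assoc] at h4
  simp only [← sw_naturality_assoc] at h4
  rw [cop_quad]
  simp only [MonoidalCategory.whiskerLeft_comp, Category.assoc, Preadditive.comp_add] at h2 h3 ⊢
  rw [h2, h3, opi_zero, ← reassoc_of% (opw_naturality L.bracket (coi S.co M)), comp_zero, add_zero,
    add_right_comm, h4, zero_add]

section Spin
variable {M : C} {v : V.X ⊗ M ⟶ M}

/-- The quadratic elements of the Clifford (or Weyl) algebra which represent `L`. -/
def spin [Linear ℚ C] (v : V.X ⊗ M ⟶ M) : L.X ⊗ M ⟶ M :=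
  (2⁻¹ : ℚ) • (cop S.quad M ≫ V.X ◁ v ≫ v)

variable [Linear ℚ C]

/-- Moving v past the two factors of (x eᵢ) eⁱ leaves two contractions, each equal to x v. -/
lemma icomm_spin (hv : IsCurved 0 S.om v) : icomm (S.spin v) v v = opw V.act M ≫ v := by
  have h1 : V.X ◁ v ≫ v = sw V.X V.X M ≫ V.X ◁ v ≫ v + opi S.om M := by
    have := icomm_eq_iff.1 hv
    rwa [opw_zero, zero_comp, zero_add] at this
  have h2 := V.X ◁ V.X ◁ v ≫= h1
  have h3 := congrArg (fun t => V.X ◁ t ≫ v) h1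
  simp only [MonoidalPreadditive.whiskerLeft_add, Preadditive.add_comp, Preadditive.comp_add,
    MonoidalCategory.whiskerLeft_comp, Category.assoc, sw_naturality_assoc, opi_naturality] at h2 h3
  have h4 : icomm (cop S.quad M ≫ V.X ◁ v ≫ v) v v = opw V.act M ≫ v + opw V.act M ≫ v := by
    rw [icomm, reassoc_of% (cop_naturality S.quad v), h3, h2]
    simp only [MonoidalCategory.whiskerLeft_comp, Category.assoc, Preadditive.comp_add]
    rw [reassoc_of% (cop_quad_sw_om S M), reassoc_of% (cop_quad_om S M),
      reassoc_of% (cop_sw_sw S.quad V.X M)]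
    abel
  rw [spin, icomm_smul_left, h4, ← two_smul ℚ, smul_smul]
  norm_num

/-- Only the commutators of x with V enter. By the Leibniz rule they act on both factors of quad(y),
which gives quad([x, y]). For x = spin this says that `spin` represents L. -/
lemma icomm_act_spin {x : L.X ⊗ M ⟶ M} (hx : icomm x v v = opw V.act M ≫ v) :
    icomm x (S.spin v) (S.spin v) = opw L.bracket M ≫ S.spin v := by
  have h1 := icomm_eq_iff.1 hx
  have h2 := L.X ◁ V.X ◁ v ≫= h1
  have h3 := congrArg (fun t => sw L.X V.X (V.X ⊗ M) ≫ V.X ◁ t ≫ v) h1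
  simp only [MonoidalPreadditive.whiskerLeft_add, Preadditive.add_comp, Preadditive.comp_add,
    MonoidalCategory.whiskerLeft_comp, Category.assoc, sw_naturality_assoc] at h2 h3
  rw [spin, icomm_smul_right, Linear.comp_smul, icomm]
  congr 1
  simp only [MonoidalCategory.whiskerLeft_comp, Category.assoc]
  rw [h2, h3, reassoc_of% (opw_naturality V.act v)]
  have h4 := S.cop_quad_act M =≫ (V.X ◁ v ≫ v)
  simp only [Preadditive.add_comp, Preadditive.comp_add, Category.assoc] at h4 ⊢
  rw [← h4, reassoc_of% (sw_whiskerLeft_cop L.X S.quad M), ← reassoc_of% (cop_naturality S.quad x)]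
  abel

lemma spin_hom {N : C} {w : V.X ⊗ N ⟶ N} {f : M ⟶ N} (h : v ≫ f = V.X ◁ f ≫ w) :
    S.spin v ≫ f = L.X ◁ f ≫ S.spin w := by
  simp only [spin, Linear.smul_comp, Linear.comp_smul, Category.assoc]
  rw [h, reassoc_of% (cop_naturality S.quad f), ← MonoidalCategory.whiskerLeft_comp_assoc, h,
    MonoidalCategory.whiskerLeft_comp_assoc]

/-- If `x` acts on `V` as `L` does, then `x - spin` commutes with `V`. -/
lemma icomm_sub_spin (hv : IsCurved 0 S.om v) {x : L.X ⊗ M ⟶ M}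
    (hx : icomm x v v = opw V.act M ≫ v) : icomm (x - S.spin v) v v = 0 := by
  rw [icomm_sub_left, hx, S.icomm_spin hv, sub_self]

lemma icomm_spin_of_comm {x : L.X ⊗ M ⟶ M} (hx : icomm x v v = 0) :
    icomm x (S.spin v) (S.spin v) = 0 := by
  have h1 := sub_eq_zero.1 hx
  rw [spin, icomm_smul_right, icomm]
  simp only [MonoidalCategory.whiskerLeft_comp, Category.assoc]
  rw [h1, sw_naturality_assoc, ← MonoidalCategory.whiskerLeft_comp_assoc V.X (L.X ◁ v), h1,
    reassoc_of% (cop_naturality S.quad x)]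
  simp only [MonoidalCategory.whiskerLeft_comp, Category.assoc]
  rw [reassoc_of% (sw_whiskerLeft_cop L.X S.quad M), sub_self, smul_zero]

/-- The operators x - spin(x) commute with V, hence with `spin`, which is quadratic in V. So the
commutator of x - spin(x) and y - spin(y) is that of x and y - spin(y), namely [x, y] - spin([x,
y]). -/
lemma isCurved_sub_spin (hv : IsCurved 0 S.om v) {x : L.X ⊗ M ⟶ M}
    (hx : icomm x v v = opw V.act M ≫ v) (hx' : IsCurved L.bracket 0 x) :
    IsCurved L.bracket 0 (x - S.spin v) := by
  have h1 : icomm (S.spin v) (x - S.spin v) (x - S.spin v) = 0 := by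
    rw [icomm_swap, S.icomm_spin_of_comm (S.icomm_sub_spin hv hx), comp_zero, neg_zero]
  rw [IsCurved, opi_zero, add_zero] at hx' ⊢
  rw [icomm_sub_left, h1, sub_zero, icomm_sub_right, hx', S.icomm_act_spin hx,
    Preadditive.comp_sub]

lemma icomm_add_spin (hv : IsCurved 0 S.om v) {x : L.X ⊗ M ⟶ M} (hx : icomm x v v = 0) :
    icomm (x + S.spin v) v v = opw V.act M ≫ v := by
  rw [icomm_add_left, hx, S.icomm_spin hv, zero_add]

/-- This is the converse construction: commuting actions of V and of L are combined into an action
of the Weil algebra. -/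
lemma isCurved_add_spin (hv : IsCurved 0 S.om v) {x : L.X ⊗ M ⟶ M} (hx : icomm x v v = 0)
    (hx' : IsCurved L.bracket 0 x) : IsCurved L.bracket 0 (x + S.spin v) := by
  have h1 : icomm (S.spin v) x x = 0 := by
    rw [icomm_swap, S.icomm_spin_of_comm hx, comp_zero, neg_zero]
  rw [IsCurved, opi_zero, add_zero] at hx' ⊢
  rw [icomm_add_right, S.icomm_act_spin (S.icomm_add_spin hv hx), icomm_add_left, hx', h1,
    add_zero, Preadditive.comp_add]

end Spin

end SymplecticForm
end Symplectic
-- Derivations, contractions and the Euler operator on symmetric algebras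
section Derivations
open MonObj
variable {C : Type u} [Category.{v} C] [Preadditive C] [MonoidalCategory C] [MonoidalPreadditive C]
  [SymmetricCategory C]

/-- The commutator of two derivations. -/
lemma whiskerLeft_icomm_of_derivations {K K' X A : C} {D : K ⊗ A ⟶ A} {D' : K' ⊗ A ⟶ A}
    {l : X ⊗ A ⟶ A} {E : K ⊗ (X ⊗ A) ⟶ A} {E' : K' ⊗ (X ⊗ A) ⟶ A} (h : icomm D l l = E)
    (h' : icomm D' l l = E') : K ◁ K' ◁ l ≫ icomm D D' D' =
      K ◁ sw K' X A ≫ sw K X (K' ⊗ A) ≫ X ◁ icomm D D' D' ≫ l +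
        (K ◁ sw K' X A ≫ K ◁ X ◁ D' ≫ E + K ◁ E' ≫ D) -
        sw K K' (X ⊗ A) ≫ (K' ◁ sw K X A ≫ K' ◁ X ◁ D ≫ E' + K' ◁ E ≫ D') := by
  have key : ∀ {K K' : C} {D : K ⊗ A ⟶ A} {D' : K' ⊗ A ⟶ A} {E : K ⊗ (X ⊗ A) ⟶ A}
      {E' : K' ⊗ (X ⊗ A) ⟶ A} (_ : icomm D l l = E) (_ : icomm D' l l = E'),
      K ◁ K' ◁ l ≫ K ◁ D' ≫ D = K ◁ sw K' X A ≫ sw K X (K' ⊗ A) ≫ X ◁ (K ◁ D' ≫ D) ≫ l +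
        (K ◁ sw K' X A ≫ K ◁ X ◁ D' ≫ E + K ◁ E' ≫ D) := by
    intro K K' D D' E E' h h'
    have h1 := K ◁ X ◁ D' ≫= icomm_eq_iff.1 h
    rw [Preadditive.comp_add, sw_naturality_assoc] at h1
    rw [← MonoidalCategory.whiskerLeft_comp_assoc, icomm_eq_iff.1 h']
    simp only [MonoidalPreadditive.whiskerLeft_add, Preadditive.add_comp, Preadditive.comp_add,
      MonoidalCategory.whiskerLeft_comp, Category.assoc, h1]
    abel
  have h2 := key h h'
  have h3 := sw K K' (X ⊗ A) ≫= key h' h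
  have h4 : sw K K' (X ⊗ A) ≫ K' ◁ sw K X A ≫ sw K' X (K ⊗ A) ≫ X ◁ (K' ◁ D ≫ D') ≫ l =
      K ◁ sw K' X A ≫ sw K X (K' ⊗ A) ≫ X ◁ sw K K' A ≫ X ◁ (K' ◁ D ≫ D') ≫ l := by
    rw [reassoc_of% (sw_braid K K' X A)]
  rw [icomm, Preadditive.comp_sub, sw_naturality_assoc, h2, h3, Preadditive.comp_add, h4]
  simp only [whiskerLeft_sub', Preadditive.sub_comp, Preadditive.comp_sub,
    MonoidalCategory.whiskerLeft_comp, Category.assoc]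
  abel

end Derivations

section Symmetric
open MonObj
variable {C : Type u} [Category.{v} C] [Preadditive C] [MonoidalCategory C] [MonoidalPreadditive C]
  [SymmetricCategory C] {V S : C} [MonObj S] {s : V ⟶ S}

/-- The contraction of symmetric tensors with vectors. -/
lemma FreeOn.exists_contraction [HasBinaryBiproducts C] (hS : FreeOn 0 0 S s) (ω : V ⊗ V ⟶ 𝟙_ C) :
    ∃ D : V ⊗ S ⟶ S, icomm D (lmul s) (lmul s) = opi ω S ∧ V ◁ η[S] ≫ D = 0 ∧
      icomm D D D = 0 := by
  -- The flip is needed because `exists_derivation` lists the generator before the parameter,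
  -- whereas ω takes the contracting vector first.
  let κ := (β_ V V).hom ≫ ω
  obtain ⟨D, h1, h2⟩ := hS.exists_derivation (lmul s) hS.curved (opi κ S) (by
    have h1 : V ◁ (sw V V S ≫ V ◁ lmul s) ≫ opi κ S + V ◁ opi κ S ≫ lmul s =
        (V ◁ sw V V S ≫ opi κ (V ⊗ S) + V ◁ opi κ S) ≫ lmul s := by
      rw [MonoidalCategory.whiskerLeft_comp, Category.assoc, opi_naturality,
        Preadditive.add_comp, Category.assoc]
    have h2 : sw V V (V ⊗ S) ≫ (V ◁ sw V V S ≫ opi κ (V ⊗ S) + V ◁ opi κ S) =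
        V ◁ sw V V S ≫ opi κ (V ⊗ S) + V ◁ opi κ S := by
      rw [whiskerLeft_opi, Preadditive.comp_add, sw_sw_assoc, add_comm]
    rw [h1, reassoc_of% h2, sub_self, opw_zero, zero_comp])
  have h3 : icomm D (lmul s) (lmul s) = opi ω S := by
    rw [h1, sw_opi]
    simp only [κ, SymmetricCategory.symmetry_assoc]
  -- The commutator of two contractions is linear, as its inhomogeneous terms are symmetric in the
  -- two vectors and cancel. It kills the unit, so it is zero.
  refine ⟨D, h3, h2, hS.generates.eq_zero₂ (lmul s) ?_ ?_⟩
  · rw [whiskerLeft_icomm_of_derivations h3 h3]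
    have h4 : V ◁ sw V V S ≫ V ◁ V ◁ D ≫ opi ω S + V ◁ opi ω S ≫ D =
        (V ◁ sw V V S ≫ opi ω (V ⊗ S) + V ◁ opi ω S) ≫ D := by
      rw [opi_naturality, Preadditive.add_comp, Category.assoc]
    have h5 : sw V V (V ⊗ S) ≫ (V ◁ sw V V S ≫ opi ω (V ⊗ S) + V ◁ opi ω S) =
        V ◁ sw V V S ≫ opi ω (V ⊗ S) + V ◁ opi ω S := by
      rw [whiskerLeft_opi, Preadditive.comp_add, sw_sw_assoc, add_comm]
    rw [h4, reassoc_of% h5]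
    abel
  · have h6 : V ◁ V ◁ η[S] ≫ V ◁ D = 0 := by
      rw [← MonoidalCategory.whiskerLeft_comp, h2, MonoidalPreadditive.whiskerLeft_zero]
    rw [icomm, Preadditive.comp_sub, sw_naturality_assoc, reassoc_of% h6]
    simp

/-- The Euler operator. -/
def euler (c : 𝟙_ C ⟶ V ⊗ V) {M : C} (D l : V ⊗ M ⟶ M) : M ⟶ M := coi c M ≫ V ◁ D ≫ l

/-- The extra term is ∑ eᵢ ω(eⁱ, v) = v. Thus the operator ∑ eᵢ D(eⁱ) multiplies symmetric tensors
by their degree. -/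
lemma comp_euler (c : 𝟙_ C ⟶ V ⊗ V) {M : C} {ω : V ⊗ V ⟶ 𝟙_ C} {D l : V ⊗ M ⟶ M}
    (hc : coi c (V ⊗ M) ≫ V ◁ opi ω M = 𝟙 _) (hl : IsCurved 0 0 l) (hD : icomm D l l = opi ω M) :
    l ≫ euler c D l = V ◁ euler c D l ≫ l + l := by
  have h1 : V ◁ l ≫ l = sw V V M ≫ V ◁ l ≫ l := by
    have := icomm_eq_iff.1 hl
    rwa [opw_zero, zero_comp, zero_add, opi_zero, add_zero] at this
  have h2 := V ◁ V ◁ D ≫= h1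
  rw [sw_naturality_assoc] at h2
  have h3 := congrArg (fun t => V ◁ t ≫ l) (icomm_eq_iff.1 hD)
  simp only [MonoidalPreadditive.whiskerLeft_add, Preadditive.add_comp,
    MonoidalCategory.whiskerLeft_comp, Category.assoc] at h3
  rw [h2] at h3
  have h4 : coi c (V ⊗ M) ≫ V ◁ sw V V M ≫ sw V V (V ⊗ M) = V ◁ coi c M := by
    rw [← sw_coi]
    simp
  rw [euler, ← Category.assoc, coi_naturality, Category.assoc, h3, Preadditive.comp_add,
    reassoc_of% hc, reassoc_of% h4]
  simp

lemma isCurved_zero_zero {M : C} : IsCurved 0 0 (0 : V ⊗ M ⟶ M) := by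
  simp [IsCurved, icomm]

section
variable [HasColimitsOfShape (Discrete ℕ) C]
  [∀ X : C, PreservesColimitsOfShape (Discrete ℕ) (tensorLeft X)]

lemma whiskerLeft_whiskerLeft_sigma_hom_ext (F : ℕ → C) (X Y : C) {Z : C}
    {f g : X ⊗ (Y ⊗ (∐ F)) ⟶ Z}
    (h : ∀ n, X ◁ Y ◁ Sigma.ι F n ≫ f = X ◁ Y ◁ Sigma.ι F n ≫ g) : f = g := by
  rw [← cancel_epi (α_ X Y _).hom]
  refine whiskerLeft_sigma_hom_ext F _ fun n => ?_
  rw [associator_naturality_right_assoc, h, associator_naturality_right_assoc]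

/-- Symmetric tensors without constant term are in the image of the Euler operator. -/
lemma FreeOn.exists_euler_homotopy [Linear ℚ C] (hS : FreeOn 0 0 S s) {N : S ⟶ S}
    (hN : lmul s ≫ N = V ◁ N ≫ lmul s + lmul s) (hN1 : η[S] ≫ N = 0) :
    ∃ (h : S ⟶ S) (ε : S ⟶ 𝟙_ C), N ≫ h = 𝟙 S - ε ≫ η[S] ∧ η[S] ≫ ε = 𝟙 _ := by
  let F : ℕ → C := fun _ => S
  let inc : ∀ n, S ⟶ ∐ F := Sigma.ι F
  -- The coproduct plays the role of S[t], on which v acts as v t. The linear map φ : S → S[t] with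
  -- φ(1) = 1 multiplies tensors of degree n by tⁿ; it takes the place of a grading of S.
  obtain ⟨b, hb⟩ := exists_whiskerLeft_sigmaDesc F V fun n => lmul s ≫ Sigma.ι F (n + 1)
  have hb' : ∀ n, lmul s ≫ inc (n + 1) = V ◁ inc n ≫ b := fun n => (hb n).symm
  have hcurv : IsCurved 0 0 b := by
    have hl := icomm_eq_iff.1 hS.curved
    rw [opw_zero, zero_comp, zero_add, opi_zero, add_zero] at hl
    rw [IsCurved, opw_zero, zero_comp, zero_add, opi_zero, icomm, sub_eq_zero]
    refine whiskerLeft_whiskerLeft_sigma_hom_ext F V V fun n => ?_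
    change V ◁ V ◁ inc n ≫ V ◁ b ≫ b = V ◁ V ◁ inc n ≫ sw V V (∐ F) ≫ V ◁ b ≫ b
    rw [sw_naturality_assoc, ← MonoidalCategory.whiskerLeft_comp_assoc, ← hb',
      MonoidalCategory.whiskerLeft_comp_assoc, ← hb']
    exact (reassoc_of% hl) _
  obtain ⟨φ, hφ, hφ1⟩ := hS.exists_ext' b hcurv (η[S] ≫ inc 0)
  obtain ⟨ε, hε, hε1⟩ := hS.exists_ext' (0 : V ⊗ 𝟙_ C ⟶ 𝟙_ C) isCurved_zero_zero (𝟙 _)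
  -- In terms of t these are evaluation at 1, evaluation at 0, t d/dt, and division of tⁿ by n
  -- followed by evaluation at 1. As (0 : ℚ)⁻¹ = 0, the map `J` kills the constant term, which `Nd`
  -- kills anyway.
  let E₁ : (∐ F) ⟶ S := Sigma.desc fun _ => 𝟙 S
  let E₀ : (∐ F) ⟶ S := Sigma.desc fun n => if n = 0 then 𝟙 S else 0
  let Nd : (∐ F) ⟶ ∐ F := Sigma.desc fun n => (n : ℚ) • inc n
  let J : (∐ F) ⟶ S := Sigma.desc fun n => (n : ℚ)⁻¹ • 𝟙 S
  have e1 : ∀ n, inc n ≫ E₁ = 𝟙 S := fun n => Sigma.ι_desc _ _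
  have e0 : ∀ n, inc n ≫ E₀ = if n = 0 then 𝟙 S else 0 := fun n => Sigma.ι_desc _ _
  have ed : ∀ n, inc n ≫ Nd = (n : ℚ) • inc n := fun n => Sigma.ι_desc _ _
  have ej : ∀ n, inc n ≫ J = (n : ℚ)⁻¹ • 𝟙 S := fun n => Sigma.ι_desc _ _
  have h1 : φ ≫ E₁ = 𝟙 S := by
    refine hS.generates.ext (lmul s) ?_ (by simp) ?_
    · have hE : b ≫ E₁ = V ◁ E₁ ≫ lmul s := by
        refine whiskerLeft_sigma_hom_ext F V fun n => ?_
        change V ◁ inc n ≫ _ = V ◁ inc n ≫ _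
        rw [← reassoc_of% hb', e1, ← MonoidalCategory.whiskerLeft_comp_assoc, e1]
        simp
      rw [reassoc_of% hφ, hE, MonoidalCategory.whiskerLeft_comp_assoc]
    · rw [reassoc_of% hφ1, e1, Category.comp_id]
  have h0 : φ ≫ E₀ = ε ≫ η[S] := by
    refine hS.generates.ext 0 ?_ ?_ ?_
    · have hE : b ≫ E₀ = 0 := by
        refine whiskerLeft_sigma_hom_ext F V fun n => ?_
        change V ◁ inc n ≫ _ = V ◁ inc n ≫ _
        rw [← reassoc_of% hb', e0]
        simp
      rw [reassoc_of% hφ, hE, comp_zero, comp_zero]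
    · rw [reassoc_of% hε, zero_comp, comp_zero, comp_zero]
    · rw [reassoc_of% hφ1, e0, reassoc_of% hε1]
      simp
  -- Under φ the Euler operator becomes t d/dt: the inhomogeneous terms cancel in the difference,
  -- which is therefore linear, and it kills the unit.
  have hd : φ ≫ Nd = N ≫ φ := by
    have hE : b ≫ Nd = V ◁ Nd ≫ b + b := by
      refine whiskerLeft_sigma_hom_ext F V fun n => ?_
      change V ◁ inc n ≫ _ = V ◁ inc n ≫ _
      rw [← reassoc_of% hb', ed, Preadditive.comp_add, ← MonoidalCategory.whiskerLeft_comp_assoc,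
        ed, whiskerLeft_smul', Linear.smul_comp, ← hb', Linear.comp_smul]
      push_cast
      rw [add_smul, one_smul]
    rw [← sub_eq_zero]
    refine hS.generates.ext b ?_ (G := 0) (by simp) ?_
    · simp only [Preadditive.comp_sub, whiskerLeft_sub', Preadditive.sub_comp,
        MonoidalCategory.whiskerLeft_comp, Category.assoc]
      rw [reassoc_of% hφ, hE, reassoc_of% hN]
      simp only [Preadditive.comp_add, Preadditive.add_comp, Category.assoc, hφ]
      abel
    · rw [Preadditive.comp_sub, reassoc_of% hφ1, ed, reassoc_of% hN1]
      simp
  have hJ : Nd ≫ J = E₁ - E₀ := by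
    refine Sigma.hom_ext _ _ fun n => ?_
    change inc n ≫ _ = inc n ≫ _
    rw [reassoc_of% ed, Linear.smul_comp, ej, Preadditive.comp_sub, e1, e0, smul_smul]
    rcases eq_or_ne n 0 with rfl | hn
    · simp
    · rw [mul_inv_cancel₀ (Nat.cast_ne_zero.2 hn)]
      simp [hn]
  refine ⟨φ ≫ J, ε, ?_, hε1⟩
  rw [← reassoc_of% hd, hJ, Preadditive.comp_sub, h1, h0]

end
end Symmetric
-- Modules over the Weil algebra
section Centralizer
open MonObj
variable {C : Type u} [Category.{v} C] [Preadditive C] [MonoidalCategory C] [MonoidalPreadditive C]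
  [SymmetricCategory C]

lemma Generates.eq_zero_tensor {X A : C} [MonObj A] {i : X ⟶ A} (h : Generates A i) {K Y M : C}
    (b : X ⊗ M ⟶ M) {F : K ⊗ (A ⊗ Y) ⟶ M} (hF : icomm F (opw (lmul i) Y) b = 0)
    (h1 : K ◁ η[A] ▷ Y ≫ F = 0) : F = 0 := by
  have h2 : sw A K Y ≫ F = 0 := by
    refine h _ M b _ ?_ ?_
    · rw [reassoc_of% (opw_sw (lmul i) K Y), sub_eq_zero.1 hF, sw_sw_assoc,
        MonoidalCategory.whiskerLeft_comp_assoc]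
    · rw [reassoc_of% (sw_naturality_left η[A] K Y), h1, comp_zero]
  rwa [← cancel_epi (sw A K Y), comp_zero]

lemma Generates.ext_tensor {X A : C} [MonObj A] {i : X ⟶ A} (h : Generates A i) {K Y M : C}
    (b : X ⊗ M ⟶ M) {F G : K ⊗ (A ⊗ Y) ⟶ M}
    (hF : icomm F (opw (lmul i) Y) b = icomm G (opw (lmul i) Y) b)
    (h1 : K ◁ η[A] ▷ Y ≫ F = K ◁ η[A] ▷ Y ≫ G) : F = G := by
  rw [← sub_eq_zero]
  refine h.eq_zero_tensor b ?_ ?_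
  · rw [icomm_sub_left, hF, sub_self]
  · rw [Preadditive.comp_sub, h1, sub_self]

/-- Actions on different tensor factors commute. -/
lemma icomm_sw_opw {X X' Y A : C} (b : X ⊗ Y ⟶ Y) (a : X' ⊗ A ⟶ A) :
    icomm (sw X A Y ≫ A ◁ b) (opw a Y) (opw a Y) = 0 := by
  rw [icomm, sub_eq_zero, reassoc_of% (whiskerLeft_opw_sw X a Y), MonoidalCategory.whiskerLeft_comp,
    Category.assoc, opw_naturality]

lemma icomm_whiskerLeft_comp {K X A A' M : C} (F : K ⊗ A ⟶ M) {a : X ⊗ A ⟶ A} {b : X ⊗ M ⟶ M}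
    {a' : X ⊗ A' ⟶ A'} {f : A' ⟶ A} (hf : a' ≫ f = X ◁ f ≫ a) :
    icomm (K ◁ f ≫ F) a' b = K ◁ X ◁ f ≫ icomm F a b := by
  have := icomm_comp F (b := b) (b' := b) hf (g := 𝟙 M) (by simp)
  simpa using this

lemma icomm_comp_right {K X A M M' : C} (F : K ⊗ A ⟶ M) {a : X ⊗ A ⟶ A} {b : X ⊗ M ⟶ M}
    {b' : X ⊗ M' ⟶ M'} {g : M ⟶ M'} (hg : b ≫ g = X ◁ g ≫ b') :
    icomm (F ≫ g) a b' = icomm F a b ≫ g := by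
  have := icomm_comp F (a := a) (a' := a) (f := 𝟙 A) (by simp) hg
  simpa using this

lemma icomm_eq_zero_swap {X Y M : C} {a : X ⊗ M ⟶ M} {b : Y ⊗ M ⟶ M} (h : icomm a b b = 0) :
    icomm b a a = 0 := by
  rw [icomm_swap, h, comp_zero, neg_zero]

variable [Linear ℚ C]

section Shift
variable {V M : C} {ω : V ⊗ V ⟶ 𝟙_ C} {l t : V ⊗ M ⟶ M}

/-- Because ω is skew, both cross terms [l, t] and [t, l] equal ω. With r = ½ one passes from
commuting operators to the Weyl relations, and with r = -½ one returns. -/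
lemma icomm_add_smul (hω : sw V V M ≫ opi ω M = -opi ω M) (htl : icomm t l l = opi ω M)
    (htt : icomm t t t = 0) (r : ℚ) :
    icomm (l + r • t) (l + r • t) (l + r • t) = icomm l l l + (2 * r) • opi ω M := by
  have h : icomm l t t = opi ω M := by
    rw [icomm_swap, htl, hω, neg_neg]
  rw [icomm_add_left, icomm_add_right, icomm_smul_left, icomm_add_right, icomm_smul_right,
    icomm_smul_right, h, htl, htt, two_mul, add_smul, smul_zero, add_zero]
  abel

lemma icomm_add_smul_left (htl : icomm t l l = opi ω M)
    (htt : icomm t t t = 0) (r : ℚ) : icomm t (l + r • t) (l + r • t) = opi ω M := by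
  rw [icomm_add_right, icomm_smul_right, htl, htt, smul_zero, add_zero]

lemma icomm_comm_add_smul {X N : C} {l' t' : V ⊗ N ⟶ N} {F : X ⊗ M ⟶ N} (hl : icomm F l l' = 0)
    (ht : icomm F t t' = 0) (r : ℚ) : icomm F (l + r • t) (l' + r • t') = 0 := by
  rw [icomm_add_right, icomm_smul_right, hl, ht, smul_zero, add_zero]

end Shift

namespace SymplecticForm
variable {L : LieObj C} {V : LieMod L} (S : SymplecticForm V)

lemma icomm_spin_eq_zero {K M N : C} {v : V.X ⊗ M ⟶ M} {w : V.X ⊗ N ⟶ N} {F : K ⊗ M ⟶ N}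
    (h : icomm F v w = 0) : icomm F (S.spin v) (S.spin w) = 0 := by
  have h1 := sub_eq_zero.1 h
  rw [spin, spin, icomm_smul_right, icomm]
  simp only [MonoidalCategory.whiskerLeft_comp, Category.assoc]
  rw [h1, sw_naturality_assoc, ← MonoidalCategory.whiskerLeft_comp_assoc V.X (K ◁ v), h1,
    reassoc_of% (cop_naturality S.quad F)]
  simp only [MonoidalCategory.whiskerLeft_comp, Category.assoc]
  rw [reassoc_of% (sw_whiskerLeft_cop K S.quad M), sub_self, smul_zero]

lemma spin_lmul {A : C} [MonObj A] (f : V.X ⟶ A) :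
    S.spin (lmul f) = lmul ((2⁻¹ : ℚ) • (S.quad ≫ (f ⊗ₘ f) ≫ μ[A])) := by
  rw [spin, ← lmul_cop]
  simp [lmul]

end SymplecticForm

/-- The relations of the Weil algebra for the actions `x` of `L` and `v` of `V` on `M`. -/
structure WeilRel {L : LieObj C} {V : LieMod L} (S : SymplecticForm V) {M : C} (x : L.X ⊗ M ⟶ M)
    (v : V.X ⊗ M ⟶ M) : Prop where
  lie : IsCurved L.bracket 0 x
  act : icomm x v v = opw V.act M ≫ v
  weyl : IsCurved 0 S.om v

/-- The algebra generated by `L` and `V` subject to the relations of the Weil algebra. -/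
structure IsWeil {L : LieObj C} {V : LieMod L} (S : SymplecticForm V) (A : C) [MonObj A]
    (f₀ : L.X ⟶ A) (f₁ : V.X ⟶ A) : Prop where
  rel : WeilRel S (lmul f₀) (lmul f₁)
  exists_ext : ∀ (M : C) (x : L.X ⊗ M ⟶ M) (v : V.X ⊗ M ⟶ M), WeilRel S x v → ∀ m : 𝟙_ C ⟶ M,
    ∃ F : A ⟶ M, lmul f₀ ≫ F = L.X ◁ F ≫ x ∧ lmul f₁ ≫ F = V.X ◁ F ≫ v ∧ η[A] ≫ F = m
  eq_zero : ∀ (K M : C) (x : L.X ⊗ M ⟶ M) (v : V.X ⊗ M ⟶ M) (F : K ⊗ A ⟶ M),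
    icomm F (lmul f₀) x = 0 → icomm F (lmul f₁) v = 0 → K ◁ η[A] ≫ F = 0 → F = 0

lemma IsWeil.ext {L : LieObj C} {V : LieMod L} {S : SymplecticForm V} {A : C} [MonObj A]
    {f₀ : L.X ⟶ A} {f₁ : V.X ⟶ A} (h : IsWeil S A f₀ f₁) {M : C} (x : L.X ⊗ M ⟶ M)
    (v : V.X ⊗ M ⟶ M) {F G : A ⟶ M} (hF : lmul f₀ ≫ F = L.X ◁ F ≫ x)
    (hF' : lmul f₁ ≫ F = V.X ◁ F ≫ v) (hG : lmul f₀ ≫ G = L.X ◁ G ≫ x)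
    (hG' : lmul f₁ ≫ G = V.X ◁ G ≫ v) (h1 : η[A] ≫ F = η[A] ≫ G) : F = G := by
  have key : ∀ {X : C} {a : X ⊗ A ⟶ A} {b : X ⊗ M ⟶ M}, a ≫ F = X ◁ F ≫ b → a ≫ G = X ◁ G ≫ b →
      icomm ((λ_ A).hom ≫ (F - G)) a b = 0 := by
    intro X a b h2 h3
    rw [icomm, leftUnitor_naturality_assoc, Preadditive.comp_sub, h2, h3]
    simp [sw, whiskerLeft_sub', Preadditive.sub_comp]
  have h2 := h.eq_zero (𝟙_ C) M x v ((λ_ A).hom ≫ (F - G)) (key hF hG) (key hF' hG') (by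
    rw [leftUnitor_naturality_assoc, Preadditive.comp_sub, h1, sub_self, comp_zero])
  rwa [← sub_eq_zero, ← cancel_epi (λ_ A).hom, comp_zero]

end Centralizer
-- The enveloping algebra in the Weil algebra; symbols and symmetrization
section Centralizer
open MonObj
variable {C : Type u} [Category.{v} C] [Preadditive C] [MonoidalCategory C] [MonoidalPreadditive C]
  [SymmetricCategory C] [Linear ℚ C]

namespace IsWeil
variable {L : LieObj C} {V : LieMod L} {S : SymplecticForm V} {A : C} [MonObj A]
  {f₀ : L.X ⟶ A} {f₁ : V.X ⟶ A}

variable (S f₀ f₁) in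
/-- The generators of the enveloping algebra of `L` which commute with `V`. -/
def twisted : L.X ⟶ A := f₀ - (2⁻¹ : ℚ) • (S.quad ≫ (f₁ ⊗ₘ f₁) ≫ μ[A])

lemma lmul_twisted : lmul (twisted S f₀ f₁) = lmul f₀ - S.spin (lmul f₁) := by
  rw [S.spin_lmul, twisted, lmul, sub_whiskerRight', Preadditive.sub_comp]
  rfl

section
variable (h : IsWeil S A f₀ f₁)
include h

lemma twisted_comm :
    icomm (lmul (twisted S f₀ f₁)) (lmul f₁) (lmul f₁) = 0 := by
  rw [lmul_twisted]
  exact S.icomm_sub_spin h.rel.weyl h.rel.act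

lemma isCurved_twisted : IsCurved L.bracket 0 (lmul (twisted S f₀ f₁)) := by
  rw [lmul_twisted]
  exact S.isCurved_sub_spin h.rel.weyl h.rel.act h.rel.lie

lemma icomm_lie_twisted : icomm (lmul f₀) (lmul (twisted S f₀ f₁)) (lmul (twisted S f₀ f₁)) =
    opw L.bracket A ≫ lmul (twisted S f₀ f₁) := by
  have h1 := h.rel.lie
  rw [IsCurved, opi_zero, add_zero] at h1
  rw [lmul_twisted, icomm_sub_right, h1, S.icomm_act_spin h.rel.act, Preadditive.comp_sub]

lemma icomm_adop_weyl : icomm (adop f₁) (lmul f₁) (lmul f₁) = opi S.om A := by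
  have h1 := h.rel.weyl
  rw [IsCurved, opw_zero, zero_comp, zero_add] at h1
  rw [icomm_adop_lmul, h1]

/-- Commutators of elements of V are scalars, hence central, so the inner derivations they define
commute. -/
lemma icomm_adop_adop_weyl : icomm (adop f₁) (adop f₁) (adop f₁) = 0 := by
  have h1 := (isCurved_lmul_iff f₁).1 h.rel.weyl
  rw [zero_comp, zero_add] at h1
  rw [icomm_adop_adop, h1, opw_comp, Category.assoc, unit_whiskerRight_commutator, comp_zero]

lemma icomm_adop_twisted :
    icomm (adop f₁) (lmul (twisted S f₀ f₁)) (lmul (twisted S f₀ f₁)) = 0 := by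
  rw [icomm_adop_lmul, icomm_eq_zero_swap h.twisted_comm]

/-- The elements x - spin(x) satisfy the relations of L, which gives θ. They commute with V, so the
derivations ad(v) kill the image. Equivariance concerns the original generators f₀ and follows from
[x, y - spin(y)] = [x, y] - spin([x, y]). -/
theorem exists_hom {U : C} [MonObj U] {i : L.X ⟶ U} (hU : FreeOn L.bracket 0 U i) :
    ∃ θ : U ⟶ A, IsMonHom θ ∧ lmul i ≫ θ = L.X ◁ θ ≫ lmul (twisted S f₀ f₁) ∧
      V.X ◁ θ ≫ adop f₁ = 0 ∧ L.X ◁ θ ≫ adop f₀ = adop i ≫ θ := by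
  obtain ⟨θ, h1, h2⟩ := hU.exists_ext' _ h.isCurved_twisted η[A]
  refine ⟨θ, FreeOn.isMonHom_of_linear hU.generates _ h1 h2, h1, ?_, ?_⟩
  · refine hU.generates.eq_zero (lmul (twisted S f₀ f₁)) ?_ ?_
    · rw [icomm_whiskerLeft_comp _ h1, h.icomm_adop_twisted, comp_zero]
    · rw [← MonoidalCategory.whiskerLeft_comp_assoc, h2, whiskerLeft_one_adop]
  · have h3 := hU.curved
    rw [IsCurved, opi_zero, add_zero] at h3
    refine hU.generates.ext_left (lmul (twisted S f₀ f₁)) ?_ ?_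
    · rw [icomm_whiskerLeft_comp _ h1, icomm_adop_lmul, h.icomm_lie_twisted, icomm_comp_right _ h1,
        icomm_adop_lmul, h3, Category.assoc, h1, reassoc_of% (opw_naturality L.bracket θ)]
    · rw [← MonoidalCategory.whiskerLeft_comp_assoc, h2, whiskerLeft_one_adop,
        reassoc_of% (whiskerLeft_one_adop i), zero_comp]

end

end IsWeil

section Symbol
variable {L : LieObj C} {V : LieMod L} (S : SymplecticForm V) {T U : C} [MonObj T] [MonObj U]
  (s : V.X ⟶ T) (D : V.X ⊗ T ⟶ T) (i : L.X ⟶ U)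

/-- The action of `V` on the tensor product of the symmetric algebra `T` of `V` and the enveloping
algebra `U` of `L`, as a module over the Weil algebra. -/
def symbolWeyl (U : C) : V.X ⊗ (T ⊗ U) ⟶ T ⊗ U := opw (lmul s) U + (2⁻¹ : ℚ) • opw D U

/-- The action of `L` on the second factor of `T ⊗ U`. -/
def symbolLie (T : C) : L.X ⊗ (T ⊗ U) ⟶ T ⊗ U := sw L.X T U ≫ T ◁ lmul i

variable {s D i}

lemma opw_icomm_eq {M : C} {l t : V.X ⊗ M ⟶ M} {k : V.X ⊗ V.X ⟶ 𝟙_ C} (h : icomm t l l = opi k M)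
    (U : C) : icomm (opw t U) (opw l U) (opw l U) = opi k (M ⊗ U) := by
  rw [icomm_tensor, h]
  simp [opw, opi]

variable (hT : FreeOn 0 0 T s) (hD : icomm D (lmul s) (lmul s) = opi S.om T)
  (hDD : icomm D D D = 0)
include hT hD hDD

lemma symbolWeyl_isCurved (U : C) : IsCurved 0 S.om (symbolWeyl s D U) := by
  have h0 : icomm (lmul s) (lmul s) (lmul s) = opi 0 T := by
    have := hT.curved
    rwa [IsCurved, opw_zero, zero_comp, zero_add] at this
  have h1 : icomm D D D = opi 0 T := by rw [hDD, opi_zero]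
  rw [IsCurved, symbolWeyl, icomm_add_smul (S.sw_om _) (opw_icomm_eq hD U)
    ((opw_icomm_eq h1 U).trans (opi_zero _)), opw_icomm_eq h0]
  norm_num

lemma icomm_symbolWeyl (U : C) : icomm (opw D U) (symbolWeyl s D U) (symbolWeyl s D U) =
    opi S.om (T ⊗ U) :=
  icomm_add_smul_left (opw_icomm_eq hD U)
    ((opw_icomm_eq (by rw [hDD, opi_zero]) U).trans (opi_zero _)) _

omit hT hD hDD

lemma icomm_symbolLie_symbolWeyl :
    icomm (symbolLie i T) (symbolWeyl s D U) (symbolWeyl s D U) = 0 :=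
  icomm_comm_add_smul (icomm_sw_opw _ _) (icomm_sw_opw _ _) _

end Symbol

namespace IsWeil
variable {L : LieObj C} {V : LieMod L} {S : SymplecticForm V} {A : C} [MonObj A]
  {f₀ : L.X ⟶ A} {f₁ : V.X ⟶ A} (h : IsWeil S A f₀ f₁) {T U : C} [MonObj T] [MonObj U]
  {s : V.X ⟶ T} {D : V.X ⊗ T ⟶ T} {i : L.X ⟶ U}
  (hU : FreeOn L.bracket 0 U i) (hT : FreeOn 0 0 T s)
  (hD : icomm D (lmul s) (lmul s) = opi S.om T) (hD1 : V.X ◁ η[T] ≫ D = 0)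
  (hDD : icomm D D D = 0)

include h hU hT hD hDD in
-- The object T ⊗ U is a module over the Weil algebra: V acts through `symbolWeyl`, and L through
-- its action on U plus `spin`. The symbol σ is the action on 1 ⊗ 1. The twisted generators act on U
-- alone because their spin part is subtracted again.
lemma exists_symbol : ∃ σ : A ⟶ T ⊗ U,
    lmul (twisted S f₀ f₁) ≫ σ = L.X ◁ σ ≫ symbolLie i T ∧
    lmul f₁ ≫ σ = V.X ◁ σ ≫ symbolWeyl s D U ∧ η[A] ≫ σ = η[U] ≫ (λ_ U).inv ≫ η[T] ▷ U := by
  have hv := symbolWeyl_isCurved S hT hD hDD U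
  obtain ⟨σ, h1, h2, h3⟩ := h.exists_ext (T ⊗ U) (symbolLie i T + S.spin (symbolWeyl s D U))
    (symbolWeyl s D U) ⟨S.isCurved_add_spin hv icomm_symbolLie_symbolWeyl (hU.curved.sw T),
      S.icomm_add_spin hv icomm_symbolLie_symbolWeyl, hv⟩ (η[U] ≫ (λ_ U).inv ≫ η[T] ▷ U)
  refine ⟨σ, ?_, h2, h3⟩
  rw [lmul_twisted, Preadditive.sub_comp, h1, S.spin_hom h2, Preadditive.comp_add,
    add_sub_cancel_right]

include h hU hT hD hD1 hDD in
-- On T ⊗ U this map is the symmetrized product of vectors of V, applied to the image of θ.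
lemma exists_symmetrization {θ : U ⟶ A} (hθ : lmul i ≫ θ = L.X ◁ θ ≫ lmul (twisted S f₀ f₁))
    (hθ' : V.X ◁ θ ≫ adop f₁ = 0) : ∃ φ : T ⊗ U ⟶ A,
    symbolLie i T ≫ φ = L.X ◁ φ ≫ lmul (twisted S f₀ f₁) ∧
    symbolWeyl s D U ≫ φ = V.X ◁ φ ≫ lmul f₁ ∧ η[T] ▷ U ≫ φ = (λ_ U).hom ≫ θ := by
  -- Subtracting half of the commutator from v a leaves ½ (v a + a v). By `icomm_add_smul` with r =
  -- -½ these operators commute, so they define an action of the symmetric algebra T.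
  let w : V.X ⊗ A ⟶ A := lmul f₁ + (-2⁻¹ : ℚ) • adop f₁
  have htl := h.icomm_adop_weyl
  have htt := h.icomm_adop_adop_weyl
  have hw : IsCurved 0 0 w := by
    have h1 := h.rel.weyl
    rw [IsCurved, opw_zero, zero_comp, zero_add] at h1
    rw [IsCurved, icomm_add_smul (S.sw_om A) htl htt, h1]
    norm_num
  have htw : icomm (adop f₁) w w = opi S.om A := icomm_add_smul_left htl htt _
  have hxw : icomm (lmul (twisted S f₀ f₁)) w w = 0 :=
    icomm_comm_add_smul h.twisted_comm (icomm_eq_zero_swap h.icomm_adop_twisted) _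
  obtain ⟨φ, h1, h2⟩ := hT.exists_ext U A w hw θ
  have h3 : symbolLie i T ≫ φ = L.X ◁ φ ≫ lmul (twisted S f₀ f₁) := by
    refine hT.generates.ext_tensor w ?_ ?_
    · rw [icomm_comp_right _ h1, symbolLie, icomm_sw_opw, zero_comp, icomm_whiskerLeft_comp _ h1,
        hxw, comp_zero]
    · rw [symbolLie, Category.assoc, reassoc_of% (sw_naturality_middle L.X η[T] U),
        ← whisker_exchange_assoc, h2, ← MonoidalCategory.whiskerLeft_comp_assoc, h2,
        MonoidalCategory.whiskerLeft_comp_assoc, ← hθ]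
      simp [sw]
  -- The contraction by v and the derivation ad(v) have the same commutators, given by ω, with the
  -- multiplications on T and with `w` respectively; both composites vanish on 1 ⊗ U.
  have h4 : opw D U ≫ φ = V.X ◁ φ ≫ adop f₁ := by
    refine hT.generates.ext_tensor w ?_ ?_
    · rw [icomm_comp_right _ h1, opw_icomm_eq hD, icomm_whiskerLeft_comp _ h1, htw,
        opi_naturality]
    · rw [opw, Category.assoc, associator_inv_naturality_middle_assoc, ← comp_whiskerRight_assoc,
        hD1, ← MonoidalCategory.whiskerLeft_comp_assoc, h2, MonoidalCategory.whiskerLeft_comp_assoc,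
        hθ']
      simp
  refine ⟨φ, h3, ?_, h2⟩
  rw [symbolWeyl, Preadditive.add_comp, h1, Linear.smul_comp, h4]
  simp only [w, Preadditive.comp_add, neg_smul]
  rw [Preadditive.comp_neg, Linear.comp_smul]
  abel

include h hD hDD hT in
-- The difference of the two sides commutes with V and with the twisted generators, hence with
-- `spin` and with L, and it kills the unit.
lemma contraction_symbol {σ : A ⟶ T ⊗ U}
    (h0 : lmul (twisted S f₀ f₁) ≫ σ = L.X ◁ σ ≫ symbolLie i T)
    (h1 : lmul f₁ ≫ σ = V.X ◁ σ ≫ symbolWeyl s D U)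
    (h2 : η[A] ≫ σ = η[U] ≫ (λ_ U).inv ≫ η[T] ▷ U) (hD1 : V.X ◁ η[T] ≫ D = 0) :
    V.X ◁ σ ≫ opw D U = adop f₁ ≫ σ := by
  rw [← sub_eq_zero]
  have h3 : icomm (V.X ◁ σ ≫ opw D U - adop f₁ ≫ σ) (lmul (twisted S f₀ f₁)) (symbolLie i T) =
      0 := by
    have h5 : icomm (opw D U) (symbolLie i T) (symbolLie i T) = 0 :=
      icomm_eq_zero_swap (icomm_sw_opw _ _)
    rw [icomm_sub_left, icomm_whiskerLeft_comp _ h0, icomm_comp_right _ h0, h.icomm_adop_twisted,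
      h5]
    simp
  have h4 : icomm (V.X ◁ σ ≫ opw D U - adop f₁ ≫ σ) (lmul f₁) (symbolWeyl s D U) = 0 := by
    rw [icomm_sub_left, icomm_whiskerLeft_comp _ h1, icomm_comp_right _ h1, h.icomm_adop_weyl,
      icomm_symbolWeyl S hT hD hDD, opi_naturality, sub_self]
  refine h.eq_zero _ _ (symbolLie i T + S.spin (symbolWeyl s D U)) _ _ ?_ h4 ?_
  · have h5 := S.icomm_spin_eq_zero h4
    rw [lmul_twisted] at h3
    have h6 := icomm_add_right (V.X ◁ σ ≫ opw D U - adop f₁ ≫ σ) (lmul f₀ - S.spin (lmul f₁))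
      (S.spin (lmul f₁)) (symbolLie i T) (S.spin (symbolWeyl s D U))
    rwa [h3, h5, add_zero, sub_add_cancel] at h6
  · rw [Preadditive.comp_sub, ← MonoidalCategory.whiskerLeft_comp_assoc, h2,
      reassoc_of% (whiskerLeft_one_adop f₁)]
    simp only [MonoidalCategory.whiskerLeft_comp, Category.assoc, opw]
    rw [associator_inv_naturality_middle_assoc, ← comp_whiskerRight, hD1]
    simp

end IsWeil
end Centralizer
-- The centralizer of V and the parity automorphism
section Centralizer
open MonObj
variable {C : Type u} [Category.{v} C] [Preadditive C] [MonoidalCategory C] [MonoidalPreadditive C]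
  [SymmetricCategory C] [Linear ℚ C]

lemma euler_whiskerRight {V : C} (c : 𝟙_ C ⟶ V ⊗ V) {M : C} (D l : V ⊗ M ⟶ M) (U : C) :
    euler c D l ▷ U = coi c (M ⊗ U) ≫ V ◁ opw D U ≫ opw l U := by
  simp [euler, coi, cop, opw]

lemma comp_euler_whiskerRight {V : C} (c : 𝟙_ C ⟶ V ⊗ V) {M : C} (D l : V ⊗ M ⟶ M) {Y U : C}
    {g : Y ⟶ M ⊗ U} (hg : V ◁ g ≫ opw D U = 0) : g ≫ euler c D l ▷ U = 0 := by
  rw [euler_whiskerRight, reassoc_of% (coi_naturality c g),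
    ← MonoidalCategory.whiskerLeft_comp_assoc, hg]
  simp

lemma unit_euler {V : C} (c : 𝟙_ C ⟶ V ⊗ V) {T : C} [MonObj T] {D : V ⊗ T ⟶ T}
    (hD : V ◁ η[T] ≫ D = 0) (l : V ⊗ T ⟶ T) : η[T] ≫ euler c D l = 0 := by
  rw [euler, reassoc_of% (coi_naturality c η[T]), ← MonoidalCategory.whiskerLeft_comp_assoc, hD]
  simp

/-- What is killed by all contractions is killed by the Euler operator, and the homotopy k then
reduces it to its constant term. -/
lemma exists_comp_of_euler {V T : C} [MonObj T] {c : 𝟙_ C ⟶ V ⊗ V} {D l : V ⊗ T ⟶ T}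
    {k : T ⟶ T} {ε : T ⟶ 𝟙_ C} (hk : euler c D l ≫ k = 𝟙 T - ε ≫ η[T]) {Y U : C}
    {g : Y ⟶ T ⊗ U} (hg : V ◁ g ≫ opw D U = 0) :
    g = (g ≫ ε ▷ U ≫ (λ_ U).hom) ≫ (λ_ U).inv ≫ η[T] ▷ U := by
  have h1 := congrArg (fun t => g ≫ t ▷ U) hk
  simp only [comp_whiskerRight, sub_whiskerRight', id_whiskerRight, Preadditive.comp_sub] at h1
  rw [reassoc_of% (comp_euler_whiskerRight c D l hg), zero_comp, eq_comm, sub_eq_zero,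
    Category.comp_id] at h1
  simpa using h1

namespace IsWeil
variable {L : LieObj C} {V : LieMod L} {S : SymplecticForm V} {A : C} [MonObj A]
  {f₀ : L.X ⟶ A} {f₁ : V.X ⟶ A}

/-- The subalgebra of the Weil algebra which commutes with `V` is the enveloping algebra of `L`. -/
theorem exists_centralizer (h : IsWeil S A f₀ f₁) [HasBinaryBiproducts C]
    [HasColimitsOfShape (Discrete ℕ) C]
    [∀ X : C, PreservesColimitsOfShape (Discrete ℕ) (tensorLeft X)]
    [HasCokernels C] [∀ X : C, PreservesFiniteColimits (tensorLeft X)]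
    {U : C} [MonObj U] {i : L.X ⟶ U} (hU : FreeOn L.bracket 0 U i) :
    ∃ θ : U ⟶ A, IsMonHom θ ∧ Mono θ ∧ lmul i ≫ θ = L.X ◁ θ ≫ lmul (twisted S f₀ f₁) ∧
      V.X ◁ θ ≫ adop f₁ = 0 ∧ L.X ◁ θ ≫ adop f₀ = adop i ≫ θ ∧
      ∀ {Y : C} (u : Y ⟶ A), V.X ◁ u ≫ adop f₁ = 0 → ∃ g, g ≫ θ = u := by
  obtain ⟨θ, hθ, hθ1, hθ2, hθ3⟩ := h.exists_hom hU
  obtain ⟨T, s, hT⟩ := exists_freeOn (X := V.X) 0 0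
  obtain ⟨D, hD, hD1, hDD⟩ := hT.exists_contraction S.om
  obtain ⟨k, ε, hk, hε⟩ := hT.exists_euler_homotopy
    (comp_euler S.co (S.coi_om T.X) hT.curved hD) (unit_euler S.co hD1 _)
  obtain ⟨σ, hσ1, hσ2, hσ3⟩ := h.exists_symbol hU hT hD hDD
  obtain ⟨φ, hφ1, hφ2, hφ3⟩ := h.exists_symmetrization hU hT hD hD1 hDD hθ1 hθ2
  -- Both sides are linear for L and V and preserve the unit. Only this one-sided inverse is needed.
  have hσφ : σ ≫ φ = 𝟙 A := by
    have e : lmul f₀ = lmul (twisted S f₀ f₁) + S.spin (lmul f₁) := by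
      rw [lmul_twisted, sub_add_cancel]
    have e1 : lmul f₁ ≫ σ ≫ φ = V.X ◁ (σ ≫ φ) ≫ lmul f₁ := by
      rw [reassoc_of% hσ2, hφ2, MonoidalCategory.whiskerLeft_comp_assoc]
    refine h.ext (lmul f₀) (lmul f₁) ?_ e1 (by simp) (by simp) ?_
    · rw [e, Preadditive.add_comp, S.spin_hom e1, reassoc_of% hσ1, hφ1, Preadditive.comp_add]
      simp only [MonoidalCategory.whiskerLeft_comp, Category.assoc]
    · rw [reassoc_of% hσ3, hφ3, Iso.inv_hom_id_assoc, hθ.one_hom, Category.comp_id]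
  have hθσ : θ ≫ σ = (λ_ U).inv ≫ η[T.X] ▷ U := by
    refine hU.generates.ext (symbolLie i T.X) ?_ ?_ ?_
    · rw [reassoc_of% hθ1, hσ1, MonoidalCategory.whiskerLeft_comp_assoc]
    · have e : L.X ◁ (λ_ U).inv ≫ sw L.X (𝟙_ C) U = (λ_ (L.X ⊗ U)).inv := by
        simp [sw]
      rw [symbolLie, MonoidalCategory.whiskerLeft_comp_assoc,
        reassoc_of% (sw_naturality_middle L.X η[T.X] U), reassoc_of% e, ← whisker_exchange,
        leftUnitor_inv_naturality_assoc]
    · rw [hθ.one_hom_assoc, hσ3]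
  -- The constant term of the symbol is a retraction of θ, so θ is mono. If u commutes with V, its
  -- symbol is killed by contractions and equals 1 ⊗ g, where g is its constant term; applying φ
  -- gives u = θ(g).
  refine ⟨θ, hθ, ?_, hθ1, hθ2, hθ3, fun {Y} u hu => ⟨(u ≫ σ) ≫ ε ▷ U ≫ (λ_ U).hom, ?_⟩⟩
  · have e : θ ≫ σ ≫ ε ▷ U ≫ (λ_ U).hom = 𝟙 U := by
      rw [reassoc_of% hθσ, ← comp_whiskerRight_assoc, hε]
      simp
    exact mono_of_mono_fac e
  · have e : V.X ◁ (u ≫ σ) ≫ opw D U = 0 := by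
      rw [MonoidalCategory.whiskerLeft_comp, Category.assoc,
        h.contraction_symbol hT hD hDD hσ1 hσ2 hσ3 hD1, reassoc_of% hu, zero_comp]
    have e1 := congrArg (· ≫ φ) (exists_comp_of_euler hk e)
    simp only [Category.assoc, hσφ, Category.comp_id, hφ3, Iso.inv_hom_id_assoc] at e1
    simpa using e1.symm

/-- In each relation all terms have the same degree in V modulo 2. -/
lemma rel_neg (h : IsWeil S A f₀ f₁) : WeilRel S (lmul f₀) (-lmul f₁) where
  lie := h.rel.lie
  act := by
    have h1 := icomm_sub_right (lmul f₀) 0 (lmul f₁) 0 (lmul f₁)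
    rw [zero_sub, h.rel.act] at h1
    rw [h1, Preadditive.comp_neg]
    simp [icomm]
  weyl := by
    have h1 := h.rel.weyl
    rw [IsCurved, opw_zero, zero_comp, zero_add] at h1 ⊢
    rw [← h1]
    simp [icomm, whiskerLeft_neg']

/-- The parity automorphism of the Weil algebra. -/
lemma exists_parity (h : IsWeil S A f₀ f₁) : ∃ τ : A ⟶ A, lmul f₀ ≫ τ = L.X ◁ τ ≫ lmul f₀ ∧
    lmul f₁ ≫ τ = V.X ◁ τ ≫ (-lmul f₁) ∧ η[A] ≫ τ = η[A] :=
  h.exists_ext A _ _ h.rel_neg η[A]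

/-- Since `spin` is quadratic in V, the twisted generators are even, hence fixed by τ. -/
lemma parity_eq {τ : A ⟶ A} (hτ : lmul f₀ ≫ τ = L.X ◁ τ ≫ lmul f₀)
    (hτ1 : lmul f₁ ≫ τ = V.X ◁ τ ≫ (-lmul f₁)) (hτ2 : η[A] ≫ τ = η[A]) {U : C} [MonObj U]
    {i : L.X ⟶ U} (hU : Generates U i) {θ : U ⟶ A}
    (hθ : lmul i ≫ θ = L.X ◁ θ ≫ lmul (twisted S f₀ f₁)) (hθ1 : η[U] ≫ θ = η[A]) :
    θ ≫ τ = θ := by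
  refine hU.ext (lmul (twisted S f₀ f₁)) ?_ hθ ?_
  · have h1 : S.spin (-lmul f₁) = S.spin (lmul f₁) := by
      simp [SymplecticForm.spin, whiskerLeft_neg']
    have h2 := S.spin_hom hτ1
    rw [h1] at h2
    rw [reassoc_of% hθ, lmul_twisted, Preadditive.sub_comp, hτ, h2, ← Preadditive.comp_sub,
      MonoidalCategory.whiskerLeft_comp_assoc]
  · rw [reassoc_of% hθ1, hτ2, hθ1]

/-- The derivation d reverses the parity of generators: it kills L and maps V to L. Therefore d τ +
τ d is linear, with V acting on the target with the opposite sign, and it kills the unit. -/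
lemma parity_derivation (h : IsWeil S A f₀ f₁) {τ : A ⟶ A} (hτ : lmul f₀ ≫ τ = L.X ◁ τ ≫ lmul f₀)
    (hτ1 : lmul f₁ ≫ τ = V.X ◁ τ ≫ (-lmul f₁)) (hτ2 : η[A] ≫ τ = η[A]) {P : C} {d : P ⊗ A ⟶ A}
    {k : P ⊗ V.X ⟶ L.X} (hd : icomm d (lmul f₀) (lmul f₀) = 0)
    (hd1 : icomm d (lmul f₁) (lmul f₁) = opw k A ≫ lmul f₀) (hd2 : P ◁ η[A] ≫ d = 0) :
    P ◁ τ ≫ d + d ≫ τ = 0 := by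
  refine h.eq_zero P A (lmul f₀) (-lmul f₁) _ ?_ ?_ ?_
  · rw [icomm_add_left, icomm_whiskerLeft_comp _ hτ, icomm_comp_right _ hτ, hd]
    simp
  · have h1 : icomm d (-lmul f₁) (-lmul f₁) = -(opw k A ≫ lmul f₀) := by
      rw [← hd1]
      simp only [icomm, whiskerLeft_neg', Preadditive.neg_comp, Preadditive.comp_neg, neg_sub]
      abel
    rw [icomm_add_left, icomm_whiskerLeft_comp _ hτ1, icomm_comp_right _ hτ1, hd1, h1,
      Category.assoc, hτ, Preadditive.comp_neg, reassoc_of% (opw_naturality k τ), neg_add_cancel]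
  · rw [Preadditive.comp_add, ← MonoidalCategory.whiskerLeft_comp_assoc, hτ2, hd2, reassoc_of% hd2,
      zero_comp, add_zero]

/-- The differential of the Weil algebra vanishes on the elements which commute with `V`, if the
result commutes with `V` as well. -/
lemma whiskerLeft_derivation_eq_zero (h : IsWeil S A f₀ f₁) {P U : C} [MonObj U] {d : P ⊗ A ⟶ A}
    {k : P ⊗ V.X ⟶ L.X} (hd : icomm d (lmul f₀) (lmul f₀) = 0)
    (hd1 : icomm d (lmul f₁) (lmul f₁) = opw k A ≫ lmul f₀) (hd2 : P ◁ η[A] ≫ d = 0)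
    {i : L.X ⟶ U} (hU : Generates U i) {θ : U ⟶ A}
    (hθ : lmul i ≫ θ = L.X ◁ θ ≫ lmul (twisted S f₀ f₁)) (hθ1 : η[U] ≫ θ = η[A])
    {Y : C} {g : Y ⟶ U} {g' : P ⊗ Y ⟶ U} (hg : P ◁ (g ≫ θ) ≫ d = g' ≫ θ) :
    P ◁ (g ≫ θ) ≫ d = 0 := by
  obtain ⟨τ, hτ, hτ1, hτ2⟩ := h.exists_parity
  have h1 := parity_eq hτ hτ1 hτ2 hU hθ hθ1
  -- Let u be the composite g ≫ θ. Both u and d u are fixed by τ, the latter by `hg`, so d u = τ(d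
  -- u) = -d(τ u) = -d u, and 2 is invertible.
  have h2 := P ◁ (g ≫ θ) ≫= h.parity_derivation hτ hτ1 hτ2 hd hd1 hd2
  rw [comp_zero, Preadditive.comp_add, ← MonoidalCategory.whiskerLeft_comp_assoc, Category.assoc,
    h1, reassoc_of% hg, h1, hg, ← two_smul ℚ, smul_eq_zero, or_iff_right two_ne_zero] at h2
  rw [hg, h2]

end IsWeil
end Centralizer
-- The symplectic form on P ⊗ L
section TensorForm
variable {C : Type u} [Category.{v} C] [MonoidalCategory C] [SymmetricCategory C] {A K : C}

/-- The maps `tensorδ` and `tensorμ` cancel in the middle, which leaves the triangle identities of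
the two factors side by side. -/
lemma tensorForm_left {c : 𝟙_ C ⟶ A ⊗ A} {e : A ⊗ A ⟶ 𝟙_ C} {c' : 𝟙_ C ⟶ K ⊗ K}
    {e' : K ⊗ K ⟶ 𝟙_ C} (h : c ▷ A ≫ (α_ A A A).hom ≫ A ◁ e = (λ_ A).hom ≫ (ρ_ A).inv)
    (h' : c' ▷ K ≫ (α_ K K K).hom ≫ K ◁ e' = (λ_ K).hom ≫ (ρ_ K).inv) :
    ((λ_ _).inv ≫ (c ⊗ₘ c') ≫ tensorδ A K A K) ▷ (A ⊗ K) ≫ (α_ _ _ _).hom ≫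
      (A ⊗ K) ◁ (tensorμ A K A K ≫ (e ⊗ₘ e') ≫ (λ_ _).hom) =
        (λ_ (A ⊗ K)).hom ≫ (ρ_ (A ⊗ K)).inv := by
  rw [← cancel_mono (ρ_ (A ⊗ K)).hom]
  simp only [Category.assoc, Iso.inv_hom_id, Category.comp_id]
  nth_rw 1 [tensor_right_unitality]
  have h1 : (α_ (A ⊗ K) (A ⊗ K) (A ⊗ K)).hom ≫ (A ⊗ K) ◁ tensorμ A K A K ≫
      tensorμ A K (A ⊗ A) (K ⊗ K) = _ := (tensor_associativity A K A K A K).symm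
  simp only [comp_whiskerRight, MonoidalCategory.whiskerLeft_comp, Category.assoc,
    whiskerLeft_hom_inv_assoc, tensorμ_natural_right_assoc, reassoc_of% h1]
  rw [← comp_whiskerRight_assoc (tensorδ A K A K), tensorδ_tensorμ, id_whiskerRight,
    Category.id_comp, tensorμ_natural_left_assoc]
  simp only [tensorHom_comp_tensorHom, reassoc_of% h, reassoc_of% h', Iso.inv_hom_id,
    Category.comp_id]
  rw [← tensor_left_unitality]

lemma tensorForm_right {c : 𝟙_ C ⟶ A ⊗ A} {e : A ⊗ A ⟶ 𝟙_ C} {c' : 𝟙_ C ⟶ K ⊗ K}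
    {e' : K ⊗ K ⟶ 𝟙_ C} (h : A ◁ c ≫ (α_ A A A).inv ≫ e ▷ A = (ρ_ A).hom ≫ (λ_ A).inv)
    (h' : K ◁ c' ≫ (α_ K K K).inv ≫ e' ▷ K = (ρ_ K).hom ≫ (λ_ K).inv) :
    (A ⊗ K) ◁ ((λ_ _).inv ≫ (c ⊗ₘ c') ≫ tensorδ A K A K) ≫ (α_ _ _ _).inv ≫
      (tensorμ A K A K ≫ (e ⊗ₘ e') ≫ (λ_ _).hom) ▷ (A ⊗ K) =
        (ρ_ (A ⊗ K)).hom ≫ (λ_ (A ⊗ K)).inv := by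
  rw [← cancel_mono (λ_ (A ⊗ K)).hom]
  simp only [Category.assoc, Iso.inv_hom_id, Category.comp_id]
  nth_rw 1 [tensor_left_unitality]
  have h1 : (α_ (A ⊗ K) (A ⊗ K) (A ⊗ K)).inv ≫ tensorμ A K A K ▷ (A ⊗ K) ≫
      tensorμ (A ⊗ A) (K ⊗ K) A K = (A ⊗ K) ◁ tensorμ A K A K ≫ tensorμ A K (A ⊗ A) (K ⊗ K) ≫
        ((α_ A A A).inv ⊗ₘ (α_ K K K).inv) := by
    rw [Iso.inv_comp_eq, ← reassoc_of% (tensor_associativity A K A K A K)]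
    simp [tensorHom_comp_tensorHom]
  simp only [comp_whiskerRight, MonoidalCategory.whiskerLeft_comp, Category.assoc,
    hom_inv_whiskerRight_assoc, tensorμ_natural_left_assoc, reassoc_of% h1]
  rw [← MonoidalCategory.whiskerLeft_comp_assoc _ (tensorδ A K A K), tensorδ_tensorμ,
    MonoidalCategory.whiskerLeft_id, Category.id_comp, tensorμ_natural_right_assoc]
  simp only [tensorHom_comp_tensorHom, reassoc_of% h, reassoc_of% h', Iso.inv_hom_id,
    Category.comp_id]
  rw [← tensor_right_unitality]

lemma exactPairing_left {X Y : C} [ExactPairing X Y] (f : Y ≅ X) :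
    (η_ X Y ≫ X ◁ f.hom) ▷ X ≫ (α_ X X X).hom ≫ X ◁ (f.inv ▷ X ≫ ε_ X Y) =
      (λ_ X).hom ≫ (ρ_ X).inv := by
  rw [← ExactPairing.evaluation_coevaluation X Y]
  simp only [comp_whiskerRight, MonoidalCategory.whiskerLeft_comp, Category.assoc,
    associator_naturality_middle_assoc]
  rw [← MonoidalCategory.whiskerLeft_comp_assoc X (f.hom ▷ X), hom_inv_whiskerRight]
  simp

lemma exactPairing_right {X Y : C} [ExactPairing X Y] (f : Y ≅ X) :
    X ◁ (η_ X Y ≫ X ◁ f.hom) ≫ (α_ X X X).inv ≫ (f.inv ▷ X ≫ ε_ X Y) ▷ X =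
      (ρ_ X).hom ≫ (λ_ X).inv := by
  have h := congrArg (fun t => f.inv ▷ 𝟙_ C ≫ t ≫ 𝟙_ C ◁ f.hom)
    (ExactPairing.coevaluation_evaluation X Y)
  simp only [Category.assoc, rightUnitor_naturality_assoc, ← leftUnitor_inv_naturality,
    Iso.inv_hom_id_assoc] at h
  rw [← h]
  simp only [comp_whiskerRight, MonoidalCategory.whiskerLeft_comp, Category.assoc]
  rw [← whisker_exchange_assoc, ← whisker_exchange, associator_inv_naturality_right_assoc,
    associator_inv_naturality_left_assoc, whisker_exchange_assoc]

end TensorForm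

section QuadraticForm
variable {C : Type u} [Category.{v} C] [Preadditive C] [MonoidalCategory C] [MonoidalPreadditive C]
  [SymmetricCategory C] [HasBinaryBiproducts C] {P : C} (hP : (β_ P P).hom = -𝟙 _) (e : P ⊗ P ⟶ 𝟙_ C) [IsIso e]

include hP in
-- An invertible pairing has its inverse as copairing, provided that the two ways of contracting P ⊗
-- P ⊗ P agree. This is where the sign of the braiding of P enters, through
-- `whiskerLeft_pairing_unitor`.
lemma inv_pairing_left : inv e ▷ P ≫ (α_ P P P).hom ≫ P ◁ e = (λ_ P).hom ≫ (ρ_ P).inv := by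
  rw [← cancel_mono (ρ_ P).hom]
  simp only [Category.assoc, whiskerLeft_pairing_unitor hP e, Iso.hom_inv_id_assoc,
    ← comp_whiskerRight_assoc, IsIso.inv_hom_id]
  simp

include hP in
lemma inv_pairing_right : P ◁ inv e ≫ (α_ P P P).inv ≫ e ▷ P = (ρ_ P).hom ≫ (λ_ P).inv := by
  rw [← cancel_mono (λ_ P).hom]
  simp only [Category.assoc, ← whiskerLeft_pairing_unitor hP e,
    ← MonoidalCategory.whiskerLeft_comp_assoc, IsIso.inv_hom_id]
  simp

variable (L : LieObj C) [q : QuadraticLieObj L]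

/-- The module `P ⊗ L`, where `L` acts by the adjoint action on the second factor. -/
abbrev oddAdjoint (P : C) (L : LieObj C) : LieMod L := (LieMod.trivial L).obj P ⊗ L.adjoint

/-- The symplectic form on `P ⊗ L` which is the tensor product of the pairing of `P` and of the
form of `L`. -/
def oddForm : SymplecticForm (oddAdjoint P L) :=
  letI := q.exactPairing
  let e' : (LieMod.trivial L).obj P ⊗ (LieMod.trivial L).obj P ⟶ 𝟙_ (LieMod L) :=
    ⟨e, (LieMod.zero_comm e).trans
      (congrArg (· ≫ e) (LieMod.trivial_tensor_act (L := L) P P).symm)⟩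
  let c : 𝟙_ C ⟶ P ⊗ P := inv e
  let c' : 𝟙_ (LieMod L) ⟶ (LieMod.trivial L).obj P ⊗ (LieMod.trivial L).obj P :=
    ⟨c, (congrArg (L.X ◁ c ≫ ·) (LieMod.trivial_tensor_act (L := L) P P)).trans
      (LieMod.zero_comm c)⟩
  { form := pairing e' (q.iso.inv ▷ L.adjoint ≫ ε_ L.adjoint q.dual) ≫ (λ_ _).hom
    coform := (λ_ _).inv ≫ (c' ⊗ₘ η_ L.adjoint q.dual ≫ L.adjoint ◁ q.iso.hom) ≫ tensorδ _ _ _ _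
    skew := by
      have h : (β_ _ _).hom ≫ e' = -e' := LieMod.hom_ext (by
        change (β_ P P).hom ≫ e = -e
        rw [hP]
        simp)
      rw [← Category.assoc, braiding_pairing, q.symm, h, pairing, pairing, neg_tensor',
        Preadditive.comp_neg, Preadditive.neg_comp]
    left_inv := by
      rw [pairing, Category.assoc]
      exact tensorForm_left (LieMod.hom_ext (inv_pairing_left hP e)) (exactPairing_left q.iso)
    right_inv := by
      rw [pairing, Category.assoc]
      exact tensorForm_right (LieMod.hom_ext (inv_pairing_right hP e)) (exactPairing_right q.iso) }

lemma oddAdjoint_act : (oddAdjoint P L).act = sw L.X P L.X ≫ P ◁ L.bracket := by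
  rw [← actR_eq_sw]
  change actL (0 : L.X ⊗ P ⟶ P) L.X + actR P L.bracket = actR P L.bracket
  rw [actL_zero, zero_add]

end QuadraticForm
-- Even and odd components of the double of L
section Double
open MonObj
variable {C : Type u} [Category.{v} C] [Preadditive C] [MonoidalCategory C] [MonoidalPreadditive C]
  [SymmetricCategory C] [HasBinaryBiproducts C] [Linear ℚ C]

section Components
variable (P G : C)

def evenIncl : G ⟶ (𝟙_ C ⊞ P) ⊗ G := (λ_ G).inv ≫ biprod.inl ▷ G
def oddIncl : P ⊗ G ⟶ (𝟙_ C ⊞ P) ⊗ G := biprod.inr ▷ G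
def evenProj : (𝟙_ C ⊞ P) ⊗ G ⟶ G := biprod.fst ▷ G ≫ (λ_ G).hom
def oddProj : (𝟙_ C ⊞ P) ⊗ G ⟶ P ⊗ G := biprod.snd ▷ G

lemma evenProj_comp_add : evenProj P G ≫ evenIncl P G + oddProj P G ≫ oddIncl P G = 𝟙 _ := by
  simp [evenProj, evenIncl, oddProj, oddIncl, ← comp_whiskerRight,
    ← MonoidalPreadditive.add_whiskerRight]

@[simp] lemma evenIncl_evenProj : evenIncl P G ≫ evenProj P G = 𝟙 _ := by
  simp [evenProj, evenIncl, ← comp_whiskerRight_assoc]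

@[simp] lemma oddIncl_oddProj : oddIncl P G ≫ oddProj P G = 𝟙 _ := by
  simp [oddProj, oddIncl, ← comp_whiskerRight]

@[simp] lemma evenIncl_oddProj : evenIncl P G ≫ oddProj P G = 0 := by
  simp [oddProj, evenIncl, ← comp_whiskerRight]

@[simp] lemma oddIncl_evenProj : oddIncl P G ≫ evenProj P G = 0 := by
  simp [evenProj, oddIncl, ← comp_whiskerRight_assoc]

variable {P G}

lemma hom_ext_double {X Y : C} {f g : ((𝟙_ C ⊞ P) ⊗ G) ⊗ X ⟶ Y}
    (h0 : evenIncl P G ▷ X ≫ f = evenIncl P G ▷ X ≫ g)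
    (h1 : oddIncl P G ▷ X ≫ f = oddIncl P G ▷ X ≫ g) : f = g := by
  have h : 𝟙 (((𝟙_ C ⊞ P) ⊗ G) ⊗ X) = evenProj P G ▷ X ≫ evenIncl P G ▷ X +
      oddProj P G ▷ X ≫ oddIncl P G ▷ X := by
    simp only [← comp_whiskerRight, ← MonoidalPreadditive.add_whiskerRight, evenProj_comp_add,
      id_whiskerRight]
  rw [← Category.id_comp f, ← Category.id_comp g, h]
  simp only [Preadditive.add_comp, Category.assoc, h0, h1]

lemma hom_ext_double_middle {X Y Z : C} {f g : Z ⊗ (((𝟙_ C ⊞ P) ⊗ G) ⊗ X) ⟶ Y}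
    (h0 : Z ◁ evenIncl P G ▷ X ≫ f = Z ◁ evenIncl P G ▷ X ≫ g)
    (h1 : Z ◁ oddIncl P G ▷ X ≫ f = Z ◁ oddIncl P G ▷ X ≫ g) : f = g := by
  rw [← cancel_epi (sw _ _ _)]
  refine hom_ext_double ?_ ?_
  · rw [reassoc_of% sw_naturality_left, reassoc_of% sw_naturality_left, h0]
  · rw [reassoc_of% sw_naturality_left, reassoc_of% sw_naturality_left, h1]

/-- The action of `(𝟙_ C ⊞ P) ⊗ G` with the given components. -/
def doubleAct {M : C} (x : G ⊗ M ⟶ M) (v : (P ⊗ G) ⊗ M ⟶ M) : ((𝟙_ C ⊞ P) ⊗ G) ⊗ M ⟶ M :=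
  evenProj P G ▷ M ≫ x + oddProj P G ▷ M ≫ v

lemma evenIncl_doubleAct {M : C} (x : G ⊗ M ⟶ M) (v : (P ⊗ G) ⊗ M ⟶ M) :
    evenIncl P G ▷ M ≫ doubleAct x v = x := by
  simp [doubleAct, ← comp_whiskerRight_assoc]

lemma oddIncl_doubleAct {M : C} (x : G ⊗ M ⟶ M) (v : (P ⊗ G) ⊗ M ⟶ M) :
    oddIncl P G ▷ M ≫ doubleAct x v = v := by
  simp [doubleAct, ← comp_whiskerRight_assoc]

lemma doubleAct_components {M : C} (b : ((𝟙_ C ⊞ P) ⊗ G) ⊗ M ⟶ M) :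
    doubleAct (evenIncl P G ▷ M ≫ b) (oddIncl P G ▷ M ≫ b) = b := by
  refine hom_ext_double ?_ ?_
  · rw [evenIncl_doubleAct]
  · rw [oddIncl_doubleAct]

lemma tensorHom_pairing {A A' K K' X Y X' Y' : C} (m : A ⊗ A ⟶ A') (n : K ⊗ K ⟶ K')
    (f : X ⟶ A) (g : Y ⟶ A) (f' : X' ⟶ K) (g' : Y' ⟶ K) :
    ((f ⊗ₘ f') ⊗ₘ (g ⊗ₘ g')) ≫ pairing m n =
      tensorμ X X' Y Y' ≫ ((f ⊗ₘ g) ≫ m ⊗ₘ (f' ⊗ₘ g') ≫ n) := by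
  rw [pairing, tensorμ_natural_assoc, tensorHom_comp_tensorHom]

lemma evenIncl_eq : evenIncl P G = (λ_ G).inv ≫ (biprod.inl ⊗ₘ 𝟙 G) := by
  simp [evenIncl]

lemma oddIncl_eq : oddIncl P G = biprod.inr ⊗ₘ 𝟙 G := by
  simp [oddIncl]

variable (b : G ⊗ G ⟶ G)

lemma inl_tensor_inl_mul : ((biprod.inl : 𝟙_ C ⟶ 𝟙_ C ⊞ P) ⊗ₘ (biprod.inl : 𝟙_ C ⟶ 𝟙_ C ⊞ P)) ≫
    dualNumbersMul P = (λ_ _).hom ≫ biprod.inl := by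
  apply biprod.hom_ext
  · simp [dualNumbersMul_fst]
  · simp [dualNumbersMul_snd]

lemma inl_tensor_inr_mul : ((biprod.inl : 𝟙_ C ⟶ 𝟙_ C ⊞ P) ⊗ₘ (biprod.inr : P ⟶ 𝟙_ C ⊞ P)) ≫
    dualNumbersMul P = (λ_ _).hom ≫ biprod.inr := by
  apply biprod.hom_ext
  · simp [dualNumbersMul_fst]
  · simp [dualNumbersMul_snd]

lemma inr_tensor_inr_mul : ((biprod.inr : P ⟶ 𝟙_ C ⊞ P) ⊗ₘ (biprod.inr : P ⟶ 𝟙_ C ⊞ P)) ≫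
    dualNumbersMul P = 0 := by
  apply biprod.hom_ext
  · simp [dualNumbersMul_fst]
  · simp [dualNumbersMul_snd]

lemma evenIncl_evenIncl_bracket :
    (evenIncl P G ⊗ₘ evenIncl P G) ≫ pairing (dualNumbersMul P) b = b ≫ evenIncl P G := by
  have h : ((λ_ G).inv ⊗ₘ (λ_ G).inv) ≫ tensorμ (𝟙_ C) G (𝟙_ C) G ≫
      ((λ_ (𝟙_ C)).hom ▷ (G ⊗ G)) = (λ_ (G ⊗ G)).inv := by
    rw [← cancel_mono (λ_ (G ⊗ G)).hom]
    simp only [Category.assoc, ← leftUnitor_monoidal, tensorHom_comp_tensorHom, Iso.inv_hom_id]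
    simp
  rw [evenIncl_eq, ← tensorHom_comp_tensorHom, Category.assoc, tensorHom_pairing,
    inl_tensor_inl_mul]
  simp only [MonoidalCategory.tensorHom_def, comp_whiskerRight, Category.assoc] at h ⊢
  rw [reassoc_of% h]
  simp only [id_whiskerRight, MonoidalCategory.whiskerLeft_id, Category.id_comp,
    Category.comp_id, ← whisker_exchange]
  rw [leftUnitor_inv_naturality_assoc]

lemma evenIncl_oddIncl_bracket :
    (evenIncl P G ⊗ₘ oddIncl P G) ≫ pairing (dualNumbersMul P) b =
      (sw G P G ≫ P ◁ b) ≫ oddIncl P G := by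
  have h : (λ_ G).inv ▷ (P ⊗ G) ≫ tensorμ (𝟙_ C) G P G ≫ (λ_ P).hom ▷ (G ⊗ G) = sw G P G := by
    simp [tensorμ, sw]
  rw [evenIncl_eq, oddIncl_eq, ← Category.id_comp (biprod.inr ⊗ₘ 𝟙 G),
    ← tensorHom_comp_tensorHom, Category.assoc, tensorHom_pairing, inl_tensor_inr_mul]
  simp only [MonoidalCategory.tensorHom_def, comp_whiskerRight, Category.assoc,
    MonoidalCategory.whiskerLeft_id, Category.id_comp, id_whiskerRight, ← h]
  simp [whisker_exchange]

lemma oddIncl_oddIncl_bracket :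
    (oddIncl P G ⊗ₘ oddIncl P G) ≫ pairing (dualNumbersMul P) b = 0 := by
  rw [oddIncl_eq, tensorHom_pairing, inr_tensor_inr_mul]
  simp

variable (e : P ⊗ P ⟶ 𝟙_ C) (k : G ⊗ G ⟶ 𝟙_ C)

lemma evenIncl_cocycle {Y : C} (f : Y ⟶ (𝟙_ C ⊞ P) ⊗ G) :
    (evenIncl P G ⊗ₘ f) ≫ pairing (topPairing e) k = 0 := by
  have h : evenIncl P G ▷ ((𝟙_ C ⊞ P) ⊗ G) ≫ pairing (topPairing e) k = 0 := by
    have h1 := tensorHom_pairing (topPairing e) k (biprod.inl : 𝟙_ C ⟶ 𝟙_ C ⊞ P) (𝟙 _) (𝟙 G) (𝟙 G)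
    rw [topPairing, tensorHom_comp_tensorHom_assoc, biprod.inl_snd] at h1
    simp only [tensorHom_id, id_whiskerRight, MonoidalPreadditive.zero_tensor, zero_comp,
      comp_zero] at h1
    rw [evenIncl, comp_whiskerRight, Category.assoc, topPairing, h1, comp_zero]
  rw [MonoidalCategory.tensorHom_def', Category.assoc, h, comp_zero]

lemma cocycle_evenIncl {Y : C} (f : Y ⟶ (𝟙_ C ⊞ P) ⊗ G) :
    (f ⊗ₘ evenIncl P G) ≫ pairing (topPairing e) k = 0 := by
  have h : ((𝟙_ C ⊞ P) ⊗ G) ◁ evenIncl P G ≫ pairing (topPairing e) k = 0 := by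
    have h1 := tensorHom_pairing (topPairing e) k (𝟙 _) (biprod.inl : 𝟙_ C ⟶ 𝟙_ C ⊞ P) (𝟙 G) (𝟙 G)
    rw [topPairing, tensorHom_comp_tensorHom_assoc, biprod.inl_snd] at h1
    simp only [tensorHom_id, id_tensorHom, id_whiskerRight, MonoidalPreadditive.tensor_zero,
      MonoidalPreadditive.zero_tensor, zero_comp, comp_zero] at h1
    rw [evenIncl, MonoidalCategory.whiskerLeft_comp, Category.assoc, topPairing, h1, comp_zero]
  rw [MonoidalCategory.tensorHom_def, Category.assoc, h, comp_zero]

lemma oddIncl_oddIncl_cocycle :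
    (oddIncl P G ⊗ₘ oddIncl P G) ≫ pairing (topPairing e) k = pairing e k := by
  rw [oddIncl_eq, tensorHom_pairing, topPairing]
  simp [pairing]

end Components

section Weil
variable {P : C} (hP : (β_ P P).hom = -𝟙 _) (e : P ⊗ P ⟶ 𝟙_ C) [IsIso e] (L : LieObj C)
  [QuadraticLieObj L]

/-- The bracket of `(𝟙_ C ⊞ P) ⊗ L`. -/
abbrev doubleBracket (P : C) (L : LieObj C) :
    ((𝟙_ C ⊞ P) ⊗ L.X) ⊗ ((𝟙_ C ⊞ P) ⊗ L.X) ⟶ (𝟙_ C ⊞ P) ⊗ L.X :=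
  pairing (dualNumbersMul P) L.bracket

/-- The cocycle of `(𝟙_ C ⊞ P) ⊗ L`. -/
abbrev doubleCocycle : ((𝟙_ C ⊞ P) ⊗ L.X) ⊗ ((𝟙_ C ⊞ P) ⊗ L.X) ⟶ 𝟙_ C :=
  pairing (topPairing e) (QuadraticLieObj.form L) ≫ (λ_ _).hom

variable {e L} in
lemma icomm_double {M X Y : C} {b : ((𝟙_ C ⊞ P) ⊗ L.X) ⊗ M ⟶ M}
    (hb : IsCurved (doubleBracket P L) (doubleCocycle e L) b) (f : X ⟶ (𝟙_ C ⊞ P) ⊗ L.X)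
    (g : Y ⟶ (𝟙_ C ⊞ P) ⊗ L.X) :
    icomm (f ▷ M ≫ b) (g ▷ M ≫ b) (g ▷ M ≫ b) =
      opw ((f ⊗ₘ g) ≫ doubleBracket P L) M ≫ b + opi ((f ⊗ₘ g) ≫ doubleCocycle e L) M := by
  rw [icomm_whisker, hb, opw_whisker, opi_whisker]
  simp only [Preadditive.comp_add, Category.assoc]

variable {L}

/-- The even part is the subalgebra L, which acts on the odd part P ⊗ L by the adjoint action; the
odd part is abelian, and the cocycle lives on it alone. Of the four components of the curvature, the
odd-even one follows from the even-odd one by skew-symmetry. -/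
lemma isCurved_double_iff {M : C} (b : ((𝟙_ C ⊞ P) ⊗ L.X) ⊗ M ⟶ M) :
    IsCurved (doubleBracket P L) (doubleCocycle e L) b ↔
      IsCurved L.bracket 0 (evenIncl P L.X ▷ M ≫ b) ∧
      icomm (evenIncl P L.X ▷ M ≫ b) (oddIncl P L.X ▷ M ≫ b) (oddIncl P L.X ▷ M ≫ b) =
        opw (sw L.X P L.X ≫ P ◁ L.bracket) M ≫ oddIncl P L.X ▷ M ≫ b ∧
      IsCurved 0 (pairing e (QuadraticLieObj.form L) ≫ (λ_ _).hom) (oddIncl P L.X ▷ M ≫ b) := by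
  have c0 : ∀ {Y : C} (f : Y ⟶ (𝟙_ C ⊞ P) ⊗ L.X),
      (evenIncl P L.X ⊗ₘ f) ≫ doubleCocycle e L = 0 := by
    intro Y f
    rw [doubleCocycle, reassoc_of% (evenIncl_cocycle e (QuadraticLieObj.form L)), zero_comp]
  have c10 : (oddIncl P L.X ⊗ₘ evenIncl P L.X) ≫ doubleCocycle e L = 0 := by
    rw [doubleCocycle, reassoc_of% (cocycle_evenIncl e (QuadraticLieObj.form L)), zero_comp]
  have c11 : (oddIncl P L.X ⊗ₘ oddIncl P L.X) ≫ doubleCocycle e L =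
      pairing e (QuadraticLieObj.form L) ≫ (λ_ _).hom := by
    rw [doubleCocycle, reassoc_of% (oddIncl_oddIncl_cocycle e (QuadraticLieObj.form L))]
  have b00 : (evenIncl P L.X ⊗ₘ evenIncl P L.X) ≫ doubleBracket P L =
      L.bracket ≫ evenIncl P L.X := evenIncl_evenIncl_bracket L.bracket
  have b01 : (evenIncl P L.X ⊗ₘ oddIncl P L.X) ≫ doubleBracket P L =
      (sw L.X P L.X ≫ P ◁ L.bracket) ≫ oddIncl P L.X := evenIncl_oddIncl_bracket L.bracket
  have b10 : (oddIncl P L.X ⊗ₘ evenIncl P L.X) ≫ doubleBracket P L =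
      -((β_ _ _).hom ≫ (sw L.X P L.X ≫ P ◁ L.bracket) ≫ oddIncl P L.X) := by
    have h := (LieObj.extendScalars (𝟙_ C ⊞ P) L).skew
    change (β_ _ _).hom ≫ doubleBracket P L = -doubleBracket P L at h
    rw [← b01, ← BraidedCategory.braiding_naturality_assoc, h, Preadditive.comp_neg, neg_neg]
  have b11 : (oddIncl P L.X ⊗ₘ oddIncl P L.X) ≫ doubleBracket P L = 0 :=
    oddIncl_oddIncl_bracket L.bracket
  constructor
  · intro hb
    refine ⟨?_, ?_, ?_⟩
    · rw [IsCurved, icomm_double hb, c0, b00, opw_comp, Category.assoc]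
    · rw [icomm_double hb, c0, b01, opw_comp, opi_zero, add_zero, Category.assoc]
    · rw [IsCurved, icomm_double hb, c11, b11, opw_zero, opw_zero, zero_comp, zero_comp]
  · rintro ⟨h00, h01, h11⟩
    have key : ∀ {X Y : C} (f : X ⟶ (𝟙_ C ⊞ P) ⊗ L.X) (g : Y ⟶ (𝟙_ C ⊞ P) ⊗ L.X),
        icomm (f ▷ M ≫ b) (g ▷ M ≫ b) (g ▷ M ≫ b) =
          opw ((f ⊗ₘ g) ≫ doubleBracket P L) M ≫ b + opi ((f ⊗ₘ g) ≫ doubleCocycle e L) M →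
        X ◁ g ▷ M ≫ f ▷ (_ ⊗ M) ≫ icomm b b b = X ◁ g ▷ M ≫ f ▷ (_ ⊗ M) ≫
          (opw (doubleBracket P L) M ≫ b + opi (doubleCocycle e L) M) := by
      intro X Y f g hfg
      rw [icomm_whisker, opw_whisker, opi_whisker] at hfg
      rw [hfg]
      simp only [Preadditive.comp_add, Category.assoc]
    rw [IsCurved] at h00 h11
    refine hom_ext_double ?_ ?_ <;> refine hom_ext_double_middle ?_ ?_
    · refine key _ _ ?_
      rw [h00, c0, b00, opw_comp, Category.assoc]
    · refine key _ _ ?_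
      rw [h01, c0, b01, opi_zero, add_zero]
      simp only [opw_comp, comp_whiskerRight, Category.assoc]
    · refine key _ _ ?_
      rw [icomm_swap, h01, c10, b10, opw_neg, ← sw_opw, opi_zero, add_zero,
        Preadditive.neg_comp]
      simp only [opw_comp, comp_whiskerRight, Category.assoc]
    · refine key _ _ ?_
      rw [h11, c11, b11, opw_zero, opw_zero, zero_comp, zero_comp]

lemma weilRel_iff {M : C} (b : ((𝟙_ C ⊞ P) ⊗ L.X) ⊗ M ⟶ M) :
    IsCurved (doubleBracket P L) (doubleCocycle e L) b ↔
      WeilRel (oddForm hP e L) (evenIncl P L.X ▷ M ≫ b) (oddIncl P L.X ▷ M ≫ b) := by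
  have h0 : ∀ x : L.X ⊗ ((P ⊗ L.X) ⊗ M) ⟶ M, x = opw (oddAdjoint P L).act M ≫
      oddIncl P L.X ▷ M ≫ b ↔ x = opw (sw L.X P L.X ≫ P ◁ L.bracket) M ≫
      oddIncl P L.X ▷ M ≫ b := by
    intro x
    rw [oddAdjoint_act]
    rfl
  rw [isCurved_double_iff]
  exact ⟨fun h => ⟨h.1, (h0 _).2 h.2.1, h.2.2⟩, fun h => ⟨h.lie, (h0 _).1 h.act, h.weyl⟩⟩

/-- The algebra generated by `(𝟙_ C ⊞ P) ⊗ L` with the relations of the unital enveloping algebra is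
the Weil algebra of `P ⊗ L`. -/
lemma FreeOn.isWeil {A : C} [MonObj A] {j : (𝟙_ C ⊞ P) ⊗ L.X ⟶ A}
    (h : FreeOn (doubleBracket P L) (doubleCocycle e L) A j) :
    IsWeil (oddForm hP e L) A (evenIncl P L.X ≫ j) (oddIncl P L.X ≫ j) := by
  have e0 : lmul (evenIncl P L.X ≫ j) = evenIncl P L.X ▷ A ≫ lmul j := by
    simp [lmul]
  have e1 : lmul (oddIncl P L.X ≫ j) = oddIncl P L.X ▷ A ≫ lmul j := by
    simp [lmul]
  have hw : ∀ {M : C} {x x' : L.X ⊗ M ⟶ M} {v v' : (P ⊗ L.X) ⊗ M ⟶ M}, x = x' → v = v' →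
      WeilRel (oddForm hP e L) x v → WeilRel (oddForm hP e L) x' v' := by
    rintro M x _ v _ rfl rfl h
    exact h
  refine ⟨hw e0.symm e1.symm ((weilRel_iff hP e _).1 h.curved), ?_, ?_⟩
  · intro M x (v : (P ⊗ L.X) ⊗ M ⟶ M) hxv m
    obtain ⟨F, h1, h2⟩ := h.exists_ext' (doubleAct x v) ((weilRel_iff hP e _).2
      (hw (evenIncl_doubleAct x v).symm (oddIncl_doubleAct x v).symm hxv)) m
    have h3 : lmul (oddIncl P L.X ≫ j) ≫ F = (P ⊗ L.X) ◁ F ≫ v := by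
      rw [e1, Category.assoc, h1, ← whisker_exchange_assoc, oddIncl_doubleAct]
    refine ⟨F, ?_, h3, h2⟩
    rw [e0, Category.assoc, h1, ← whisker_exchange_assoc, evenIncl_doubleAct]
  · intro K M x (v : (P ⊗ L.X) ⊗ M ⟶ M) F h0 (h1 : icomm F (lmul (oddIncl P L.X ≫ j)) v = 0) h2
    refine h.generates.eq_zero (doubleAct x v) ?_ h2
    rw [← doubleAct_components (lmul j), ← e0, ← e1, doubleAct, doubleAct, icomm_add_right]
    have w : ∀ {X Y : C} (g : X ⟶ Y) (a : Y ⊗ A ⟶ A) (c : Y ⊗ M ⟶ M), icomm F a c = 0 →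
        icomm F (g ▷ A ≫ a) (g ▷ M ≫ c) = 0 := by
      intro X Y g a c hc
      have := icomm_whisker (𝟙 K) g F a c
      simpa [hc] using this
    rw [w _ _ _ h0, w _ _ _ h1, add_zero]

end Weil
end Double
-- From algebras in C to algebras in Mod(Q)
section Forget
open MonObj
variable {C : Type u} [Category.{v} C] [Preadditive C] [MonoidalCategory C] [MonoidalPreadditive C]
  [SymmetricCategory C] {Q : LieObj C}

/-- The algebra underlying an algebra in the category of modules. -/
instance LieMod.monObjX (A : LieMod Q) [MonObj A] : MonObj A.X where
  one := η[A].hom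
  mul := μ[A].hom
  one_mul := congrArg LieMod.Hom.hom (MonObj.one_mul A)
  mul_one := congrArg LieMod.Hom.hom (MonObj.mul_one A)
  mul_assoc := congrArg LieMod.Hom.hom (MonObj.mul_assoc A)

lemma LieMod.opw_comm {M N K : LieMod Q} (f : M ⊗ N ⟶ K) (Z : C) :
    Q.X ◁ opw f.hom Z ≫ opw K.act Z =
      (opw M.act (N.X ⊗ Z) + sw Q.X M.X (N.X ⊗ Z) ≫ M.X ◁ opw N.act Z) ≫ opw f.hom Z := by
  have h : Q.X ◁ f.hom ≫ K.act = (actL M.act N.X + actR M.X N.act) ≫ f.hom := f.comm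
  have h1 := (Q.X ◁ (α_ M.X N.X Z).inv ≫ (α_ _ _ _).inv) ≫= congrArg (fun t => t ▷ Z) h
  rw [actR_eq_sw] at h1
  simpa [-LieMod.Hom.comm, opw, actL, sw, Preadditive.add_comp] using h1

lemma LieMod.opi_comm {M N : LieMod Q} (f : M ⊗ N ⟶ 𝟙_ (LieMod Q)) (Z : C) :
    (opw M.act (N.X ⊗ Z) + sw Q.X M.X (N.X ⊗ Z) ≫ M.X ◁ opw N.act Z) ≫ opi f.hom Z = 0 := by
  have h := opw_comm f Z
  change _ ≫ opw (0 : Q.X ⊗ 𝟙_ C ⟶ 𝟙_ C) Z = _ at h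
  rw [opw_zero, comp_zero] at h
  have h1 := congrArg (· ≫ (λ_ Z).hom) h.symm
  simp only [Category.assoc, zero_comp] at h1
  exact h1

variable (X : LieMod Q) {A : C} [MonObj A] (j : X.X ⟶ A)

/-- The action `Q` on the generators of the algebra `A` extends to `A`. -/
lemma FreeOn.exists_module_derivation [HasBinaryBiproducts C] {br : X ⊗ X ⟶ X}
    {ω : X ⊗ X ⟶ 𝟙_ (LieMod Q)} (h : FreeOn br.hom ω.hom A j) :
    ∃ d : Q.X ⊗ A ⟶ A, icomm d (lmul j) (lmul j) = opw X.act A ≫ lmul j ∧ Q.X ◁ η[A] ≫ d = 0 := by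
  let l := lmul j
  have hl : X.X ◁ l ≫ l = sw X.X X.X A ≫ X.X ◁ l ≫ l + (opw br.hom A ≫ l + opi ω.hom A) :=
    icomm_eq_iff.1 h.curved
  obtain ⟨d, h1, h2⟩ := h.exists_derivation (K := Q.X) l h.curved
    (sw X.X Q.X A ≫ opw X.act A ≫ l) (by
      -- T is the expression (q x) y a + x (q y) a prescribed by the Leibniz rule. It respects the
      -- relations because br and ω are morphisms of Q-modules; ω contributes nothing, as Q acts by
      -- zero on the unit. The map Φ moves q next to a, the order used in `exists_derivation`.
      let T := opw X.act (X.X ⊗ A) ≫ X.X ◁ l ≫ l +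
        sw Q.X X.X (X.X ⊗ A) ≫ X.X ◁ opw X.act A ≫ X.X ◁ l ≫ l
      let Φ := sw Q.X X.X (X.X ⊗ A) ≫ X.X ◁ sw Q.X X.X A
      have hT : T = Q.X ◁ sw X.X X.X A ≫ T + Q.X ◁ opw br.hom A ≫ opw X.act A ≫ l := by
        have e1 := opw X.act (X.X ⊗ A) ≫= hl
        have e2 := (sw Q.X X.X (X.X ⊗ A) ≫ X.X ◁ opw X.act A) ≫= hl
        have e3 := congrArg (· ≫ l) (LieMod.opw_comm br A)
        have e4 := LieMod.opi_comm ω A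
        simp only [Preadditive.comp_add, Preadditive.add_comp, Category.assoc] at e1 e2 e3 e4
        rw [reassoc_of% (opw_sw X.act X.X A)] at e1
        rw [reassoc_of% (whiskerLeft_opw_sw X.X X.act A), sw_sw_assoc] at e2
        simp only [T, Preadditive.comp_add]
        refine (congrArg₂ (· + ·) e1 e2).trans ?_
        rw [e3, ← sub_eq_zero, ← e4]
        abel
      have hΦ : ∀ {Z : C} (t : X.X ⊗ (X.X ⊗ (Q.X ⊗ A)) ⟶ Z),
          Φ ≫ sw X.X X.X (Q.X ⊗ A) ≫ t = Q.X ◁ sw X.X X.X A ≫ Φ ≫ t := by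
        intro Z t
        have := sw_braid Q.X X.X X.X A
        simp only [Φ, Category.assoc]
        rw [reassoc_of% this]
      have hΦT : Φ ≫ (X.X ◁ (sw X.X Q.X A ≫ Q.X ◁ l) ≫ sw X.X Q.X A ≫ opw X.act A ≫ l +
          X.X ◁ (sw X.X Q.X A ≫ opw X.act A ≫ l) ≫ l) = T := by
        simp only [Φ, T, Preadditive.comp_add, MonoidalCategory.whiskerLeft_comp, Category.assoc,
          whiskerLeft_sw_sw_assoc]
        rw [sw_naturality_assoc, sw_sw_assoc, reassoc_of% (opw_naturality X.act l)]
      have hΦb : Φ ≫ opw br.hom (Q.X ⊗ A) ≫ sw X.X Q.X A ≫ opw X.act A ≫ l =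
          Q.X ◁ opw br.hom A ≫ opw X.act A ≫ l := by
        have := whiskerLeft_opw_sw Q.X br.hom A
        simp only [Φ, Category.assoc]
        rw [← reassoc_of% this, sw_sw_assoc]
      rw [← cancel_epi Φ, Preadditive.comp_sub, hΦ, hΦT, hΦb, sub_eq_iff_eq_add']
      exact hT)
  exact ⟨d, by rw [h1, sw_sw_assoc], h2⟩

variable {X j}
variable {d : Q.X ⊗ A ⟶ A} (hj : Generates A j)
  (hd : icomm d (lmul j) (lmul j) = opw X.act A ≫ lmul j) (hd1 : Q.X ◁ η[A] ≫ d = 0)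
include hj hd hd1

/-- The difference between the commutator of d with itself and the derivation given by the bracket
of Q commutes with the generators, since X is a Q-module, and it kills the unit. -/
lemma Generates.isCurved_derivation : IsCurved Q.bracket 0 d := by
  rw [IsCurved, opi_zero, add_zero, ← sub_eq_zero]
  have hQ : Q.X ◁ opw X.act A ≫ opw X.act A =
      sw Q.X Q.X (X.X ⊗ A) ≫ Q.X ◁ opw X.act A ≫ opw X.act A + opw Q.bracket (X.X ⊗ A) ≫ opw X.act A := by
    have := (SymplecticForm.isCurved_act X).opw A
    rw [IsCurved, opi_zero, add_zero] at this
    exact icomm_eq_iff.1 this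
  have hd' : Q.X ◁ lmul j ≫ d = sw Q.X X.X A ≫ X.X ◁ d ≫ lmul j + opw X.act A ≫ lmul j := icomm_eq_iff.1 hd
  refine hj.eq_zero₂ (lmul j) ?_ ?_
  · rw [Preadditive.comp_sub, whiskerLeft_icomm_of_derivations hd hd,
      reassoc_of% (opw_naturality Q.bracket (lmul j)), hd', whiskerLeft_sub', Preadditive.sub_comp,
      Preadditive.comp_sub, Preadditive.comp_sub]
    have e1 := congrArg (· ≫ lmul j) hQ
    simp only [Preadditive.add_comp, Category.assoc] at e1
    simp only [MonoidalCategory.whiskerLeft_comp, Category.assoc, Preadditive.comp_add, hd',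
      reassoc_of% (whiskerLeft_opw_sw Q.X X.act A),
      ← reassoc_of% (opw_naturality X.act d), sw_sw_assoc, reassoc_of% (opw_sw Q.bracket X.X A)]
    nth_rw 1 [e1]
    abel
  · rw [Preadditive.comp_sub, reassoc_of% (opw_naturality Q.bracket η[A]), hd1, comp_zero, sub_zero,
      icomm, Preadditive.comp_sub, sw_naturality_assoc, ← MonoidalCategory.whiskerLeft_comp_assoc,
      hd1]
    simp

/-- Both sides have the same commutator with the generators and agree on Y. This gives the Leibniz
rule for the multiplication and the equivariance of linear extensions. -/
lemma Generates.derivation_ext {Y M : C} {y : Q.X ⊗ Y ⟶ Y} {m : Q.X ⊗ M ⟶ M} {b : X.X ⊗ M ⟶ M}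
    (hb : icomm m b b = opw X.act M ≫ b) {F : A ⊗ Y ⟶ M} {f : Y ⟶ M}
    (hF : opw (lmul j) Y ≫ F = X.X ◁ F ≫ b) (hF1 : η[A] ▷ Y ≫ F = (λ_ Y).hom ≫ f)
    (hf : Q.X ◁ f ≫ m = y ≫ f) : Q.X ◁ F ≫ m = (actL d Y + actR A y) ≫ F := by
  refine hj.ext_tensor b ?_ ?_
  · rw [icomm_whiskerLeft_comp _ hF, hb, icomm_comp_right _ hF, icomm_add_left, actR_eq_sw,
      actL_eq_opw, icomm_sw_opw, icomm_tensor, hd, add_zero, opw_comp,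
      reassoc_of% (opw_naturality X.act F), ← hF]
    simp [opw]
  · rw [← MonoidalCategory.whiskerLeft_comp_assoc, hF1, Preadditive.add_comp,
      Preadditive.comp_add, MonoidalCategory.whiskerLeft_comp_assoc, hf, actR_eq_sw, Category.assoc,
      reassoc_of% (sw_naturality_middle Q.X η[A] Y), ← whisker_exchange_assoc, hF1, actL,
      Category.assoc, associator_inv_naturality_middle_assoc, ← comp_whiskerRight_assoc, hd1]
    simp [sw]

omit hj hd hd1 in
/-- The algebra generated by a module with invariant relations, as an algebra in the category of
modules. -/
theorem FreeOn.exists_module [HasBinaryBiproducts C] {br : X ⊗ X ⟶ X}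
    {ω : X ⊗ X ⟶ 𝟙_ (LieMod Q)} (h : FreeOn br.hom ω.hom A j) :
    ∃ (A' : Mon (LieMod Q)) (j' : X ⟶ A'.X), FreeOn br ω A'.X j' ∧
      FreeOn br.hom ω.hom A'.X.X j'.hom := by
  obtain ⟨d, hd, hd1⟩ := h.exists_module_derivation
  have hc := h.generates.isCurved_derivation hd hd1
  rw [IsCurved, opi_zero, add_zero] at hc
  let M : LieMod Q :=
    { X := A
      act := d
      bracket_act := by
        have h1 := (α_ Q.X Q.X A).hom ≫= hc
        simp only [opw, Category.assoc, Iso.hom_inv_id_assoc] at h1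
        rw [← h1, icomm]
        simp [sw] }
  have hmul : Q.X ◁ μ[A] ≫ d = (actL d A + actR A d) ≫ μ[A] :=
    h.generates.derivation_ext hd hd1 hd (f := 𝟙 A)
      (by
        simp only [opw, lmul, comp_whiskerRight, Category.assoc, MonObj.mul_assoc]
        rw [whisker_exchange_assoc]
        simp) (by simp) (by simp)
  let _ : MonObj M :=
    { one := ⟨η[A], hd1.trans zero_comp.symm⟩
      mul := ⟨μ[A], hmul⟩
      one_mul := LieMod.hom_ext (MonObj.one_mul A)
      mul_one := LieMod.hom_ext (MonObj.mul_one A)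
      mul_assoc := LieMod.hom_ext (MonObj.mul_assoc A) }
  -- This is the commutation rule of d with the generators, evaluated at the unit.
  have hjd : Q.X ◁ j ≫ d = X.act ≫ j := by
    have h1 := (Q.X ◁ (ρ_ X.X).inv ≫ Q.X ◁ X.X ◁ η[A]) ≫= icomm_eq_iff.1 hd
    simp only [Preadditive.comp_add, Category.assoc] at h1
    rw [sw_naturality_assoc, ← MonoidalCategory.whiskerLeft_comp_assoc X.X (Q.X ◁ η[A]), hd1,
      reassoc_of% (opw_naturality X.act η[A]), whiskerLeft_one_lmul,
      ← MonoidalCategory.whiskerLeft_comp_assoc, ← MonoidalCategory.whiskerLeft_comp_assoc,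
      Category.assoc, whiskerLeft_one_lmul] at h1
    simpa [opw] using h1
  let j' : X ⟶ M := ⟨j, hjd⟩
  refine ⟨⟨M⟩, j', ⟨LieMod.hom_ext h.curved, ?_, ?_⟩, h⟩
  · intro Y N b F h1 h2
    exact LieMod.hom_ext (h.generates Y.X N.X b.hom F.hom (congrArg LieMod.Hom.hom h1)
      (congrArg LieMod.Hom.hom h2))
  · intro Y N b hb f
    -- The extension exists in C; it is automatically a morphism of Q-modules.
    obtain ⟨F, hF, hF1⟩ := h.exists_ext Y.X N.X b.hom (congrArg LieMod.Hom.hom hb) f.hom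
    have hb' : icomm N.act b.hom b.hom = opw X.act N.X ≫ b.hom := by
      have h1 : Q.X ◁ b.hom ≫ N.act = (actL X.act N.X + actR X.X N.act) ≫ b.hom := b.comm
      rw [icomm_eq_iff, h1, actL_eq_opw, actR_eq_sw, Preadditive.add_comp, add_comm,
        Category.assoc]
    have hF2 := h.generates.derivation_ext hd hd1 hb' hF hF1 f.comm
    exact ⟨⟨F, hF2⟩, LieMod.hom_ext hF, LieMod.hom_ext hF1⟩

end Forget
-- The unital enveloping algebra in Mod(L)
section Central
open MonObj
variable {C : Type u} [Category.{v} C] [Preadditive C] [MonoidalCategory C] [MonoidalPreadditive C]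
  [SymmetricCategory C]

lemma icomm_lmul_of_derivation {K Y A : C} [MonObj A] {d : K ⊗ A ⟶ A} (g : Y ⟶ A)
    (hd : K ◁ μ[A] ≫ d = (actL d A + actR A d) ≫ μ[A]) :
    icomm d (lmul g) (lmul g) = opw (K ◁ g ≫ d) A ≫ μ[A] := by
  rw [icomm_eq_iff, lmul, MonoidalCategory.whiskerLeft_comp, Category.assoc, hd,
    Preadditive.add_comp, Preadditive.comp_add, reassoc_of% (actR_whiskerRight d g), actR_eq_sw,
    add_comm]
  simp [actL, opw]

variable [HasBinaryBiproducts C] {L : LieObj C} {ω : L.X ⊗ L.X ⟶ 𝟙_ C} {A : C} [MonObj A]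
  {j : L.X ⟶ A} (hj : (j ⊗ₘ j) ≫ commutator A = L.bracket ≫ j + ω ≫ η[A])

/-- An algebra `A` with a map `j : L ⟶ A` such that `[j x, j y] = j [x, y] + ω(x, y)`, with the
adjoint action of `L`, as an algebra in the category of `L`-modules. -/
def curvedAdjointAlgebra : Mon (LieMod L) where
  X :=
    { X := A
      act := adop j
      bracket_act := by
        have h1 := icomm_adop_adop j j
        have h2 : opw (ω ≫ η[A]) A ≫ commutator A = 0 := by
          rw [opw, comp_whiskerRight, Category.assoc, Category.assoc,
            unit_whiskerRight_commutator, comp_zero, comp_zero]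
        rw [hj, opw_add, Preadditive.add_comp, h2, add_zero] at h1
        have h3 := (α_ L.X L.X A).hom ≫= h1
        simp only [opw, Category.assoc, Iso.hom_inv_id_assoc, comp_whiskerRight] at h3
        rw [adop, ← h3, icomm]
        simp [sw, adop] }
  mon :=
    { one := ⟨η[A], (whiskerLeft_one_adop j).trans zero_comp.symm⟩
      mul := ⟨μ[A], by
        change L.X ◁ μ[A] ≫ j ▷ A ≫ commutator A =
          (actL (j ▷ A ≫ commutator A) A + actR A (j ▷ A ≫ commutator A)) ≫ μ[A]
        rw [whisker_exchange_assoc, whiskerLeft_mul_commutator, Preadditive.comp_add,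
          Preadditive.add_comp]
        congr 1
        · simp [actL]
        · simp only [actR, swapFst, Category.assoc, MonoidalCategory.whiskerLeft_comp]
          rw [associator_inv_naturality_left_assoc, ← comp_whiskerRight_assoc,
            BraidedCategory.braiding_naturality_left, comp_whiskerRight_assoc,
            associator_naturality_middle_assoc]⟩
      one_mul := LieMod.hom_ext (MonObj.one_mul A)
      mul_one := LieMod.hom_ext (MonObj.mul_one A)
      mul_assoc := LieMod.hom_ext (MonObj.mul_assoc A) }

/-- The map from the central extension of `L` to the algebra `A`. -/
def centralExtensionDesc (h : LieObj.IsCocycle L ω) :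
    (LieObj.centralExtension L ω h).X ⟶ (curvedAdjointAlgebra hj).X :=
  ⟨biprod.desc η[A] j, by
    change L.X ◁ biprod.desc η[A] j ≫ adop j = LieObj.extAct L ω ≫ biprod.desc η[A] j
    rw [LieObj.extAct, Category.assoc, biprod.lift_desc, add_comm, ← hj, biprod.desc_eq,
      MonoidalPreadditive.whiskerLeft_add, Preadditive.add_comp,
      MonoidalCategory.whiskerLeft_comp_assoc, whiskerLeft_one_adop, comp_zero, zero_add,
      MonoidalCategory.whiskerLeft_comp_assoc, MonoidalCategory.tensorHom_def', Category.assoc]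
    rfl⟩

/-- A unital Lie morphism out of the central extension is determined by its restriction f₁ to L,
which satisfies [f₁ x, f₁ y] = f₁ [x, y] + ω(x, y). Freeness of A in C gives the morphism of
algebras; what remains is its L-equivariance. -/
theorem FreeOn.isUnitalEnvelopingAlgebra (h : LieObj.IsCocycle L ω)
    (hA : FreeOn L.bracket ω A j) :
    IsUnitalEnvelopingAlgebra (LieObj.centralExtension L ω h) (curvedAdjointAlgebra hj)
      (centralExtensionDesc hj h) where
  isLieHom := LieMod.hom_ext (by
    change LieObj.extBracket L ω ≫ biprod.desc η[A] j =
      (biprod.desc η[A] j ⊗ₘ biprod.desc η[A] j) ≫ commutator A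
    have h1 : ∀ {Y : C} (f : Y ⟶ A), (η[A] ⊗ₘ f) ≫ commutator A = 0 := by
      intro Y f
      rw [MonoidalCategory.tensorHom_def', Category.assoc, unit_whiskerRight_commutator, comp_zero]
    have h2 : ∀ {Y : C} (f : Y ⟶ A), (f ⊗ₘ η[A]) ≫ commutator A = 0 := by
      intro Y f
      rw [MonoidalCategory.tensorHom_def, Category.assoc, one_commutator, comp_zero]
    rw [LieObj.extBracket, Category.assoc, biprod.lift_desc, add_comm, ← hj, biprod.desc_eq]
    simp only [MonoidalPreadditive.add_tensor, MonoidalPreadditive.tensor_add,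
      Preadditive.add_comp, ← tensorHom_comp_tensorHom, Category.assoc, h1, h2, comp_zero,
      zero_add])
  unit_comp := LieMod.hom_ext (biprod.inl_desc _ _)
  existsUnique B f hf hf1 := by
    let φ : 𝟙_ C ⊞ L.X ⟶ B.X.X := f.hom
    let f₁ : L.X ⟶ B.X.X := biprod.inr ≫ φ
    have hη : biprod.inl ≫ φ = η[B.X.X] :=
      congrArg LieMod.Hom.hom hf1
    have hdesc : φ = biprod.desc η[B.X.X] f₁ := by
      apply biprod.hom_ext'
      · exact hη.trans (biprod.inl_desc _ _).symm
      · exact (biprod.inr_desc _ _).symm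
    have hc : (f₁ ⊗ₘ f₁) ≫ commutator B.X.X = L.bracket ≫ f₁ + ω ≫ η[B.X.X] := by
      have h1 : LieObj.extBracket L ω ≫ φ = (φ ⊗ₘ φ) ≫ commutator B.X.X :=
        congrArg LieMod.Hom.hom hf
      have h2 := (biprod.inr ⊗ₘ biprod.inr) ≫= h1
      rw [LieObj.extBracket, Category.assoc, tensorHom_comp_tensorHom_assoc, hdesc,
        biprod.lift_desc, tensorHom_comp_tensorHom_assoc, biprod.inr_desc, biprod.inr_snd,
        id_tensorHom_id, Category.id_comp] at h2
      rw [← h2, add_comm]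
    -- Since f is equivariant, L acts on the image of f₁ by commutators.
    have hl : L.X ◁ f₁ ≫ B.X.act = (f₁ ⊗ₘ f₁) ≫ commutator B.X.X := by
      have h1 : L.X ◁ φ ≫ B.X.act = LieObj.extAct L ω ≫ φ := f.comm
      rw [hc, show L.X ◁ f₁ = L.X ◁ (biprod.inr ≫ φ) from rfl, MonoidalCategory.whiskerLeft_comp, Category.assoc, h1, LieObj.extAct, Category.assoc,
        ← MonoidalCategory.whiskerLeft_comp_assoc, biprod.inr_snd, hdesc, biprod.lift_desc,
        add_comm]
      simp
    obtain ⟨g, hg, hg'⟩ := hA.existsUnique_hom ⟨B.X.X⟩ f₁ hc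
    -- The given action of L on B and the commutators with f₁ are derivations that agree on
    -- generators, so they agree on the image of A.
    have hlin : L.X ◁ g.hom ≫ B.X.act = adop j ≫ g.hom := by
      have hgl := lmul_hom j g.hom
      rw [hg] at hgl
      have hd : L.X ◁ μ[B.X.X] ≫ B.X.act =
          (actL B.X.act B.X.X + actR B.X.X B.X.act) ≫ μ[B.X.X] := μ[B.X].comm
      rw [adop_hom, hg]
      refine hA.generates.ext_left (lmul f₁) ?_ ?_
      · rw [icomm_whiskerLeft_comp _ hgl, icomm_whiskerLeft_comp _ hgl,
          icomm_lmul_of_derivation f₁ hd, icomm_adop_lmul, icomm_lmul, hl]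
      · rw [← MonoidalCategory.whiskerLeft_comp_assoc, ← MonoidalCategory.whiskerLeft_comp_assoc,
          IsMonHom.one_hom g.hom]
        exact (η[B.X].comm.trans zero_comp).trans (whiskerLeft_one_adop f₁).symm
    let G : (curvedAdjointAlgebra hj).X ⟶ B.X := ⟨g.hom, hlin⟩
    have : IsMonHom G :=
      ⟨LieMod.hom_ext (IsMonHom.one_hom g.hom), LieMod.hom_ext (IsMonHom.mul_hom g.hom)⟩
    refine ⟨⟨G⟩, LieMod.hom_ext ?_, fun g₂ hg₂ => ?_⟩
    · change biprod.desc η[A] j ≫ g.hom = φ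
      rw [hdesc]
      apply biprod.hom_ext'
      · rw [biprod.inl_desc_assoc, biprod.inl_desc]
        exact IsMonHom.one_hom g.hom
      · rw [biprod.inr_desc_assoc, biprod.inr_desc, hg]
    · have : IsMonHom (M := A) (N := B.X.X) g₂.hom.hom :=
        ⟨congrArg LieMod.Hom.hom (IsMonHom.one_hom g₂.hom),
          congrArg LieMod.Hom.hom (IsMonHom.mul_hom g₂.hom)⟩
      let ψ : A ⟶ B.X.X := g₂.hom.hom
      have h1 : biprod.desc η[A] j ≫ ψ = φ := congrArg LieMod.Hom.hom hg₂
      have h2 := hg' ⟨ψ⟩ (by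
        change j ≫ ψ = biprod.inr ≫ φ
        rw [← h1, biprod.inr_desc_assoc])
      exact Mon.Hom.ext (LieMod.hom_ext (congrArg Mon.Hom.hom h2))

end Central
-- Invariants and their comparison with a subalgebra
section Invariants
open MonObj
variable {C : Type u} [Category.{v} C] [Preadditive C] [MonoidalCategory C] [MonoidalPreadditive C]
  [SymmetricCategory C]

lemma one_invariantsIncl {L : LieObj C} [(LieMod.trivial L).IsLeftAdjoint] (A : Mon (LieMod L)) :
    η[((invariants L).mapMon.obj A).X] ≫ invariantsIncl A.X = η[A.X].hom := by
  have h1 := congrArg LieMod.Hom.hom (invariantsAdj L).map_ε_comp_counit_app_unit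
  have h2 := congrArg LieMod.Hom.hom ((invariantsAdj L).counit.naturality η[A.X])
  change Functor.LaxMonoidal.ε (invariants L) ≫ invariantsIncl (𝟙_ (LieMod L)) = 𝟙 _ at h1
  change (invariants L).map η[A.X] ≫ invariantsIncl A.X =
    invariantsIncl (𝟙_ (LieMod L)) ≫ η[A.X].hom at h2
  change (Functor.LaxMonoidal.ε (invariants L) ≫ (invariants L).map η[A.X]) ≫ _ = _
  rw [Category.assoc, h2, reassoc_of% h1]

lemma FreeOn.of_iso {X : C} {br : X ⊗ X ⟶ X} {ω : X ⊗ X ⟶ 𝟙_ C} {A A' : C} [MonObj A] [MonObj A']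
    {i : X ⟶ A} (h : FreeOn br ω A i) (e : A ⟶ A') [IsIso e] [IsMonHom e] :
    FreeOn br ω A' (i ≫ e) := by
  have hl := lmul_hom i e
  have hl' : lmul (i ≫ e) ≫ inv e = X ◁ inv e ≫ lmul i := by
    rw [IsIso.comp_inv_eq, Category.assoc, hl, ← MonoidalCategory.whiskerLeft_comp_assoc]
    simp
  have hη : η[A'] ≫ inv e = η[A] := by
    rw [IsIso.comp_inv_eq, IsMonHom.one_hom]
  have key : ∀ {Y M : C} {b : X ⊗ M ⟶ M} {F : A' ⊗ Y ⟶ M},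
      opw (lmul (i ≫ e)) Y ≫ F = X ◁ F ≫ b →
      opw (lmul i) Y ≫ e ▷ Y ≫ F = X ◁ (e ▷ Y ≫ F) ≫ b := by
    intro Y M b F hF
    have h1 := congrArg (fun t => opw t Y ≫ F) hl
    simp only [opw_comp, Category.assoc] at h1
    rw [h1, MonoidalCategory.whiskerLeft_comp, Category.assoc, ← hF]
    simp [opw]
  refine ⟨h.curved.of_iso (inv e) hl', fun Y M b F h1 h2 => ?_, fun Y M b hb f => ?_⟩
  · rw [← cancel_epi (e ▷ Y), comp_zero]
    refine h.generates Y M b _ (key h1) ?_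
    rw [← comp_whiskerRight_assoc, IsMonHom.one_hom, h2]
  · obtain ⟨F, h1, h2⟩ := h.exists_ext Y M b hb f
    refine ⟨inv e ▷ Y ≫ F, ?_, ?_⟩
    · have h3 := congrArg (fun t => opw t Y ≫ F) hl'
      simp only [opw_comp, Category.assoc] at h3
      rw [h3, MonoidalCategory.whiskerLeft_comp, Category.assoc, ← h1]
      simp [opw]
    · rw [← comp_whiskerRight_assoc, hη, h2]

/-- The universal property for algebras already determines U up to isomorphism, so the stronger
freeness for modules is transported from one model to all others. -/
lemma IsEnvelopingAlgebra.freeOn {L : LieObj C} {U U' : Mon C} {i : L.X ⟶ U.X} {i' : L.X ⟶ U'.X}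
    (hU : IsEnvelopingAlgebra L U i) (hU' : FreeOn L.bracket 0 U'.X i') :
    FreeOn L.bracket 0 U.X i := by
  have h := hU'.isEnvelopingAlgebra
  obtain ⟨f, hf, -⟩ := h.existsUnique U i hU.isLieHom
  obtain ⟨g, hg, -⟩ := hU.existsUnique U' i' h.isLieHom
  have h1 : f ≫ g = 𝟙 U' := (h.existsUnique U' i' h.isLieHom).unique
    (by rw [Mon.comp_hom', reassoc_of% hf, hg]) (Category.comp_id _)
  have h2 : g ≫ f = 𝟙 U := (hU.existsUnique U i hU.isLieHom).unique
    (by rw [Mon.comp_hom', reassoc_of% hg, hf]) (Category.comp_id _)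
  have : IsIso f.hom :=
    ⟨g.hom, congrArg Mon.Hom.hom h1, congrArg Mon.Hom.hom h2⟩
  have h3 := hU'.of_iso f.hom
  rwa [hf] at h3

lemma IsUnitalEnvelopingAlgebra.nonempty_iso {M : UnitalLieObj C} {E E' : Mon C} {j : M.X ⟶ E.X}
    {j' : M.X ⟶ E'.X} (h : IsUnitalEnvelopingAlgebra M E j)
    (h' : IsUnitalEnvelopingAlgebra M E' j') : Nonempty (E ≅ E') := by
  obtain ⟨f, hf, -⟩ := h.existsUnique E' j' h'.isLieHom h'.unit_comp
  obtain ⟨g, hg, -⟩ := h'.existsUnique E j h.isLieHom h.unit_comp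
  exact ⟨f, g, (h.existsUnique E j h.isLieHom h.unit_comp).unique
    (by rw [Mon.comp_hom', reassoc_of% hf, hg]) (Category.comp_id _),
    (h'.existsUnique E' j' h'.isLieHom h'.unit_comp).unique
    (by rw [Mon.comp_hom', reassoc_of% hg, hf]) (Category.comp_id _)⟩

variable {Q : LieObj C} {L : LieObj (LieMod Q)}

/-- By the Leibniz rule x (q u) is, up to signs, a combination of q (x u) and (q x) u, which both
vanish for u invariant. So invariants of L are stable under Q. -/
lemma LieMod.whiskerLeft_act_eq_zero (M : LieMod L) {K : C} (k : K ⟶ M.X.X)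
    (hk : L.X.X ◁ k ≫ M.act.hom = 0) : L.X.X ◁ (Q.X ◁ k ≫ M.X.act) ≫ M.act.hom = 0 := by
  have h1 : Q.X ◁ M.act.hom ≫ M.X.act =
      (actL L.X.act M.X.X + actR L.X.X M.X.act) ≫ M.act.hom := M.act.comm
  have h2 := Q.X ◁ L.X.X ◁ k ≫= h1
  rw [← MonoidalCategory.whiskerLeft_comp_assoc, hk, Preadditive.add_comp, Preadditive.comp_add,
    reassoc_of% (actL_whiskerLeft L.X.act k), hk, actR_eq_sw, Category.assoc,
    sw_naturality_assoc, ← MonoidalCategory.whiskerLeft_comp_assoc] at h2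
  rw [← cancel_epi (sw Q.X L.X.X K)]
  simpa using h2.symm

/-- The algebra `B` is the subalgebra of `L`-invariants of `E`, and the action of `Q` vanishes on
it. -/
structure IsFlatInvariants (E : Mon (LieMod L)) (B : Mon C) (θ : B.X ⟶ E.X.X.X) : Prop where
  mono : Mono θ
  isMonHom : IsMonHom θ
  killed : L.X.X ◁ θ ≫ E.X.act.hom = 0
  flat : Q.X ◁ θ ≫ E.X.X.act = 0
  exists_lift : ∀ {Y : C} (u : Y ⟶ E.X.X.X), L.X.X ◁ u ≫ E.X.act.hom = 0 → ∃ g, g ≫ θ = u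

namespace IsFlatInvariants
variable {E : Mon (LieMod L)} {B : Mon C} {θ : B.X ⟶ E.X.X.X}

lemma of_iso (h : IsFlatInvariants E B θ) {E' : Mon (LieMod L)} (e : E ≅ E') :
    IsFlatInvariants E' B (θ ≫ e.hom.hom.hom.hom) := by
  let f : E.X.X.X ⟶ E'.X.X.X := e.hom.hom.hom.hom
  let g : E'.X.X.X ⟶ E.X.X.X := e.inv.hom.hom.hom
  have hfg : f ≫ g = 𝟙 _ :=
    congrArg (fun t : E ⟶ E => t.hom.hom.hom) e.hom_inv_id
  have hgf : g ≫ f = 𝟙 _ :=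
    congrArg (fun t : E' ⟶ E' => t.hom.hom.hom) e.inv_hom_id
  have hf : IsIso f := ⟨g, hfg, hgf⟩
  have hfm : IsMonHom f :=
    ⟨congrArg (fun t => t.hom.hom) (IsMonHom.one_hom e.hom.hom),
      congrArg (fun t => t.hom.hom) (IsMonHom.mul_hom e.hom.hom)⟩
  have h1 : L.X.X ◁ f ≫ E'.X.act.hom = E.X.act.hom ≫ f :=
    congrArg LieMod.Hom.hom e.hom.hom.comm
  have h2 : L.X.X ◁ g ≫ E.X.act.hom = E'.X.act.hom ≫ g :=
    congrArg LieMod.Hom.hom e.inv.hom.comm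
  have h3 : Q.X ◁ f ≫ E'.X.X.act = E.X.X.act ≫ f := e.hom.hom.hom.comm
  have := h.mono
  have := h.isMonHom
  change IsFlatInvariants E' B (θ ≫ f)
  refine ⟨inferInstance, inferInstance, ?_, ?_, fun u hu => ?_⟩
  · rw [MonoidalCategory.whiskerLeft_comp, Category.assoc, h1, reassoc_of% h.killed, zero_comp]
  · rw [MonoidalCategory.whiskerLeft_comp, Category.assoc, h3, reassoc_of% h.flat, zero_comp]
  · obtain ⟨v, hv⟩ := h.exists_lift (u ≫ g) (by
      rw [MonoidalCategory.whiskerLeft_comp, Category.assoc, h2, reassoc_of% hu, zero_comp])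
    exact ⟨v, by rw [reassoc_of% hv, hgf, Category.comp_id]⟩

/-- The invariants of `E` are the module `B` with zero action. -/
lemma exists_isIso (h : IsFlatInvariants E B θ) [(LieMod.trivial L).IsLeftAdjoint] :
    ∃ ψ : B.X ⟶ ((invariants L).mapMon.obj E).X.X, IsIso ψ ∧ IsMonHom ψ ∧
      ((invariants L).mapMon.obj E).X.act = 0 := by
  have := h.mono
  have := h.isMonHom
  let A : Mon (LieMod Q) := (invariants L).mapMon.obj E
  let n : A.X ⟶ E.X.X := invariantsIncl E.X
  have hn : L.X.X ◁ n.hom ≫ E.X.act.hom = 0 :=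
    congrArg LieMod.Hom.hom (act_invariantsIncl E.X)
  obtain ⟨g, hg⟩ := h.exists_lift n.hom hn
  have hact : A.X.act ≫ g = 0 := by
    rw [← cancel_mono θ, Category.assoc, hg, ← n.comm, ← hg, MonoidalCategory.whiskerLeft_comp,
      Category.assoc, h.flat, comp_zero, zero_comp]
  -- As Q acts by zero on the image, θ is a morphism of Q-modules from the trivial module. It and
  -- the inclusion of the invariants are monomorphisms that factor through each other.
  let θ' : (LieMod.trivial Q).obj B.X ⟶ E.X.X := ⟨θ, h.flat.trans zero_comp.symm⟩
  let Ψ : (LieMod.trivial Q).obj B.X ⟶ A.X := invariantsLift E.X θ' (LieMod.hom_ext h.killed)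
  let ψ : B.X ⟶ A.X.X := Ψ.hom
  have hΨ : Ψ ≫ n = θ' := invariantsLift_incl _ _ _
  have hψ : ψ ≫ n.hom = θ := congrArg LieMod.Hom.hom hΨ
  let G : A.X ⟶ (LieMod.trivial Q).obj B.X := ⟨g, comp_zero.trans hact.symm⟩
  have hG : G ≫ θ' = n := LieMod.hom_ext hg
  have h1 : ψ ≫ g = 𝟙 B.X := by
    rw [← cancel_mono θ, Category.assoc, hg, hψ, Category.id_comp]
  have hn' : Mono n := inferInstanceAs (Mono (invariantsIncl E.X))
  have h2 : G ≫ Ψ = 𝟙 _ := by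
    rw [← cancel_mono n, Category.assoc, hΨ, hG, Category.id_comp]
  have h3 : g ≫ ψ = 𝟙 _ := congrArg LieMod.Hom.hom h2
  have hgi : IsIso g := ⟨ψ, h3, h1⟩
  have hnm : Mono n.hom := by
    rw [← hg]
    infer_instance
  have hn1 : η[A.X.X] ≫ n.hom = η[E.X.X.X] := congrArg LieMod.Hom.hom (one_invariantsIncl E)
  have hn2 : μ[A.X.X] ≫ n.hom = (n.hom ⊗ₘ n.hom) ≫ μ[E.X.X.X] :=
    congrArg LieMod.Hom.hom (mul_invariantsIncl E)
  refine ⟨ψ, ⟨g, h1, h3⟩, ⟨?_, ?_⟩, (cancel_mono g).1 (hact.trans zero_comp.symm)⟩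
  · rw [← cancel_mono n.hom, Category.assoc, hψ]
    exact (IsMonHom.one_hom θ).trans hn1.symm
  · rw [← cancel_mono n.hom, Category.assoc, hψ]
    refine (IsMonHom.mul_hom θ).trans ?_
    refine Eq.trans ?_ (Category.assoc _ _ _).symm
    refine Eq.trans ?_ (congrArg ((ψ ⊗ₘ ψ) ≫ ·) hn2).symm
    rw [tensorHom_comp_tensorHom_assoc, hψ]

end IsFlatInvariants

lemma isMonHom_quotientAlgebra [HasCokernels C] [∀ X : C, PreservesFiniteColimits (tensorLeft X)]
    {Z : C} [MonObj Z] {B : C} (b : B ⟶ Z) (hl : b ▷ Z ≫ μ[Z] ≫ cokernel.π b = 0)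
    (hr : Z ◁ b ≫ μ[Z] ≫ cokernel.π b = 0) :
    IsMonHom (M := Z) (N := (quotientAlgebra b hl hr).X) (cokernel.π b) :=
  ⟨rfl, (Classical.choose_spec (exists_quotientMul b hl hr)).symm⟩

end Invariants

/-! ### Cohomology of an algebra with zero differential -/

section Cohomology
open MonObj
variable {C : Type u} [Category.{v} C] [Abelian C] [MonoidalCategory C] [MonoidalPreadditive C]
  [SymmetricCategory C] [Linear ℚ C] [Supercategory C]
namespace Supercategory

/-- The cohomology of an algebra with zero differential. -/
lemma nonempty_cohomology_iso (A : Mon (LieMod (Q C))) (hA : A.X.act = 0) {B : Mon C}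
    (ψ : B.X ⟶ A.X.X) [IsIso ψ] [IsMonHom ψ] : Nonempty (cohomology A ≅ B) := by
  -- When d = 0, all of A consists of cycles and the boundary map is zero, so the inclusion of
  -- cycles and the projection to cohomology are both invertible.
  let Z : Mon C := (invariants (Q C)).mapMon.obj A
  let n : Z.X ⟶ A.X.X := invariantsIncl A.X
  let s : A.X.X ⟶ Z.X := invariantsLift A.X (𝟙 A.X.X) (by rw [hA, comp_zero])
  have hs : s ≫ n = 𝟙 _ := invariantsLift_incl _ _ _
  have hn : Mono n := inferInstanceAs (Mono (invariantsIncl A.X))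
  have hs' : n ≫ s = 𝟙 _ := by
    rw [← cancel_mono n, Category.assoc, hs, Category.comp_id, Category.id_comp]
  have hsi : IsIso s := ⟨n, hs, hs'⟩
  have hb : boundary A.X = 0 := by
    rw [← cancel_mono (invariantsIncl A.X), boundary_incl, hA]
    exact zero_comp.symm
  have hπ : ∀ {Y W : C} (f : Y ⟶ W), f = 0 → IsIso (cokernel.π f) := by
    rintro Y W f rfl
    infer_instance
  let p : Z.X ⟶ (cohomology A).X := cokernel.π (boundary A.X)
  have hp : IsIso p := hπ _ hb
  have h1 : η[Z.X] ≫ n = η[A.X.X] := one_invariantsIncl A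
  have h2 : μ[Z.X] ≫ n = (n ⊗ₘ n) ≫ μ[A.X.X] := mul_invariantsIncl A
  have hpm : IsMonHom p := isMonHom_quotientAlgebra _ _ _
  have hsm : IsMonHom s :=
    ⟨by rw [← h1, Category.assoc, hs', Category.comp_id],
      by
        rw [← cancel_mono n, Category.assoc, hs, Category.assoc, h2,
          tensorHom_comp_tensorHom_assoc, hs]
        simp⟩
  let φ : B.X ≅ (cohomology A).X := asIso (ψ ≫ s ≫ p)
  have : IsMonHom φ.hom := inferInstanceAs (IsMonHom (ψ ≫ s ≫ p))
  exact ⟨(Mon.mkIso' φ).symm⟩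

theorem nonempty_LCohomology_iso (L₀ : LieObj C) [(tensorLeft L₀.X).IsLeftAdjoint]
    {E : Mon (LieMod (doubled L₀))} {B : Mon C} {θ : B.X ⟶ E.X.X.X}
    (h : IsFlatInvariants E B θ) : Nonempty (LCohomology L₀ E ≅ B) := by
  obtain ⟨ψ, h1, h2, h3⟩ := h.exists_isIso
  exact nonempty_cohomology_iso _ h3 ψ

end Supercategory
end Cohomology
-- The Weil algebra of a quadratic Lie algebra and the main theorem
section Main
open MonObj
variable {C : Type u} [Category.{v} C] [Abelian C] [MonoidalCategory C] [MonoidalPreadditive C]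
  [SymmetricCategory C] [Linear ℚ C] [Supercategory C]
namespace Supercategory

lemma hasColimitsOfShape_nat : HasColimitsOfShape (Discrete ℕ) C := by
  have := Supercategory.hasCountableCoproducts (C := C)
  infer_instance

theorem exists_freeOn {X : C} (br : X ⊗ X ⟶ X) (ω : X ⊗ X ⟶ 𝟙_ C) :
    ∃ (A : Mon C) (i : X ⟶ A.X), FreeOn br ω A.X i := by
  have := hasColimitsOfShape_nat (C := C)
  have (X : C) := Supercategory.tensor_coproducts X
  exact SuperCat.exists_freeOn br ω

variable (L₀ : LieObj C)

lemma evenIncl_act : P C ◁ evenIncl (P C) L₀.X ≫ (doubled L₀).X.act = 0 := by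
  change P C ◁ evenIncl (P C) L₀.X ≫ (actL (dualNumbersD (oddPairing C)) L₀.X +
    actR (𝟙_ C ⊞ P C) (0 : P C ⊗ L₀.X ⟶ L₀.X)) = 0
  rw [actR_zero, add_zero, evenIncl, MonoidalCategory.whiskerLeft_comp, Category.assoc, actL,
    associator_inv_naturality_middle_assoc, ← comp_whiskerRight, dualNumbersD,
    ← MonoidalCategory.whiskerLeft_comp_assoc]
  simp

/-- On the double, d maps P ⊗ L₀ to L₀ through P ⊗ P ≅ 𝟙_ C; this is the map k required in
`IsWeil.parity_derivation`. -/
lemma oddIncl_act : P C ◁ oddIncl (P C) L₀.X ≫ (doubled L₀).X.act =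
    ((α_ _ _ _).inv ≫ oddPairing C ▷ L₀.X ≫ (λ_ _).hom) ≫ evenIncl (P C) L₀.X := by
  change P C ◁ oddIncl (P C) L₀.X ≫ (actL (dualNumbersD (oddPairing C)) L₀.X +
    actR (𝟙_ C ⊞ P C) (0 : P C ⊗ L₀.X ⟶ L₀.X)) = _
  rw [actR_zero, add_zero, oddIncl, actL,
    associator_inv_naturality_middle_assoc, ← comp_whiskerRight, dualNumbersD,
    ← MonoidalCategory.whiskerLeft_comp_assoc, evenIncl]
  simp

variable [QuadraticLieObj L₀]

/-- Three layers are stacked: an algebra in C with the relations of the central extension, the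
derivation extending d, and the action of L by commutators. The invariants are then found inside the
centralizer of P ⊗ L₀. -/
theorem exists_weilAlgebra : ∃ (E : Mon (LieMod (doubled L₀))) (j : (weil L₀).X ⟶ E.X),
    IsUnitalEnvelopingAlgebra (weil L₀) E j ∧
    ∀ (U : Mon C) (i : L₀.X ⟶ U.X) (hi : IsLieHom L₀ (LieObj.ofMon U.X) i),
      FreeOn L₀.bracket 0 U.X i →
      ∃ θ, IsFlatInvariants E ((invariants L₀).mapMon.obj (adjointAlgebra L₀ U i hi)) θ := by
  have := hasColimitsOfShape_nat (C := C)
  have (X : C) := Supercategory.tensor_coproducts X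
  obtain ⟨A', j', hA'⟩ := exists_freeOn (doubled L₀).bracket.hom (weilCocycle L₀).hom
  obtain ⟨A, j, hA, hAj⟩ := hA'.exists_module
  have hj := (isCurved_lmul_iff j).1 hA.curved
  refine ⟨_, _, hA.isUnitalEnvelopingAlgebra hj (isCocycle_weilCocycle L₀), ?_⟩
  intro U i hi hU
  let ζ : (𝟙_ C ⊞ P C) ⊗ L₀.X ⟶ A.X.X := j.hom
  have hζ : FreeOn (doubleBracket (P C) L₀) (doubleCocycle (oddPairing C) L₀) A.X.X ζ := hAj
  have hW := hζ.isWeil (braiding_P C) (oddPairing C)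
  let f₀ : L₀.X ⟶ A.X.X := evenIncl (P C) L₀.X ≫ ζ
  let f₁ : P C ⊗ L₀.X ⟶ A.X.X := oddIncl (P C) L₀.X ≫ ζ
  obtain ⟨θ, hθ, hθm, hθ1, hθ2, hθ3, hθ4⟩ := hW.exists_centralizer hU
  have hθ2' : (P C ⊗ L₀.X) ◁ θ ≫ adop f₁ = 0 := hθ2
  have hθ4' : ∀ {Y : C} (u : Y ⟶ A.X.X), (P C ⊗ L₀.X) ◁ u ≫ adop f₁ = 0 → ∃ g, g ≫ θ = u := hθ4
  let M : LieMod L₀ := (adjointAlgebra L₀ U i hi).X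
  let B : Mon C := (invariants L₀).mapMon.obj (adjointAlgebra L₀ U i hi)
  let n : B.X ⟶ U.X := invariantsIncl M
  have hn : Mono n := inferInstanceAs (Mono (invariantsIncl M))
  have hn0 : L₀.X ◁ n ≫ adop i = 0 := act_invariantsIncl M
  have e0 : evenIncl (P C) L₀.X ▷ A.X.X ≫ adop ζ = adop f₀ := by simp [adop, f₀]
  have e1 : oddIncl (P C) L₀.X ▷ A.X.X ≫ adop ζ = adop f₁ := by simp [adop, f₁]
  -- Invariance under L splits into commuting with P ⊗ L₀, which places u in the image of θ, and
  -- commuting with L₀.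
  have hk : ∀ {Y : C} (u : Y ⟶ A.X.X), ((𝟙_ C ⊞ P C) ⊗ L₀.X) ◁ u ≫ adop ζ = 0 ↔
      L₀.X ◁ u ≫ adop f₀ = 0 ∧ (P C ⊗ L₀.X) ◁ u ≫ adop f₁ = 0 := by
    intro Y u
    rw [← e0, ← e1, whisker_exchange_assoc, whisker_exchange_assoc]
    constructor
    · intro h
      rw [h, comp_zero, comp_zero]
      exact ⟨rfl, rfl⟩
    · rintro ⟨h0, h1⟩
      exact hom_ext_double (h0.trans comp_zero.symm) (h1.trans comp_zero.symm)
  have hkill : ((𝟙_ C ⊞ P C) ⊗ L₀.X) ◁ (n ≫ θ) ≫ adop ζ = 0 := by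
    rw [hk, MonoidalCategory.whiskerLeft_comp, MonoidalCategory.whiskerLeft_comp, Category.assoc,
      Category.assoc, hθ2', hθ3, reassoc_of% hn0, zero_comp, comp_zero]
    exact ⟨rfl, rfl⟩
  let d : P C ⊗ A.X.X ⟶ A.X.X := A.X.act
  have hd : P C ◁ μ[A.X.X] ≫ d = (actL d A.X.X + actR A.X.X d) ≫ μ[A.X.X] := μ[A.X].comm
  have hdη : P C ◁ η[A.X.X] ≫ d = 0 := η[A.X].comm.trans zero_comp
  let q : P C ⊗ ((𝟙_ C ⊞ P C) ⊗ L₀.X) ⟶ (𝟙_ C ⊞ P C) ⊗ L₀.X := (doubled L₀).X.act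
  have hq0 : P C ◁ evenIncl (P C) L₀.X ≫ q = 0 := evenIncl_act L₀
  have hq1 : P C ◁ oddIncl (P C) L₀.X ≫ q =
    ((α_ _ _ _).inv ≫ oddPairing C ▷ L₀.X ≫ (λ_ _).hom) ≫ evenIncl (P C) L₀.X := oddIncl_act L₀
  have hdζ : P C ◁ ζ ≫ d = q ≫ ζ := j.comm
  have hd0 : icomm d (lmul f₀) (lmul f₀) = 0 := by
    rw [icomm_lmul_of_derivation f₀ hd, MonoidalCategory.whiskerLeft_comp, Category.assoc, hdζ,
      reassoc_of% hq0, zero_comp, opw_zero, zero_comp]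
  have hd1 : icomm d (lmul f₁) (lmul f₁) =
      opw ((α_ _ _ _).inv ≫ oddPairing C ▷ L₀.X ≫ (λ_ _).hom) A.X.X ≫ lmul f₀ := by
    rw [icomm_lmul_of_derivation f₁ hd, MonoidalCategory.whiskerLeft_comp, Category.assoc, hdζ,
      reassoc_of% hq1]
    simp [opw, lmul, f₀]
  -- The differential of an invariant is invariant, so it commutes with P ⊗ L₀ and lies in the image
  -- of θ; the parity argument then makes it vanish.
  have hflat : P C ◁ (n ≫ θ) ≫ d = 0 := by
    obtain ⟨g', hg'⟩ := hθ4' (P C ◁ (n ≫ θ) ≫ d)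
      ((hk _).1 (LieMod.whiskerLeft_act_eq_zero (curvedAdjointAlgebra hj).X (n ≫ θ) hkill)).2
    exact hW.whiskerLeft_derivation_eq_zero hd0 hd1 hdη hU.generates hθ1 (IsMonHom.one_hom θ)
      hg'.symm
  have hnm : IsMonHom n := ⟨one_invariantsIncl _, mul_invariantsIncl _⟩
  refine ⟨n ≫ θ, ⟨inferInstanceAs (Mono (n ≫ θ)), inferInstanceAs (IsMonHom (n ≫ θ)), hkill, hflat, ?_⟩⟩
  · intro Y u hu
    obtain ⟨h0, h1⟩ := (hk u).1 hu
    obtain ⟨g, hg⟩ := hθ4' u h1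
    -- Invariance descends along θ, which is equivariant and mono.
    have hg0 : L₀.X ◁ g ≫ adop i = 0 := by
      rw [← cancel_mono θ, Category.assoc, ← hθ3, ← MonoidalCategory.whiskerLeft_comp_assoc, hg,
        h0, zero_comp]
    let g' : Y ⟶ B.X := invariantsLift M g hg0
    have h2 : g' ≫ n = g := invariantsLift_incl _ _ _
    exact ⟨g', (Category.assoc g' n θ).symm.trans ((congrArg (· ≫ θ) h2).trans hg)⟩

end Supercategory
end Main
end SuperCat
end
theorem mainTheorem8 {C : Type u} [CategoryTheory.Category.{v} C] [CategoryTheory.Abelian C]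
    [MonoidalCategory C] [MonoidalPreadditive C] [SymmetricCategory C] [Linear ℚ C]
    [SuperCat.Supercategory C] (L₀ : SuperCat.LieObj C) [SuperCat.QuadraticLieObj L₀] :
    (∃ (U : Mon C) (i : L₀.X ⟶ U.X), SuperCat.IsEnvelopingAlgebra L₀ U i) ∧
    (∃ (E : Mon (SuperCat.LieMod (SuperCat.Supercategory.doubled L₀)))
      (j : (SuperCat.Supercategory.weil L₀).X ⟶ E.X),
      SuperCat.IsUnitalEnvelopingAlgebra (SuperCat.Supercategory.weil L₀) E j) ∧
    ∀ (U : Mon C) (i : L₀.X ⟶ U.X) (hU : SuperCat.IsEnvelopingAlgebra L₀ U i)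
      (E : Mon (SuperCat.LieMod (SuperCat.Supercategory.doubled L₀)))
      (j : (SuperCat.Supercategory.weil L₀).X ⟶ E.X),
      SuperCat.IsUnitalEnvelopingAlgebra (SuperCat.Supercategory.weil L₀) E j →
      Nonempty (SuperCat.Supercategory.LCohomology L₀ E ≅
        (SuperCat.invariants L₀).mapMon.obj
          (SuperCat.adjointAlgebra L₀ U i hU.isLieHom)) := by
  obtain ⟨U₀, i₀, hU₀⟩ := SuperCat.Supercategory.exists_freeOn L₀.bracket 0
  obtain ⟨E₀, j₀, hE₀, hH⟩ := SuperCat.Supercategory.exists_weilAlgebra L₀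
  refine ⟨⟨U₀, i₀, hU₀.isEnvelopingAlgebra⟩, ⟨E₀, j₀, hE₀⟩, fun U i hU E j hE => ?_⟩
  -- Both U and E are arbitrary models: freeness passes to U from U₀, and the description of the
  -- invariants passes from E₀ to E.
  obtain ⟨θ, hθ⟩ := hH U i hU.isLieHom (hU.freeOn hU₀)
  obtain ⟨e⟩ := hE₀.nonempty_iso hE
  exact SuperCat.Supercategory.nonempty_LCohomology_iso L₀ (hθ.of_iso e)
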